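/- Let $(M,g)$ be a non-empty two-dimensional orientable smooth Riemannian manifold (Hausdorff, second countable, without boundary; neither compactness, connectedness nor bounded geometry is assumed), and let $\mu=\mathrm{vol}(g)$ be its Riemannian volume form for a choice of orientation. Let $\mathfrak X(M)$ be the space of compactly supported smooth vector fields on $M$, let $\mathrm{Diff}(M)$ be the identity component of the group of compactly supported smooth diffeomorphisms of $M$, and let $$\mathrm{Diff}_\mu(M)=\{\varphi\in\mathrm{Diff}(M):\varphi^*\mu=\mu\}.$$ For $s\in\mathbb R$, for smooth charts $\kappa_i:U_i\to\mathbb R^2$ of $M$ and a locally finite smooth partition of unity $(\chi_i)$ on $M$ with $\operatorname{supp}\chi_i\subset U_i$, put $$\|u\|_{H^s}^2=\sum_i\sum_{k=1}^2\int_{\mathbb R^2}(1+|\xi|^2)^s\,\bigl|\mathcal F\bigl[((\kappa_i)_*(\chi_iu))^k\bigr](\xi)\bigr|^2\,d\xi ,\qquad u\in\mathfrak X(M).$$ A Sobolev inner product of order $s$ on $\mathfrak X(M)$ is a symmetric bilinear form $\langle\!\langle\cdot,\cdot\rangle\!\rangle$ on $\mathfrak X(M)$ such that, for every compact $K\subset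 M$, there is $C>0$ with $C^{-1}\|u\|_{H^s}^2\le\langle\!\langle u,u\rangle\!\rangle\le C\|u\|_{H^s}^2$ for all $u\in\mathfrak X(M)$ supported in $K$. Let $\langle\!\langle\cdot,\cdot\rangle\!\rangle$ be any Sobolev inner product of order $-\tfrac12$ (with respect to any such charts and partition of unity), and for $\varphi_0,\varphi_1\in\mathrm{Diff}_\mu(M)$ let $$d(\varphi_0,\varphi_1)=\inf\int_0^1\sqrt{\langle\!\langle u_t,u_t\rangle\!\rangle}\,dt,\qquad u_t=\partial_t\varphi(t)\circ\varphi(t)^{-1},$$ where the infimum is over all smooth paths $\varphi:[0,1]\to\mathrm{Diff}_\mu(M)$ (jointly smooth in time and space, and equal to the identity outside a compact set independent of $t$) with $\varphi(0)=\varphi_0$ and $\varphi(1)=\varphi_1$, and $\inf\emptyset=\infty$. This is the geodesic distance of the right-invariant $H^{-1/2}$ metric on $\mathrm{Diff}_\mu(M)$. Then this geodesic distance is degenerate: there are $\varphi,\psi\in\mathrm{Diff}_\mu(M)$ with $\varphi\ne\psi$ and $d(\varphi,\psi)=0$. -/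

import Mathlib

open scoped Manifold ContDiff ENNReal FourierTransform
open Bundle

/-- The model space of a two-dimensional manifold. -/
abbrev Plane : Type := EuclideanSpace ℝ (Fin 2)

section Geometry

variable {M : Type*} [TopologicalSpace M] [ChartedSpace Plane M] [IsManifold (𝓡 2) ∞ M]

/-- Smooth Riemannian metrics on a surface `M`. -/
abbrev SurfaceMetric (M : Type*) [TopologicalSpace M] [ChartedSpace Plane M]
    [IsManifold (𝓡 2) ∞ M] : Type _ :=
  ContMDiffRiemannianMetric (𝓡 2) ∞ Plane (fun x : M => TangentSpace (𝓡 2) x)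

/-- `μ` is a Riemannian volume form of `(M, g)`: a smooth 2-form which takes the values `±1` on
orthonormal frames, i.e. whose square is the Gram determinant. On an oriented surface the volume
form is the one of these which is positive on positive frames; conversely such a `μ` orients
`M`. So `M` is orientable exactly if such a form exists, and giving `μ` amounts to
choosing an orientation. -/
structure IsRiemannianVolumeForm (g : SurfaceMetric M)
    (μ : ∀ x : M, TangentSpace (𝓡 2) x →L[ℝ] TangentSpace (𝓡 2) x →L[ℝ] ℝ) : Prop where
  contMDiff : ContMDiff (𝓡 2) ((𝓡 2).prod 𝓘(ℝ, Plane →L[ℝ] Plane →L[ℝ] ℝ)) ∞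
    (fun x => TotalSpace.mk' (Plane →L[ℝ] Plane →L[ℝ] ℝ)
      (E := fun x : M => TangentSpace (𝓡 2) x →L[ℝ] TangentSpace (𝓡 2) x →L[ℝ] ℝ) x (μ x))
  alternating : ∀ (x : M) (v : TangentSpace (𝓡 2) x), μ x v v = 0
  sq_eq_gram : ∀ (x : M) (v w : TangentSpace (𝓡 2) x),
    (μ x v w) ^ 2 = g.inner x v v * g.inner x w w - (g.inner x v w) ^ 2

/-- The space `𝔛(M)` of compactly supported smooth vector fields on `M`. -/
def CompactVectorField (M : Type*) [TopologicalSpace M] [ChartedSpace Plane M]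
    [IsManifold (𝓡 2) ∞ M] :
    Submodule ℝ (ContMDiffSection (𝓡 2) Plane ∞ (fun x : M => TangentSpace (𝓡 2) x)) where
  carrier := {u | ∃ K : Set M, IsCompact K ∧ ∀ x ∉ K, u x = 0}
  zero_mem' := ⟨∅, isCompact_empty, fun _ _ => rfl⟩
  add_mem' := by
    rintro u v ⟨K, hK, hu⟩ ⟨L, hL, hv⟩
    refine ⟨K ∪ L, hK.union hL, fun x hx => ?_⟩
    have h1 := hu x (fun h => hx (Or.inl h))
    have h2 := hv x (fun h => hx (Or.inr h))
    rw [ContMDiffSection.coe_add, Pi.add_apply, h1, h2, add_zero]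
  smul_mem' := by
    rintro c u ⟨K, hK, hu⟩
    refine ⟨K, hK, fun x hx => ?_⟩
    rw [ContMDiffSection.coe_smul, Pi.smul_apply, hu x hx, smul_zero]

end Geometry

section Groups

variable {M : Type*} [TopologicalSpace M] [ChartedSpace Plane M]

/-- `c`, restricted to `[0,1]`, is a smooth path in the group of compactly supported
diffeomorphisms of `M`: it is jointly smooth, and the `c t` are the identity outside a common
compact set. -/
def IsSmoothDiffPath (c : ℝ → Diffeomorph (𝓡 2) (𝓡 2) M M ∞) : Prop :=
  ContMDiffOn (𝓘(ℝ, ℝ).prod (𝓡 2)) (𝓡 2) ∞ (fun p : ℝ × M => c p.1 p.2)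
    (Set.Icc (0 : ℝ) 1 ×ˢ Set.univ) ∧
  ∃ K : Set M, IsCompact K ∧ ∀ t ∈ Set.Icc (0 : ℝ) 1, ∀ x ∉ K, c t x = x

/-- `Diff(M)`: the identity component of the group of compactly supported smooth diffeomorphisms.
This group is locally smoothly contractible, so its components are its smooth path components. -/
def compactDiff (M : Type*) [TopologicalSpace M] [ChartedSpace Plane M] :
    Set (Diffeomorph (𝓡 2) (𝓡 2) M M ∞) :=
  {φ | ∃ c : ℝ → Diffeomorph (𝓡 2) (𝓡 2) M M ∞,
    IsSmoothDiffPath c ∧ c 0 = Diffeomorph.refl (𝓡 2) M ∞ ∧ c 1 = φ}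

/-- `Diff_μ(M)`: those `φ ∈ Diff(M)` for which `φ^* μ = μ`. -/
def volumeDiff (μ : ∀ x : M, TangentSpace (𝓡 2) x →L[ℝ] TangentSpace (𝓡 2) x →L[ℝ] ℝ) :
    Set (Diffeomorph (𝓡 2) (𝓡 2) M M ∞) :=
  {φ | φ ∈ compactDiff M ∧ ∀ (x : M) (v w : TangentSpace (𝓡 2) x),
    μ (φ x) (mfderiv (𝓡 2) (𝓡 2) φ x v) (mfderiv (𝓡 2) (𝓡 2) φ x w) = μ x v w}

end Groups

section Sobolev

/-- The square of the Sobolev norm of order `s` of a function on the plane, as an extended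
nonnegative real: `∫ (1 + |ξ|²)^s |𝓕 f (ξ)|² dξ`. -/
noncomputable def planeSobolevSq (s : ℝ) (f : Plane → ℝ) : ℝ≥0∞ :=
  ∫⁻ ξ : Plane, ENNReal.ofReal ((1 + ‖ξ‖ ^ 2) ^ s * ‖𝓕 (fun y : Plane => (f y : ℂ)) ξ‖ ^ 2)

/-- A family of smooth charts of `M` with a subordinate smooth (locally finite) partition of
unity. -/
structure SobolevAtlas (ι M : Type*) [TopologicalSpace M] [ChartedSpace Plane M] where
  chart : ι → OpenPartialHomeomorph M Plane
  chart_mem : ∀ i, chart i ∈ IsManifold.maximalAtlas (𝓡 2) ∞ M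
  weight : SmoothPartitionOfUnity ι (𝓡 2) M
  subordinate : weight.IsSubordinate (fun i => (chart i).source)

variable {ι M : Type*} [TopologicalSpace M] [ChartedSpace Plane M] [IsManifold (𝓡 2) ∞ M]

open Classical in
/-- The `k`-th component of `χ_i u` in the `i`-th chart, extended by zero to the plane. -/
noncomputable def SobolevAtlas.component (D : SobolevAtlas ι M) (i : ι) (k : Fin 2)
    (u : CompactVectorField M) (y : Plane) : ℝ :=
  if y ∈ (D.chart i).target then
    D.weight i ((D.chart i).symm y) *
      (EuclideanSpace.proj k : Plane →L[ℝ] ℝ)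
        (mfderiv (𝓡 2) (𝓡 2) (D.chart i) ((D.chart i).symm y) (u.1 ((D.chart i).symm y)))
  else 0

/-- The square of the Sobolev norm of order `s` of a vector field on `M`, given by charts and a
partition of unity. -/
noncomputable def SobolevAtlas.sobolevSq (D : SobolevAtlas ι M) (s : ℝ)
    (u : CompactVectorField M) : ℝ≥0∞ :=
  ∑' i : ι, ∑ k : Fin 2, planeSobolevSq s (D.component i k u)

/-- `B` is a Sobolev inner product of order `s` on `𝔛(M)`: a symmetric bilinear form whose
quadratic form is, on the fields supported in any given compact set, comparable to the square of
the Sobolev norm of order `s` (so that `B` is positive definite). The norms from different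
charts, partitions of unity, Riemannian metrics on `M`, or Fourier multipliers comparable to
`(1 + |ξ|²)^(s/2)` are all comparable on compact sets. On compact `M` this is the usual
equivalence of norms. -/
structure IsSobolevInnerProduct (D : SobolevAtlas ι M) (s : ℝ)
    (B : CompactVectorField M →ₗ[ℝ] CompactVectorField M →ₗ[ℝ] ℝ) : Prop where
  symm : ∀ u v, B u v = B v u
  comparable : ∀ K : Set M, IsCompact K → ∃ C : ℝ, 0 < C ∧
    ∀ u : CompactVectorField M, (∀ x ∉ K, u.1 x = 0) →
      ENNReal.ofReal (B u u) ≤ ENNReal.ofReal C * D.sobolevSq s u ∧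
      D.sobolevSq s u ≤ ENNReal.ofReal C * ENNReal.ofReal (B u u)

end Sobolev

section Distance

variable {M : Type*} [TopologicalSpace M] [ChartedSpace Plane M] [IsManifold (𝓡 2) ∞ M]

/-- A smooth path `t ↦ c t`, `t ∈ [0,1]`, in `Diff_μ(M)` from `φ` to `ψ`, with its right
logarithmic derivative `u t = ∂ₜ c t ∘ (c t)⁻¹`. On `[0,1]`, the only times that are used, the
field `u` is determined by `c`. -/
structure VolumeDiffPath
    (μ : ∀ x : M, TangentSpace (𝓡 2) x →L[ℝ] TangentSpace (𝓡 2) x →L[ℝ] ℝ)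
    (φ ψ : Diffeomorph (𝓡 2) (𝓡 2) M M ∞) where
  curve : ℝ → Diffeomorph (𝓡 2) (𝓡 2) M M ∞
  velocity : ℝ → CompactVectorField M
  smooth : IsSmoothDiffPath curve
  mem : ∀ t ∈ Set.Icc (0 : ℝ) 1, curve t ∈ volumeDiff μ
  start : curve 0 = φ
  finish : curve 1 = ψ
  hasDeriv : ∀ t ∈ Set.Icc (0 : ℝ) 1, ∀ x : M,
    HasMFDerivWithinAt 𝓘(ℝ, ℝ) (𝓡 2) (fun r : ℝ => curve r x) (Set.Icc (0 : ℝ) 1) t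
      (ContinuousLinearMap.toSpanSingleton ℝ
        ((velocity t).1 (curve t x) : TangentSpace (𝓡 2) (curve t x)))

/-- The length of a path for the right-invariant metric `⟪h, k⟫_φ = B (h ∘ φ⁻¹) (k ∘ φ⁻¹)`. -/
noncomputable def VolumeDiffPath.length
    {μ : ∀ x : M, TangentSpace (𝓡 2) x →L[ℝ] TangentSpace (𝓡 2) x →L[ℝ] ℝ}
    {φ ψ : Diffeomorph (𝓡 2) (𝓡 2) M M ∞} (p : VolumeDiffPath μ φ ψ)
    (B : CompactVectorField M →ₗ[ℝ] CompactVectorField M →ₗ[ℝ] ℝ) : ℝ≥0∞ :=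
  ∫⁻ t in Set.Icc (0 : ℝ) 1, ENNReal.ofReal (Real.sqrt (B (p.velocity t) (p.velocity t)))

/-- The geodesic distance on `Diff_μ(M)`: the infimal length of the smooth paths in `Diff_μ(M)`
with the given end points (`∞` if there are none). -/
noncomputable def geodesicDist
    (μ : ∀ x : M, TangentSpace (𝓡 2) x →L[ℝ] TangentSpace (𝓡 2) x →L[ℝ] ℝ)
    (B : CompactVectorField M →ₗ[ℝ] CompactVectorField M →ₗ[ℝ] ℝ)
    (φ ψ : Diffeomorph (𝓡 2) (𝓡 2) M M ∞) : ℝ≥0∞ :=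
  ⨅ p : VolumeDiffPath μ φ ψ, p.length B

end Distance

/-! ### Smooth dependence of flows on time and initial point, by the implicit function theorem. -/

section SmoothFlow

universe u

open Set Metric

/-! On a fixed compact set, the `H^(-1/2)` norm of a Hamiltonian field is controlled by the
`H^(1/2)` norm of its Hamiltonian, and in dimension two `H^(1/2)` just fails to control restrictions
to curves. Everything takes place in one Darboux chart and exploits this failure.

To translate a disc off itself, the Hamiltonian `z₁` of the translation is needed only near the
boundary circle, because the circle carries the disc with it. Cutting `z₁` off at distance about
`4^(-k)` from the circle gives a function with squared `L²` norm `O(4^(-k))` and with gradient of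
squared `L²` norm `O(4^k)`. The resulting fields are bounded in `H^(-1/2)`, but not small. Different
scales are nearly orthogonal, however: for `k ≤ l` the pairing is at most the `L²` norm of the
coarser field times the `H^(-1)` norm of the finer one, which is `O(2^(k-l))`. Hence the average
over the scales `k < n`, which still equals `z₁` near the circle, has squared norm `O(1/n)`
(`planeSobolevSq_average_le`), and the disc is displaced by paths of length `O(n^(-1/2))`
(`exists_isDyadicallyReachable_displacement`).

The displacing map `φ n` depends on `n`. A commutator removes this dependence: if `f` and `g` are
supported in the disc, then `f` commutes with the conjugate of `g` by `φ n`, and therefore the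
commutator of `f` and `g` is a product of four conjugates of `φ n` and its inverse by fixed maps
(`commutator_eq_of_commute`). Choosing `f` and `g` not to commute gives one nontrivial map which is
the end point of arbitrarily short paths (`exists_reachable_ne_one`).

The estimates use only `L²` bounds on the pieces of the Hamiltonian and on their gradients. Such
bounds survive conjugation, products, inverses and changes of charts up to constants independent of
`n`, so they bound the given inner product on the surface (`exists_sobolevSq_liftField_le`). A
Darboux chart (`IsRiemannianVolumeForm.exists_darboux_chart`) turns area preserving maps of the
plane into volume preserving maps of the surface. -/

set_option synthInstance.maxHeartbeats 400000 in
/-- Pointwise application of operators to vectors, on spaces of continuous functions. -/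
noncomputable def continuousMapApply (I : Type*) [TopologicalSpace I] [CompactSpace I]
    (E F : Type*) [NormedAddCommGroup E] [NormedSpace ℝ E] [NormedAddCommGroup F]
    [NormedSpace ℝ F] : C(I, E →L[ℝ] F) →L[ℝ] C(I, E) →L[ℝ] C(I, F) :=
  LinearMap.mkContinuous₂
    (LinearMap.mk₂ ℝ (fun (a : C(I, E →L[ℝ] F)) (γ : C(I, E)) => (⟨fun t => a t (γ t), by fun_prop⟩ : C(I, F)))
      (fun a b γ => by ext t; simp) (fun c a γ => by ext t; simp)
      (fun a γ δ => by ext t; simp) (fun c a γ => by ext t; simp)) 1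
    (fun a γ => by
      rw [one_mul]
      refine (ContinuousMap.norm_le _ (mul_nonneg (norm_nonneg a) (norm_nonneg γ))).2 fun t => ?_
      exact (a t).le_of_opNorm_le_of_le (a.norm_coe_le_norm t) (γ.norm_coe_le_norm t))

/-- Compact support is asked of the derivative only, because the displacement uses a field that is a
nonzero constant at infinity. -/
lemma exists_lipschitz_of_hasCompactSupport {E F : Type*} [NormedAddCommGroup E]
    [NormedSpace ℝ E] [NormedAddCommGroup F] [NormedSpace ℝ F] {f : E → F} (hf : ContDiff ℝ ∞ f)
    (hc : HasCompactSupport (fderiv ℝ f)) :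
    ∃ C : ℝ, 0 ≤ C ∧ ∀ x y, ‖f y - f x‖ ≤ C * ‖y - x‖ := by
  obtain ⟨C, hC⟩ := hc.exists_bound_of_continuous (hf.continuous_fderiv (by simp))
  exact ⟨C, (norm_nonneg _).trans (hC 0), fun x y =>
    convex_univ.norm_image_sub_le_of_norm_fderiv_le
      (fun w _ => (hf.differentiable (by simp)) w) (fun w _ => hC w) (mem_univ x) (mem_univ y)⟩

/-- A smooth function with compactly supported derivative satisfies a global second order
Taylor estimate. -/
lemma exists_taylor_bound {E F : Type*} [NormedAddCommGroup E] [NormedSpace ℝ E]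
    [NormedAddCommGroup F] [NormedSpace ℝ F] {f : E → F} (hf : ContDiff ℝ ∞ f)
    (hc : HasCompactSupport (fderiv ℝ f)) :
    ∃ C : ℝ, 0 ≤ C ∧ ∀ x y, ‖f y - f x - fderiv ℝ f x (y - x)‖ ≤ C * ‖y - x‖ ^ 2 := by
  have h1 : ContDiff ℝ ∞ (fderiv ℝ f) := hf.fderiv_right (by simp)
  obtain ⟨C, hC0, hlip⟩ := exists_lipschitz_of_hasCompactSupport h1 (hc.fderiv ℝ)
  refine ⟨C, hC0, fun x y => ?_⟩
  -- Mean value inequality for `f` minus its linear part at `x`: on the segment the derivative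
  -- differs from that at `x` by at most `C * ‖y - x‖`.
  have := (convex_segment x y).norm_image_sub_le_of_norm_fderiv_le' (𝕜 := ℝ) (f := f)
    (φ := fderiv ℝ f x) (C := C * ‖y - x‖) (fun w _ => (hf.differentiable (by simp)) w)
    (fun w hw => (hlip x w).trans ?_) (left_mem_segment ℝ x y) (right_mem_segment ℝ x y)
  · calc _ ≤ _ := this
      _ = _ := by ring
  · gcongr
    rw [segment_eq_image'] at hw
    obtain ⟨θ, hθ, rfl⟩ := hw
    simp only [add_sub_cancel_left, norm_smul, Real.norm_eq_abs, abs_of_nonneg hθ.1]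
    exact mul_le_of_le_one_left (norm_nonneg _) hθ.2

set_option synthInstance.maxHeartbeats 400000 in
/-- Composition with a smooth function with compactly supported derivative is a smooth operator
on continuous functions. -/
lemma contDiff_comp_continuousMap (I : Type*) [TopologicalSpace I] [CompactSpace I]
    {E F : Type u} [NormedAddCommGroup E] [NormedSpace ℝ E]
    [NormedAddCommGroup F] [NormedSpace ℝ F] {f : E → F} (hf : ContDiff ℝ ∞ f)
    (hc : HasCompactSupport (fderiv ℝ f)) :
    ContDiff ℝ ∞ (fun γ : C(I, E) => (⟨fun t => f (γ t), hf.continuous.comp γ.continuous⟩ : C(I, F))) := by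
  rw [contDiff_infty]
  intro n
  -- The Taylor remainder is uniform in `t`, hence quadratic in the sup norm. The target `F` is left
  -- free, within the universe of `E`, because the derivative is again a composition operator, now
  -- with values in `E →L[ℝ] F`; this drives the induction on the order of smoothness.
  have key : ∀ {F : Type u} [NormedAddCommGroup F] [NormedSpace ℝ F] {f : E → F}
      (hf : ContDiff ℝ ∞ f) (_ : HasCompactSupport (fderiv ℝ f)) (γ : C(I, E)), HasFDerivAt
      (fun γ : C(I, E) => (⟨fun t => f (γ t), hf.continuous.comp γ.continuous⟩ : C(I, F)))
      (continuousMapApply I E F ⟨fun t => fderiv ℝ f (γ t),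
        (hf.continuous_fderiv (by simp)).comp γ.continuous⟩) γ := by
    intro F _ _ f hf hc γ
    obtain ⟨C, hC0, hC⟩ := exists_taylor_bound hf hc
    rw [hasFDerivAt_iff_isLittleO_nhds_zero]
    refine Asymptotics.IsBigO.trans_isLittleO (g := fun h : C(I, E) => ‖h‖ ^ 2) ?_ ?_
    · refine Asymptotics.IsBigO.of_bound C (Filter.Eventually.of_forall fun h => ?_)
      rw [norm_pow, norm_norm]
      refine (ContinuousMap.norm_le _ (by positivity)).2 fun t => ?_
      have := hC (γ t) (γ t + h t)
      simp only [add_sub_cancel_left] at this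
      refine this.trans ?_
      gcongr
      exact h.norm_coe_le_norm t
    · simpa using Asymptotics.isLittleO_norm_pow_id (E' := C(I, E)) one_lt_two
  induction n generalizing F with
  | zero =>
    rw [Nat.cast_zero, contDiff_zero]
    exact continuous_iff_continuousAt.2 fun γ => (key hf hc γ).continuousAt
  | succ n ih =>
    rw [Nat.cast_succ]
    refine (contDiff_succ_iff_hasFDerivAt (n := n)).2 ⟨_, ?_, key hf hc⟩
    have h1 : ContDiff ℝ ∞ (fderiv ℝ f) := hf.fderiv_right (by simp)
    exact (continuousMapApply I E F).contDiff.comp (ih h1 (hc.fderiv ℝ))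

/-- Integration from `0`, as an operator on the continuous functions on `[-1,1]`. -/
noncomputable def integrateFromZero (E : Type*) [NormedAddCommGroup E] [NormedSpace ℝ E] :
    C(Icc (-1 : ℝ) 1, E) →L[ℝ] C(Icc (-1 : ℝ) 1, E) :=
  LinearMap.mkContinuous
    { toFun := fun γ => ⟨fun t => ∫ s in (0 : ℝ)..t, IccExtend (by norm_num) γ s,
        (intervalIntegral.continuous_primitive (fun a b =>
          (γ.continuous.Icc_extend' (h := by norm_num)).intervalIntegrable a b) 0).comp
          continuous_subtype_val⟩
      map_add' := fun γ δ => by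
        ext t
        simp only [ContinuousMap.coe_mk, ContinuousMap.add_apply]
        rw [← intervalIntegral.integral_add]
        · rfl
        · exact (γ.continuous.Icc_extend' (h := by norm_num)).intervalIntegrable _ _
        · exact (δ.continuous.Icc_extend' (h := by norm_num)).intervalIntegrable _ _
      map_smul' := fun c γ => by
        ext t
        simp only [ContinuousMap.coe_mk, ContinuousMap.smul_apply, RingHom.id_apply]
        rw [← intervalIntegral.integral_smul]
        rfl } 1
    (fun γ => by
      rw [one_mul]
      refine (ContinuousMap.norm_le _ (by positivity)).2 fun t => ?_
      have := intervalIntegral.norm_integral_le_of_norm_le_const (a := 0) (b := (t : ℝ))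
        (C := ‖γ‖) (f := IccExtend (by norm_num : (-1 : ℝ) ≤ 1) γ)
        (fun s _ => γ.norm_coe_le_norm _)
      refine this.trans (mul_le_of_le_one_right (norm_nonneg _) ?_)
      rw [sub_zero]
      exact abs_le.2 t.2)

lemma integrateFromZero_apply {E : Type*} [NormedAddCommGroup E] [NormedSpace ℝ E]
    (γ : C(Icc (-1 : ℝ) 1, E)) (t : Icc (-1 : ℝ) 1) :
    integrateFromZero E γ t = ∫ s in (0 : ℝ)..t, IccExtend (by norm_num) γ s := rfl

lemma norm_integrateFromZero_le (E : Type*) [NormedAddCommGroup E] [NormedSpace ℝ E] :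
    ‖integrateFromZero E‖ ≤ 1 := LinearMap.mkContinuous_norm_le _ zero_le_one _

/-- The left hand side `γ - x - s ∫₀ v(γ)` of the integral equation of the curves
`t ↦ y (s t)`, where `y` is the integral curve of `v` which starts at `x`. -/
noncomputable def flowEquation {E : Type u} [NormedAddCommGroup E] [NormedSpace ℝ E] {v : E → E}
    (hv : ContDiff ℝ ∞ v) (p : (ℝ × E) × C(Icc (-1 : ℝ) 1, E)) : C(Icc (-1 : ℝ) 1, E) :=
  p.2 - ContinuousMap.const _ p.1.2 - p.1.1 • integrateFromZero E
    ⟨fun t => v (p.2 t), hv.continuous.comp p.2.continuous⟩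

lemma contDiff_flowEquation {E : Type u} [NormedAddCommGroup E] [NormedSpace ℝ E] {v : E → E}
    (hv : ContDiff ℝ ∞ v) (hc : HasCompactSupport (fderiv ℝ v)) :
    ContDiff ℝ ∞ (flowEquation hv) := by
  have h1 := contDiff_comp_continuousMap (Icc (-1 : ℝ) 1) hv hc
  have h2 : ContDiff ℝ ∞ (fun p : (ℝ × E) × C(Icc (-1 : ℝ) 1, E) =>
      (ContinuousMap.const _ p.1.2 : C(Icc (-1 : ℝ) 1, E))) :=
    (LinearMap.mkContinuous (⟨⟨fun x : E => (ContinuousMap.const _ x : C(Icc (-1 : ℝ) 1, E)),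
      fun _ _ => rfl⟩, fun _ _ => rfl⟩ : E →ₗ[ℝ] C(Icc (-1 : ℝ) 1, E)) 1 (fun x => by
        rw [one_mul]
        exact (ContinuousMap.norm_le _ (norm_nonneg x)).2 fun t => le_rfl)).contDiff.comp
      (contDiff_snd.comp contDiff_fst)
  exact (contDiff_snd.sub h2).sub ((contDiff_fst.comp contDiff_fst).smul
    ((integrateFromZero E).contDiff.comp (h1.comp contDiff_snd)))

/-- The map `γ ↦ γ - flowEquation hv (p, γ)` is the Picard iteration. For `|p.1| * C < 1` it is a
contraction, which yields existence, uniqueness and invertibility of the partial derivative in `γ`.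
-/
lemma norm_flowEquation_sub_le {E : Type u} [NormedAddCommGroup E] [NormedSpace ℝ E] {v : E → E}
    (hv : ContDiff ℝ ∞ v) {C : ℝ} (hC0 : 0 ≤ C) (hC : ∀ x y, ‖v y - v x‖ ≤ C * ‖y - x‖)
    (p : ℝ × E) (γ δ : C(Icc (-1 : ℝ) 1, E)) :
    ‖(γ - flowEquation hv (p, γ)) - (δ - flowEquation hv (p, δ))‖ ≤ |p.1| * C * ‖γ - δ‖ := by
  have : (γ - flowEquation hv (p, γ)) - (δ - flowEquation hv (p, δ)) = p.1 • integrateFromZero E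
      ((⟨fun t => v (γ t), hv.continuous.comp γ.continuous⟩ : C(Icc (-1 : ℝ) 1, E)) -
       ⟨fun t => v (δ t), hv.continuous.comp δ.continuous⟩) := by
    rw [map_sub, smul_sub]; simp only [flowEquation]; abel
  rw [this, norm_smul, Real.norm_eq_abs, mul_assoc]
  gcongr
  refine ((integrateFromZero E).le_of_opNorm_le (norm_integrateFromZero_le E) _).trans ?_
  rw [one_mul]
  refine (ContinuousMap.norm_le _ (by positivity)).2 fun t => (hC _ _).trans ?_
  gcongr
  exact (γ - δ).norm_coe_le_norm t

lemma flowEquation_unique {E : Type u} [NormedAddCommGroup E] [NormedSpace ℝ E] {v : E → E}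
    (hv : ContDiff ℝ ∞ v) {C : ℝ} (hC0 : 0 ≤ C) (hC : ∀ x y, ‖v y - v x‖ ≤ C * ‖y - x‖)
    {p : ℝ × E} (hp : |p.1| * C < 1) {γ δ : C(Icc (-1 : ℝ) 1, E)}
    (hγ : flowEquation hv (p, γ) = 0) (hδ : flowEquation hv (p, δ) = 0) : γ = δ := by
  have := norm_flowEquation_sub_le hv hC0 hC p γ δ
  rw [hγ, hδ, sub_zero, sub_zero] at this
  rw [← sub_eq_zero, ← norm_eq_zero]
  nlinarith [norm_nonneg (γ - δ)]

lemma exists_flowEquation_eq_zero {E : Type u} [NormedAddCommGroup E] [NormedSpace ℝ E]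
    [CompleteSpace E] {v : E → E}
    (hv : ContDiff ℝ ∞ v) {C : ℝ} (hC0 : 0 ≤ C) (hC : ∀ x y, ‖v y - v x‖ ≤ C * ‖y - x‖)
    {p : ℝ × E} (hp : |p.1| * C < 1) : ∃ γ, flowEquation hv (p, γ) = 0 := by
  have hc : ContractingWith ⟨|p.1| * C, by positivity⟩ (fun γ => γ - flowEquation hv (p, γ)) := by
    refine ⟨by exact_mod_cast hp, LipschitzWith.of_dist_le_mul fun γ δ => ?_⟩
    rw [dist_eq_norm, dist_eq_norm]
    exact norm_flowEquation_sub_le hv hC0 hC p γ δ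
  refine ⟨ContractingWith.fixedPoint _ hc, ?_⟩
  have := hc.fixedPoint_isFixedPt
  simpa [Function.IsFixedPt, sub_eq_self] using this

lemma isInvertible_of_norm_id_sub_lt_one {X : Type*} [NormedAddCommGroup X] [NormedSpace ℝ X]
    [CompleteSpace X] {A : X →L[ℝ] X} (h : ‖ContinuousLinearMap.id ℝ X - A‖ < 1) :
    A.IsInvertible := by
  obtain ⟨U, hU⟩ : IsUnit A := by
    have := isUnit_one_sub_of_norm_lt_one h
    rwa [← ContinuousLinearMap.one_def, sub_sub_cancel] at this
  rw [← hU]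
  exact ⟨ContinuousLinearEquiv.ofUnit U, by ext x; rfl⟩

/-- The derivative of a contraction has norm less than one, so the partial derivative is the
identity minus a small operator and a Neumann series inverts it. -/
lemma isInvertible_fderiv_flowEquation {E : Type u} [NormedAddCommGroup E] [NormedSpace ℝ E]
    [CompleteSpace E] {v : E → E}
    (hv : ContDiff ℝ ∞ v) (hc : HasCompactSupport (fderiv ℝ v)) {C : ℝ} (hC0 : 0 ≤ C)
    (hC : ∀ x y, ‖v y - v x‖ ≤ C * ‖y - x‖)
    {p : ℝ × E} (hp : |p.1| * C < 1) (γ : C(Icc (-1 : ℝ) 1, E)) :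
    (fderiv ℝ (flowEquation hv) (p, γ) ∘L .inr ℝ (ℝ × E) C(Icc (-1 : ℝ) 1, E)).IsInvertible := by
  set A := fderiv ℝ (flowEquation hv) (p, γ) ∘L .inr ℝ (ℝ × E) C(Icc (-1 : ℝ) 1, E) with hA
  have h1 : HasFDerivAt (flowEquation hv) (fderiv ℝ (flowEquation hv) (p, γ)) (p, γ) :=
    ((contDiff_flowEquation hv hc).differentiable (by simp) _).hasFDerivAt
  have h2 : HasFDerivAt (fun δ => flowEquation hv (p, δ)) A γ := by
    have := h1.comp γ (hasFDerivAt_prodMk_right p γ)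
    exact this
  have h3 : HasFDerivAt (fun δ => δ - flowEquation hv (p, δ)) (.id ℝ _ - A) γ :=
    (hasFDerivAt_id γ).sub h2
  have h4 : ‖ContinuousLinearMap.id ℝ _ - A‖ < 1 := by
    refine (h3.le_of_lipschitz (C := ⟨|p.1| * C, by positivity⟩)
      (LipschitzWith.of_dist_le_mul fun γ δ => ?_)).trans_lt (by exact_mod_cast hp)
    rw [dist_eq_norm, dist_eq_norm]
    exact norm_flowEquation_sub_le hv hC0 hC p γ δ
  exact isInvertible_of_norm_id_sub_lt_one h4

lemma hasDerivAt_of_flowEquation {E : Type u} [NormedAddCommGroup E] [NormedSpace ℝ E]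
    [CompleteSpace E] {v : E → E}
    (hv : ContDiff ℝ ∞ v) {s : ℝ} (hs : 0 < s) {x : E} {γ : C(Icc (-1 : ℝ) 1, E)}
    (hγ : flowEquation hv ((s, x), γ) = 0) :
    IccExtend (by norm_num) γ 0 = x ∧ ∀ t ∈ Ioo (-s) s,
    HasDerivAt (fun t => IccExtend (by norm_num) γ (t / s))
      (v (IccExtend (by norm_num) γ (t / s))) t := by
  have h0 : ∀ t : Icc (-1 : ℝ) 1, γ t = x + s • ∫ r in (0 : ℝ)..t,
      v (IccExtend (by norm_num) γ r) := by
    intro t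
    have := congrArg (fun δ => δ t) hγ
    simp only [flowEquation, ContinuousMap.sub_apply, ContinuousMap.zero_apply, sub_sub, sub_eq_zero] at this
    rw [this]
    rfl
  have hcont : Continuous fun r => v (IccExtend (by norm_num : (-1 : ℝ) ≤ 1) γ r) :=
    hv.continuous.comp (γ.continuous.Icc_extend' (h := by norm_num))
  constructor
  · rw [IccExtend_of_mem _ _ (by norm_num : (0 : ℝ) ∈ Icc (-1 : ℝ) 1), h0]
    simp
  · intro t ht
    have hts : t / s ∈ Ioo (-1 : ℝ) 1 := by
      rw [mem_Ioo, lt_div_iff₀ hs, div_lt_iff₀ hs]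
      simpa using ht
    have h1 : HasDerivAt (fun r : ℝ => x + s • ∫ r in (0 : ℝ)..r,
        v (IccExtend (by norm_num) γ r)) (s • v (IccExtend (by norm_num) γ (t / s))) (t / s) :=
      ((hcont.integral_hasStrictDerivAt 0 (t / s)).hasDerivAt.const_smul s).const_add x
    have h2 : HasDerivAt (IccExtend (by norm_num : (-1 : ℝ) ≤ 1) γ)
        (s • v (IccExtend (by norm_num) γ (t / s))) (t / s) := by
      refine h1.congr_of_eventuallyEq ?_
      filter_upwards [Ioo_mem_nhds hts.1 hts.2] with r hr
      rw [IccExtend_of_mem _ _ (Ioo_subset_Icc_self hr), h0]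
    have h3 := h2.scomp t ((hasDerivAt_id t).div_const s)
    simpa [Function.comp_def, smul_smul, hs.ne'] using h3

/-- A smooth vector field whose derivative is compactly supported has a smooth global flow. -/
theorem exists_contDiff_flow {E : Type u} [NormedAddCommGroup E] [NormedSpace ℝ E]
    [CompleteSpace E] {v : E → E} (hv : ContDiff ℝ ∞ v) (hc : HasCompactSupport (fderiv ℝ v)) :
    ∃ Φ : ℝ → E → E, ContDiff ℝ ∞ (fun p : ℝ × E => Φ p.1 p.2) ∧ (∀ x, Φ 0 x = x) ∧
      (∀ t x, HasDerivAt (fun s => Φ s x) (v (Φ t x)) t) ∧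
      ∀ s t x, Φ (s + t) x = Φ s (Φ t x) := by
  obtain ⟨C, hC0, hC⟩ := exists_lipschitz_of_hasCompactSupport hv hc
  -- A time of existence that does not depend on the starting point, so that local integral curves
  -- extend to all times.
  set s₀ : ℝ := 1 / (C + 1) with hs₀
  have hs₀pos : 0 < s₀ := by positivity
  have hsmall : ∀ s : ℝ, |s| ≤ s₀ → |s| * C < 1 := by
    intro s hs
    calc |s| * C ≤ s₀ * C := by gcongr
      _ < 1 := by rw [hs₀, one_div, inv_mul_lt_iff₀ (by positivity)]; linarith
  have hex : ∀ x : E, ∃ γ : ℝ → E, γ 0 = x ∧ ∀ t, HasDerivAt γ (v (γ t)) t := by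
    intro x
    have hv1 : ContMDiff 𝓘(ℝ, E) (𝓘(ℝ, E).prod 𝓘(ℝ, E)) 1
        (fun x => (⟨x, v x⟩ : TangentBundle 𝓘(ℝ, E) E)) := by
      exact contMDiff_vectorSpace_iff_contDiff.2 (hv.of_le (by exact_mod_cast le_top))
    obtain ⟨γ, h0, h1⟩ := exists_isMIntegralCurve_of_isMIntegralCurveOn (I := 𝓘(ℝ, E)) (v := v)
      hv1 hs₀pos (fun x => by
        obtain ⟨γ, hγ⟩ := exists_flowEquation_eq_zero hv hC0 hC (p := (s₀, x))
          (hsmall s₀ (abs_of_pos hs₀pos).le)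
        obtain ⟨h0, h1⟩ := hasDerivAt_of_flowEquation hv hs₀pos hγ
        exact ⟨_, by rw [zero_div]; exact h0, fun t ht => (h1 t ht).hasFDerivAt.hasMFDerivAt.hasMFDerivWithinAt⟩) x
    exact ⟨γ, h0, fun t => hasDerivAt_iff_hasFDerivAt.2 (hasMFDerivAt_iff_hasFDerivAt.1 (h1 t))⟩
  choose Y hY0 hY using hex
  have hlip : LipschitzWith ⟨C, hC0⟩ v := LipschitzWith.of_dist_le_mul fun x y => by
    rw [dist_eq_norm, dist_eq_norm]; exact hC y x
  have huniq : ∀ {γ δ : ℝ → E} (_ : ∀ t, HasDerivAt γ (v (γ t)) t)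
      (_ : ∀ t, HasDerivAt δ (v (δ t)) t), γ 0 = δ 0 → γ = δ := fun hγ hδ h =>
    ODE_solution_unique_univ (v := fun _ => v) (s := fun _ => univ) (K := ⟨C, hC0⟩)
      (fun _ => hlip.lipschitzOnWith) (fun t => ⟨hγ t, mem_univ _⟩) (fun t => ⟨hδ t, mem_univ _⟩) h
  have hgroup : ∀ s t x, Y x (s + t) = Y (Y x t) s := by
    intro s t x
    have := huniq (γ := fun s => Y x (s + t)) (δ := Y (Y x t))
      (fun r => (hY x (r + t)).comp_add_const r t) (hY _) (by simp [hY0])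
    exact congrFun this s
  -- For short times the rescaled curve `t ↦ Y x (s * t)` is the implicit function of
  -- `flowEquation`, by uniqueness of its zeros; evaluation at `t = 1` gives the flow.
  have hlocal : ∀ s x, |s| < s₀ → ContDiffAt ℝ ∞ (fun p : ℝ × E => Y p.2 p.1) (s, x) := by
    intro s x hs
    have hsol : ∀ p : ℝ × E, flowEquation hv (p, ⟨fun t => Y p.2 (p.1 * t),
        (continuous_iff_continuousAt.2 fun t => (hY p.2 t).continuousAt).comp (by fun_prop)⟩)
        = 0 := by
      intro p
      ext t
      have hcont : Continuous (fun r : ℝ => v (Y p.2 (p.1 * r))) :=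
        hv.continuous.comp ((continuous_iff_continuousAt.2 fun t => (hY p.2 t).continuousAt).comp
          (by fun_prop))
      have h1 : ∫ r in (0 : ℝ)..t, p.1 • v (Y p.2 (p.1 * r)) = Y p.2 (p.1 * t) - Y p.2 (p.1 * 0) :=
        intervalIntegral.integral_eq_sub_of_hasDerivAt (f := fun r => Y p.2 (p.1 * r)) (fun r _ => by
          have := (hY p.2 (p.1 * r)).scomp r ((hasDerivAt_id r).const_mul p.1)
          simpa [Function.comp_def] using this) ((hcont.const_smul p.1).intervalIntegrable _ _)
      simp only [flowEquation, ContinuousMap.sub_apply, ContinuousMap.zero_apply,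
        ContinuousMap.coe_mk, sub_sub, sub_eq_zero]
      rw [intervalIntegral.integral_smul, mul_zero, hY0, eq_sub_iff_add_eq'] at h1
      rw [← h1]
      congr 2
      refine intervalIntegral.integral_congr fun r hr => ?_
      have hr' : r ∈ Icc (-1 : ℝ) 1 := by
        have : uIcc (0 : ℝ) t ⊆ Icc (-1 : ℝ) 1 := uIcc_subset_Icc (by norm_num) t.2
        exact this hr
      simp only [IccExtend_of_mem _ _ hr', ContinuousMap.coe_mk]
    set γ : C(Icc (-1 : ℝ) 1, E) := ⟨fun t => Y x (s * t),
        (continuous_iff_continuousAt.2 fun t => (hY x t).continuousAt).comp (by fun_prop)⟩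
    have cdf : ContDiffAt ℝ ∞ (flowEquation hv) ((s, x), γ) :=
      (contDiff_flowEquation hv hc).contDiffAt
    have if₂ := isInvertible_fderiv_flowEquation hv hc hC0 hC (p := (s, x)) (hsmall s hs.le) γ
    have h1 := cdf.contDiffAt_implicitFunction (by simp) if₂
    have h2 := cdf.eventually_apply_implicitFunction (by simp) if₂
    have h3 : ∀ᶠ p : ℝ × E in nhds (s, x), |p.1| < s₀ :=
      (continuous_fst.abs).continuousAt.eventually_lt continuousAt_const hs
    have h4 : ContDiffAt ℝ ∞ (fun p => ContinuousMap.evalCLM ℝ (⟨1, by norm_num⟩ : Icc (-1 : ℝ) 1)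
        (cdf.implicitFunction (by simp) if₂ p)) (s, x) :=
      (ContinuousLinearMap.contDiff _).contDiffAt.comp (s, x) h1
    refine h4.congr_of_eventuallyEq ?_
    filter_upwards [h2, h3] with p hp2 hp3
    have := flowEquation_unique hv hC0 hC (hsmall _ hp3.le) (hp2.trans (hsol (s, x))) (hsol p)
    rw [this]
    simp
  have hfix : ∀ n : ℕ, ∀ t : ℝ, |t| < s₀ → ContDiff ℝ ∞ (fun x => Y x (n * t)) := by
    intro n t ht
    induction n with
    | zero => simp only [Nat.cast_zero, zero_mul, hY0]; exact contDiff_id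
    | succ n ih =>
      have h1 : ContDiff ℝ ∞ (fun x => Y x t) := contDiff_iff_contDiffAt.2 fun x =>
        (hlocal t x ht).comp x (contDiffAt_const.prodMk contDiffAt_id)
      have : (fun x => Y x ((n + 1 : ℕ) * t)) = (fun x => Y (Y x (n * t)) t) := by
        ext1 x
        rw [← hgroup]
        congr 1; push_cast; ring
      rw [this]
      exact h1.comp ih
  refine ⟨fun t x => Y x t, contDiff_iff_contDiffAt.2 ?_, hY0, fun t x => hY x t, hgroup⟩
  rintro ⟨t, x⟩
  obtain ⟨n, hn⟩ := exists_nat_gt (|t| / s₀)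
  have hn0 : (0 : ℝ) < n := lt_of_le_of_lt (by positivity) hn
  have hsm : ContDiff ℝ ∞ (fun x => Y x t) := by
    have := hfix n (t / n) (by
      rw [abs_div, abs_of_pos hn0, div_lt_iff₀ hn0, mul_comm]
      rwa [div_lt_iff₀ hs₀pos] at hn)
    simpa [mul_div_cancel₀ t hn0.ne'] using this
  -- Near time `t` the flow is the smooth short time flow after the fixed map at time `t`, which is
  -- smooth as an iterate of short time maps.
  have h1 : (fun p : ℝ × E => Y p.2 p.1) = (fun p : ℝ × E => Y p.2 p.1) ∘
      (fun p : ℝ × E => (p.1 - t, Y p.2 t)) := by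
    ext1 p
    simp only [Function.comp_apply]
    rw [← hgroup, sub_add_cancel]
  rw [h1]
  refine ContDiffAt.comp (t, x) ?_ ?_
  · exact hlocal _ _ (by simpa using hs₀pos)
  · exact ((contDiff_fst.sub contDiff_const).prodMk (hsm.comp contDiff_snd)).contDiffAt

end SmoothFlow

/-! ### Hamiltonian flows in the plane, and the operations on paths of area preserving maps. -/

section PlaneHamiltonian

open Set Metric
open scoped NNReal

/-- The standard area form of the plane. -/
noncomputable def areaForm : Plane →L[ℝ] Plane →L[ℝ] ℝ :=
  (EuclideanSpace.proj 0 : Plane →L[ℝ] ℝ).smulRight (EuclideanSpace.proj 1 : Plane →L[ℝ] ℝ) -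
  (EuclideanSpace.proj 1 : Plane →L[ℝ] ℝ).smulRight (EuclideanSpace.proj 0 : Plane →L[ℝ] ℝ)

lemma areaForm_apply (v w : Plane) : areaForm v w = v 0 * w 1 - v 1 * w 0 := by
  simp [areaForm]

lemma areaForm_swap (v w : Plane) : areaForm v w = -areaForm w v := by
  simp only [areaForm_apply]; ring

/-- The unit coordinate vectors of the plane. -/
noncomputable abbrev unitVec (i : Fin 2) : Plane := EuclideanSpace.single i (1 : ℝ)

lemma plane_eq_sum (v : Plane) : v = v 0 • unitVec 0 + v 1 • unitVec 1 := by
  ext i; fin_cases i <;> simp [unitVec]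

lemma eq_of_areaForm_eq {v w : Plane} (h : ∀ a, areaForm v a = areaForm w a) : v = w := by
  have h0 := h (unitVec 0)
  have h1 := h (unitVec 1)
  simp [areaForm_apply, unitVec] at h0 h1
  ext i; fin_cases i
  · exact h1
  · exact h0

/-- The vector which corresponds to a covector under the area form. -/
noncomputable def symplecticDual : (Plane →L[ℝ] ℝ) →L[ℝ] Plane :=
  (ContinuousLinearMap.apply ℝ ℝ (unitVec 1)).smulRight (unitVec 0) -
  (ContinuousLinearMap.apply ℝ ℝ (unitVec 0)).smulRight (unitVec 1)

lemma areaForm_symplecticDual (l : Plane →L[ℝ] ℝ) (w : Plane) :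
    areaForm (symplecticDual l) w = l w := by
  conv_rhs => rw [plane_eq_sum w]
  simp [areaForm_apply, symplecticDual, unitVec]
  ring

/-- The Hamiltonian vector field of a function on the plane. -/
noncomputable def hamField (ψ : Plane → ℝ) (z : Plane) : Plane := symplecticDual (fderiv ℝ ψ z)

lemma areaForm_hamField (ψ : Plane → ℝ) (z w : Plane) :
    areaForm (hamField ψ z) w = fderiv ℝ ψ z w := areaForm_symplecticDual _ _

lemma contDiff_hamField {ψ : Plane → ℝ} (hψ : ContDiff ℝ ∞ ψ) : ContDiff ℝ ∞ (hamField ψ) :=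
  symplecticDual.contDiff.comp (hψ.fderiv_right (by simp))

lemma hamField_const_mul {ψ : Plane → ℝ} (c : ℝ) (z : Plane) :
    hamField (fun z => c * ψ z) z = c • hamField ψ z := by
  simp only [hamField]
  have : fderiv ℝ (fun z => c * ψ z) z = c • fderiv ℝ ψ z := by
    exact congrFun (fderiv_const_smul_field (𝕜 := ℝ) (f := ψ) c) z
  rw [this, map_smul]

lemma hamField_eq_zero_of_eqOn {K : Set Plane} (hK : IsClosed K) {ψ : Plane → ℝ}
    (h : ∀ z ∉ K, ψ z = 0) {z : Plane} (hz : z ∉ K) : hamField ψ z = 0 := by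
  have : ψ =ᶠ[nhds z] fun _ => 0 := by
    filter_upwards [hK.isOpen_compl.mem_nhds hz] with y hy using h y hy
  rw [hamField, this.fderiv_eq]
  simp

/-- Hamiltonian vector fields are infinitesimally area preserving. -/
lemma areaForm_fderiv_hamField {ψ : Plane → ℝ} (hψ : ContDiff ℝ ∞ ψ) (z a b : Plane) :
    areaForm (fderiv ℝ (hamField ψ) z a) b + areaForm a (fderiv ℝ (hamField ψ) z b) = 0 := by
  have h1 : ∀ a, fderiv ℝ (hamField ψ) z a = symplecticDual (fderiv ℝ (fderiv ℝ ψ) z a) := by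
    intro a
    have hd : DifferentiableAt ℝ (fderiv ℝ ψ) z :=
      (hψ.fderiv_right (m := ∞) (by simp)).differentiable (by simp) z
    have : HasFDerivAt (hamField ψ) (symplecticDual ∘L fderiv ℝ (fderiv ℝ ψ) z) z :=
      symplecticDual.hasFDerivAt.comp z hd.hasFDerivAt
    rw [this.fderiv]; rfl
  have hs : IsSymmSndFDerivAt ℝ ψ z :=
    (hψ.contDiffAt (x := z)).isSymmSndFDerivAt
      (by simpa using (WithTop.coe_le_coe.2 le_top : ((2 : ℕ∞) : WithTop ℕ∞) ≤ ((⊤ : ℕ∞) : WithTop ℕ∞)))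
  -- The two terms become the second derivative of `ψ` at `(a, b)` and minus the one at `(b, a)`.
  rw [h1, h1, areaForm_swap a, areaForm_symplecticDual, areaForm_symplecticDual, hs a b]
  ring

/-- The flow of a vector field which is infinitesimally area preserving is area preserving. -/
lemma areaForm_fderiv_flow {v : Plane → Plane} (hv : ContDiff ℝ ∞ v)
    (hdiv : ∀ z a b, areaForm (fderiv ℝ v z a) b + areaForm a (fderiv ℝ v z b) = 0)
    {Φ : ℝ → Plane → Plane} (hΦ : ContDiff ℝ ∞ (fun p : ℝ × Plane => Φ p.1 p.2))
    (h0 : ∀ x, Φ 0 x = x) (hd : ∀ t x, HasDerivAt (fun s => Φ s x) (v (Φ t x)) t)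
    (t : ℝ) (z a b : Plane) :
    areaForm (fderiv ℝ (Φ t) z a) (fderiv ℝ (Φ t) z b) = areaForm a b := by
  set F : ℝ × Plane → Plane := fun p => Φ p.1 p.2 with hF
  have hFd : ∀ p, HasFDerivAt F (fderiv ℝ F p) p := fun p =>
    (hΦ.differentiable (by simp) p).hasFDerivAt
  have hF' : ContDiff ℝ ∞ (fderiv ℝ F) := hΦ.fderiv_right (by simp)
  have hF'd : ∀ p, HasFDerivAt (fderiv ℝ F) (fderiv ℝ (fderiv ℝ F) p) p := fun p =>
    (hF'.differentiable (by simp) p).hasFDerivAt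
  have hspace : ∀ t a, fderiv ℝ (Φ t) z a = fderiv ℝ F (t, z) (0, a) := by
    intro t a
    have := (hFd (t, z)).comp z (hasFDerivAt_prodMk_right t z)
    have h2 : HasFDerivAt (Φ t) _ z := this
    rw [h2.fderiv]; rfl
  have htime : ∀ p, fderiv ℝ F p (1, 0) = v (F p) := by
    rintro ⟨t, x⟩
    have := (hFd (t, x)).comp_hasDerivAt t ((hasDerivAt_id t).prodMk (hasDerivAt_const t x))
    exact this.unique (hd t x)
  -- The variational equation, from the symmetry of the second derivative of `F` in the time
  -- direction and a space direction.
  have hvar : ∀ t a, HasDerivAt (fun s => fderiv ℝ (Φ s) z a)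
      (fderiv ℝ v (Φ t z) (fderiv ℝ (Φ t) z a)) t := by
    intro t a
    simp only [hspace]
    have h1 : HasDerivAt (fun s => fderiv ℝ F (s, z) (0, a))
        (fderiv ℝ (fderiv ℝ F) (t, z) (1, 0) (0, a)) t := by
      have := (hF'd (t, z)).comp_hasDerivAt t ((hasDerivAt_id t).prodMk (hasDerivAt_const t z))
      exact this.clm_apply (hasDerivAt_const t ((0 : ℝ), a)) |>.congr_deriv (by simp)
    have hs : IsSymmSndFDerivAt ℝ F (t, z) := (hΦ.contDiffAt (x := (t, z))).isSymmSndFDerivAt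
      (by simpa using (WithTop.coe_le_coe.2 le_top : ((2 : ℕ∞) : WithTop ℕ∞) ≤ ((⊤ : ℕ∞) : WithTop ℕ∞)))
    have h2 : HasFDerivAt (fun p => fderiv ℝ F p (1, 0))
        ((fderiv ℝ (fderiv ℝ F) (t, z)).flip (1, 0)) (t, z) :=
      ((hF'd (t, z)).clm_apply (hasFDerivAt_const ((1 : ℝ), (0 : Plane)) (t, z))).congr_fderiv
        (by ext <;> simp)
    have h3 : HasFDerivAt (fun p => fderiv ℝ F p (1, 0))
        (fderiv ℝ v (F (t, z)) ∘L fderiv ℝ F (t, z)) (t, z) := by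
      simp only [htime]
      exact (hv.differentiable (by simp) _).hasFDerivAt.comp (t, z) (hFd (t, z))
    have h4 := congrArg (fun L => L (0, a)) (h2.unique h3)
    simp only [ContinuousLinearMap.flip_apply, ContinuousLinearMap.comp_apply] at h4
    rwa [hs (1, 0) (0, a), h4] at h1
  have hder : ∀ t, HasDerivAt (fun s => areaForm (fderiv ℝ (Φ s) z a) (fderiv ℝ (Φ s) z b)) 0 t := by
    intro t
    have := areaForm.hasDerivAt_of_bilinear (fun _ => hvar t a) (fun _ => hvar t b)
    refine this.congr_deriv ?_
    rw [add_comm]; exact hdiv _ _ _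
  have hconst := is_const_of_deriv_eq_zero (fun t => (hder t).differentiableAt)
    (fun t => (hder t).deriv) t 0
  rw [hconst]
  have : Φ 0 = id := funext h0
  simp [this]

/-- Area preserving diffeomorphisms of the plane which are the identity outside `K`. -/
def areaDiffeoGroup (K : Set Plane) : Subgroup (Equiv.Perm Plane) where
  carrier := {h | ContDiff ℝ ∞ h ∧ ContDiff ℝ ∞ h.symm ∧ (∀ z ∉ K, h z = z) ∧
    ∀ z a b, areaForm (fderiv ℝ h z a) (fderiv ℝ h z b) = areaForm a b}
  one_mem' := ⟨contDiff_id, contDiff_id, fun _ _ => rfl, fun z a b => by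
    have : ⇑(1 : Equiv.Perm Plane) = id := rfl
    rw [this, fderiv_id]; rfl⟩
  mul_mem' := by
    rintro g h ⟨hg1, hg2, hg3, hg4⟩ ⟨hh1, hh2, hh3, hh4⟩
    refine ⟨hg1.comp hh1, hh2.comp hg2, fun z hz => ?_, fun z a b => ?_⟩
    · rw [Equiv.Perm.mul_apply, hh3 z hz, hg3 z hz]
    · have : ⇑(g * h) = g ∘ h := rfl
      rw [this, fderiv_comp z (hg1.differentiable (by simp) _) (hh1.differentiable (by simp) _)]
      simp only [ContinuousLinearMap.comp_apply, hg4, hh4]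
  inv_mem' := by
    rintro h ⟨h1, h2, h3, h4⟩
    refine ⟨h2, h1, fun z hz => ?_, fun z a b => ?_⟩
    · rw [Equiv.Perm.inv_eq_iff_eq, h3 z hz]
    · have hc : HasFDerivAt (h ∘ h.symm)
          (fderiv ℝ h (h.symm z) ∘L fderiv ℝ h.symm z) z :=
        (h1.differentiable (by simp) _).hasFDerivAt.comp z
          (h2.differentiable (by simp) _).hasFDerivAt
      have hid : fderiv ℝ h (h.symm z) ∘L fderiv ℝ h.symm z = .id ℝ Plane := by
        refine hc.unique ?_
        rw [Equiv.self_comp_symm]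
        exact hasFDerivAt_id z
      have := h4 (h.symm z) (fderiv ℝ h.symm z a) (fderiv ℝ h.symm z b)
      simp only [← ContinuousLinearMap.comp_apply, hid] at this
      exact this.symm

/-- Area preserving diffeomorphisms transport Hamiltonian vector fields. -/
lemma fderiv_hamField_of_mem {K : Set Plane} {g : Equiv.Perm Plane} (hg : g ∈ areaDiffeoGroup K)
    {ψ : Plane → ℝ} (hψ : ContDiff ℝ ∞ ψ) (z : Plane) :
    fderiv ℝ g z (hamField ψ z) = hamField (ψ ∘ g.symm) (g z) := by
  refine eq_of_areaForm_eq fun a => ?_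
  obtain ⟨h1, h2, h3, h4⟩ := hg
  have hc : HasFDerivAt (g.symm ∘ g) (fderiv ℝ g.symm (g z) ∘L fderiv ℝ g z) z :=
    (h2.differentiable (by simp) _).hasFDerivAt.comp z
      (h1.differentiable (by simp) _).hasFDerivAt
  have hc' : HasFDerivAt (g ∘ g.symm) (fderiv ℝ g (g.symm (g z)) ∘L fderiv ℝ g.symm (g z)) (g z) :=
    (h1.differentiable (by simp) _).hasFDerivAt.comp (g z)
      (h2.differentiable (by simp) _).hasFDerivAt
  rw [Equiv.symm_apply_apply] at hc'
  have hid' : fderiv ℝ g z ∘L fderiv ℝ g.symm (g z) = .id ℝ Plane := by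
    refine hc'.unique ?_
    rw [Equiv.self_comp_symm]
    exact hasFDerivAt_id _
  obtain ⟨w, rfl⟩ : ∃ w, fderiv ℝ g z w = a :=
    ⟨fderiv ℝ g.symm (g z) a, by rw [← ContinuousLinearMap.comp_apply, hid']; rfl⟩
  rw [h4, areaForm_hamField, areaForm_hamField]
  have hψg : HasFDerivAt (ψ ∘ g.symm) (fderiv ℝ ψ (g.symm (g z)) ∘L fderiv ℝ g.symm (g z)) (g z) :=
    (hψ.differentiable (by simp) _).hasFDerivAt.comp (g z)
      (h2.differentiable (by simp) _).hasFDerivAt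
  have hid : fderiv ℝ g.symm (g z) ∘L fderiv ℝ g z = .id ℝ Plane := by
    refine hc.unique ?_
    rw [Equiv.symm_comp_self]
    exact hasFDerivAt_id z
  rw [hψg.fderiv, ContinuousLinearMap.comp_apply, ← ContinuousLinearMap.comp_apply (fderiv ℝ g.symm (g z)),
    hid, Equiv.symm_apply_apply]
  rfl

/-- The Hamiltonian flow. -/
theorem exists_hamFlow {ψ : Plane → ℝ} (hψ : ContDiff ℝ ∞ ψ)
    (hc : HasCompactSupport (fderiv ℝ (hamField ψ))) :
    ∃ Φ : ℝ → Equiv.Perm Plane, ContDiff ℝ ∞ (fun p : ℝ × Plane => Φ p.1 p.2) ∧ Φ 0 = 1 ∧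
      (∀ t z, HasDerivAt (fun s => Φ s z) (hamField ψ (Φ t z)) t) ∧
      (∀ s t, Φ (s + t) = Φ s * Φ t) ∧
      (∀ t, ContDiff ℝ ∞ (Φ t)) ∧ (∀ t, ContDiff ℝ ∞ (Φ t).symm) ∧
      ∀ t z a b, areaForm (fderiv ℝ (Φ t) z a) (fderiv ℝ (Φ t) z b) = areaForm a b := by
  obtain ⟨Φ, h1, h2, h3, h4⟩ := exists_contDiff_flow (contDiff_hamField hψ) hc
  have h5 : ∀ t, ContDiff ℝ ∞ (Φ t) := fun t => h1.comp (contDiff_const.prodMk contDiff_id)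
  refine ⟨fun t => ⟨Φ t, Φ (-t), fun x => by rw [← h4, neg_add_cancel, h2],
    fun x => by rw [← h4, add_neg_cancel, h2]⟩, h1, Equiv.ext h2, h3,
    fun s t => Equiv.ext (h4 s t), h5, fun t => h5 (-t), ?_⟩
  exact areaForm_fderiv_flow (contDiff_hamField hψ) (areaForm_fderiv_hamField hψ) h1 h2 h3

/-- `h` is the end point of a smooth path, starting at the identity, of area preserving
diffeomorphisms which are the identity outside `K`, with Hamiltonians from the set `S`. -/
def HamReachable (K : Set Plane) (S : Set (Plane → ℝ)) (h : Equiv.Perm Plane) : Prop :=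
  ∃ (Φ : ℝ → Equiv.Perm Plane) (ψ : ℝ → Plane → ℝ), (∀ t, Φ t ∈ areaDiffeoGroup K) ∧
    ContDiff ℝ ∞ (fun p : ℝ × Plane => Φ p.1 p.2) ∧ Φ 0 = 1 ∧ Φ 1 = h ∧ (∀ t, ψ t ∈ S) ∧
    ∀ t z, HasDerivAt (fun s => Φ s z) (hamField (ψ t) (Φ t z)) t

lemma HamReachable.mono {K : Set Plane} {S T : Set (Plane → ℝ)} (hST : S ⊆ T)
    {h : Equiv.Perm Plane} (hh : HamReachable K S h) : HamReachable K T h := by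
  obtain ⟨Φ, ψ, h1, h2, h3, h4, h5, h6⟩ := hh
  exact ⟨Φ, ψ, h1, h2, h3, h4, fun t => hST (h5 t), h6⟩

/-- The path is `Φ (1 - t) * (Φ 1)⁻¹`. Right multiplication by a fixed map leaves the Hamiltonian
unchanged and time reversal changes its sign, so no composition with a diffeomorphism enters. -/
lemma HamReachable.inv {K : Set Plane} {S : Set (Plane → ℝ)} {h : Equiv.Perm Plane}
    (hh : HamReachable K S h) : HamReachable K {ψ | ∃ χ ∈ S, ψ = fun z => (-1) * χ z} h⁻¹ := by
  obtain ⟨Φ, ψ, h1, h2, h3, rfl, h5, h6⟩ := hh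
  refine ⟨fun t => Φ (1 - t) * (Φ 1)⁻¹, fun t z => (-1) * ψ (1 - t) z,
    fun t => mul_mem (h1 _) (inv_mem (h1 _)), ?_, by simp, by simp [h3],
    fun t => ⟨_, h5 (1 - t), rfl⟩, fun t z => ?_⟩
  · exact h2.comp ((contDiff_const.sub contDiff_fst).prodMk ((h1 1).2.1.comp contDiff_snd))
  · have h7 := (h6 (1 - t) ((Φ 1)⁻¹ z)).scomp t ((hasDerivAt_id t).const_sub 1)
    rw [hamField_const_mul]
    exact h7

/-- Covariance of Hamiltonian fields: conjugating the flow by `g` transports the Hamiltonian by `g`.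
-/
lemma HamReachable.conj {K : Set Plane} {S : Set (Plane → ℝ)} (hS : ∀ ψ ∈ S, ContDiff ℝ ∞ ψ)
    {h : Equiv.Perm Plane} (hh : HamReachable K S h) {g : Equiv.Perm Plane}
    (hg : g ∈ areaDiffeoGroup K) :
    HamReachable K {ψ | ∃ χ ∈ S, ψ = χ ∘ g.symm} (g * h * g⁻¹) := by
  obtain ⟨Φ, ψ, h1, h2, h3, rfl, h5, h6⟩ := hh
  refine ⟨fun t => g * Φ t * g⁻¹, fun t => ψ t ∘ g.symm,
    fun t => mul_mem (mul_mem hg (h1 _)) (inv_mem hg), ?_, by simp [h3], rfl,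
    fun t => ⟨_, h5 t, rfl⟩, fun t z => ?_⟩
  · exact hg.1.comp (h2.comp (contDiff_fst.prodMk (hg.2.1.comp contDiff_snd)))
  · have h7 : HasFDerivAt g (fderiv ℝ g (Φ t (g⁻¹ z))) (Φ t (g⁻¹ z)) :=
      (hg.1.differentiable (by simp) _).hasFDerivAt
    have h8 := h7.comp_hasDerivAt t (h6 t (g⁻¹ z))
    rw [fderiv_hamField_of_mem hg (hS _ (h5 t))] at h8
    exact h8

lemma exists_bound_deriv_smoothTransition :
    ∃ C : ℝ, 0 ≤ C ∧ ∀ t, |deriv Real.smoothTransition t| ≤ C := by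
  have h1 : HasCompactSupport (deriv Real.smoothTransition) := by
    refine HasCompactSupport.intro (isCompact_Icc (a := (0 : ℝ)) (b := 1)) fun t ht => ?_
    rw [mem_Icc, not_and_or, not_le, not_le] at ht
    rcases ht with ht | ht
    · have : Real.smoothTransition =ᶠ[nhds t] fun _ => 0 := by
        filter_upwards [Iio_mem_nhds ht] with s hs
        exact Real.smoothTransition.zero_of_nonpos (le_of_lt hs)
      rw [this.deriv_eq]; simp
    · have : Real.smoothTransition =ᶠ[nhds t] fun _ => 1 := by
        filter_upwards [Ioi_mem_nhds ht] with s hs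
        exact Real.smoothTransition.one_of_one_le (le_of_lt hs)
      rw [this.deriv_eq]; simp
  have h2 : Continuous (deriv Real.smoothTransition) :=
    (Real.smoothTransition.contDiff (n := 1)).continuous_deriv le_rfl
  obtain ⟨C, hC⟩ := h1.exists_bound_of_continuous h2
  exact ⟨C, (norm_nonneg _).trans (hC 0), hC⟩

/-- Run the path of `h`, then the path of `g` multiplied on the right by `h`. Both are
reparametrized by a smooth step to make the junction smooth, at the cost of the factor `3 * C`. -/
lemma HamReachable.mul {K : Set Plane} {S : Set (Plane → ℝ)} {C : ℝ}
    (hC : ∀ t, |deriv Real.smoothTransition t| ≤ C) {g h : Equiv.Perm Plane}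
    (hg : HamReachable K S g) (hh : HamReachable K S h) :
    HamReachable K {ψ | ∃ c : ℝ, |c| ≤ 3 * C ∧ ∃ χ ∈ S, ψ = fun z => c * χ z} (g * h) := by
  obtain ⟨Φ, ψ, h1, h2, h3, rfl, h5, h6⟩ := hg
  obtain ⟨Ψ, χ, k1, k2, k3, rfl, k5, k6⟩ := hh
  set σ := Real.smoothTransition
  have hσ0 : ∀ t : ℝ, t ≤ 0 → σ t = 0 := fun t ht => Real.smoothTransition.zero_of_nonpos ht
  have hσ1 : ∀ t : ℝ, 1 ≤ t → σ t = 1 := fun t ht => Real.smoothTransition.one_of_one_le ht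
  have hσ : ContDiff ℝ ∞ σ := Real.smoothTransition.contDiff
  have hσd : ∀ a t : ℝ, HasDerivAt (fun t => σ (3 * t - a)) (3 * deriv σ (3 * t - a)) t := by
    intro a t
    have h1 : HasDerivAt σ (deriv σ (3 * t - a)) (3 * t - a) :=
      (hσ.differentiable (by simp) _).hasDerivAt
    have h2 : HasDerivAt (fun t : ℝ => 3 * t - a) 3 t := by
      simpa using ((hasDerivAt_id t).const_mul 3).sub_const a
    rw [mul_comm]
    exact h1.comp t h2
  have hσs : ∀ a : ℝ, ContDiff ℝ ∞ (fun t => σ (3 * t - a)) := fun a =>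
    hσ.comp ((contDiff_const.mul contDiff_id).sub contDiff_const)
  have hbound : ∀ a t : ℝ, |3 * deriv σ (3 * t - a)| ≤ 3 * C := fun a t => by
    rw [abs_mul, abs_of_pos (by norm_num : (0 : ℝ) < 3)]
    exact mul_le_mul_of_nonneg_left (hC _) (by norm_num)
  -- The first step moves only for `t` in `[0, 1/3]`, the second only in `[2/3, 1]`. The
  -- Hamiltonians are switched at `1/2`, where both factors are at rest.
  refine ⟨fun t => Φ (σ (3 * t - 2)) * Ψ (σ (3 * t - 0)), fun t => if t ≤ 1 / 2 then
    (fun z => (3 * deriv σ (3 * t - 0)) * χ (σ (3 * t - 0)) z) else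
    (fun z => (3 * deriv σ (3 * t - 2)) * ψ (σ (3 * t - 2)) z),
    fun t => mul_mem (h1 _) (k1 _), ?_, ?_, ?_, fun t => ?_, fun t z => ?_⟩
  · exact h2.comp (((hσs 2).comp contDiff_fst).prodMk
      (k2.comp (((hσs 0).comp contDiff_fst).prodMk contDiff_snd)))
  · simp only
    rw [hσ0 _ (by norm_num),
      hσ0 _ (by norm_num), h3, k3, one_mul]
  · simp only
    rw [hσ1 _ (by norm_num),
      hσ1 _ (by norm_num)]
  · beta_reduce
    split_ifs
    · exact ⟨_, hbound 0 t, _, k5 _, rfl⟩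
    · exact ⟨_, hbound 2 t, _, h5 _, rfl⟩
  · beta_reduce
    split_ifs with ht
    · rw [hamField_const_mul]
      have e1 : ∀ s : ℝ, s ≤ 2 / 3 → Φ (σ (3 * s - 2)) = 1 := fun s hs => by
        rw [hσ0 _ (by linarith), h3]
      have h7 := (k6 (σ (3 * t - 0)) z).scomp t (hσd 0 t)
      rw [e1 t (by linarith), one_mul]
      refine h7.congr_of_eventuallyEq ?_
      filter_upwards [Iio_mem_nhds (show t < 2 / 3 by linarith)] with s hs
      rw [e1 s (le_of_lt hs), one_mul]; rfl
    · rw [hamField_const_mul]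
      have e1 : ∀ s : ℝ, 1 / 3 ≤ s → Ψ (σ (3 * s - 0)) = Ψ 1 := fun s hs => by
        rw [hσ1 _ (by linarith)]
      have h7 := (h6 (σ (3 * t - 2)) (Ψ 1 z)).scomp t (hσd 2 t)
      rw [e1 t (by linarith)]
      refine h7.congr_of_eventuallyEq ?_
      filter_upwards [Ioi_mem_nhds (show 1 / 3 < t by linarith)] with s hs
      rw [e1 s (le_of_lt hs)]; rfl

end PlaneHamiltonian

/-! ### Stability of dyadic bounds, and noncommuting area preserving maps with small support. -/

section PlaneDisplacement

open Set Metric MeasureTheory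
open scoped NNReal

lemma areaDiffeoGroup_mono {K L : Set Plane} (h : K ⊆ L) : areaDiffeoGroup K ≤ areaDiffeoGroup L :=
  fun _ hg => ⟨hg.1, hg.2.1, fun z hz => hg.2.2.1 z fun hK => hz (h hK), hg.2.2.2⟩

lemma det_eq_one_of_areaForm {L : Plane →L[ℝ] Plane}
    (h : ∀ a b, areaForm (L a) (L b) = areaForm a b) : L.det = 1 := by
  have h1 := h (unitVec 0) (unitVec 1)
  have h2 : L.det = (LinearMap.toMatrix (EuclideanSpace.basisFun (Fin 2) ℝ).toBasis
      (EuclideanSpace.basisFun (Fin 2) ℝ).toBasis (L : Plane →ₗ[ℝ] Plane)).det := by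
    rw [LinearMap.det_toMatrix]
  rw [h2, Matrix.det_fin_two]
  simp only [areaForm_apply] at h1
  simpa [LinearMap.toMatrix_apply, unitVec, mul_comm] using h1

/-- `ψ` is the average of `n` functions supported in `K` whose `L²` norms are at most
`A^(1/2) 2^(-k)` and whose gradients have `L²` norms at most `A^(1/2) 2^k`, `k < n`. -/
def IsDyadicAverage (K : Set Plane) (A : ℝ≥0∞) (n : ℕ) (ψ : Plane → ℝ) : Prop :=
  ∃ χ : ℕ → Plane → ℝ, (∀ k, ContDiff ℝ ∞ (χ k)) ∧ (∀ k, ∀ z ∉ K, χ k z = 0) ∧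
    (∀ k, ∫⁻ z, ‖χ k z‖ₑ ^ 2 ≤ A * 4⁻¹ ^ k) ∧ (∀ k, ∫⁻ z, ‖fderiv ℝ (χ k) z‖ₑ ^ 2 ≤ A * 4 ^ k) ∧
    ψ = fun z => (1 / n) * ∑ k ∈ Finset.range n, χ k z

lemma IsDyadicAverage.contDiff {K : Set Plane} {A : ℝ≥0∞} {n : ℕ} {ψ : Plane → ℝ}
    (h : IsDyadicAverage K A n ψ) : ContDiff ℝ ∞ ψ := by
  obtain ⟨χ, h1, -, -, -, rfl⟩ := h
  exact contDiff_const.mul (ContDiff.sum fun k _ => h1 k)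

lemma IsDyadicAverage.eq_zero {K : Set Plane} {A : ℝ≥0∞} {n : ℕ} {ψ : Plane → ℝ}
    (h : IsDyadicAverage K A n ψ) {z : Plane} (hz : z ∉ K) : ψ z = 0 := by
  obtain ⟨χ, -, h1, -, -, rfl⟩ := h
  simp [h1 _ z hz]

lemma IsDyadicAverage.mono {K : Set Plane} {A B : ℝ≥0∞} (hAB : A ≤ B) {n : ℕ} {ψ : Plane → ℝ}
    (h : IsDyadicAverage K A n ψ) : IsDyadicAverage K B n ψ := by
  obtain ⟨χ, h1, h2, h3, h4, rfl⟩ := h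
  exact ⟨χ, h1, h2, fun k => (h3 k).trans (by gcongr), fun k => (h4 k).trans (by gcongr), rfl⟩

lemma IsDyadicAverage.const_mul {K : Set Plane} {A : ℝ≥0∞} {n : ℕ} {ψ : Plane → ℝ}
    (h : IsDyadicAverage K A n ψ) {c C : ℝ} (hc : |c| ≤ C) :
    IsDyadicAverage K (ENNReal.ofReal C ^ 2 * A) n (fun z => c * ψ z) := by
  obtain ⟨χ, h1, h2, h3, h4, rfl⟩ := h
  have hcC : ‖c‖ₑ ≤ ENNReal.ofReal C := by
    rw [← ofReal_norm]; exact ENNReal.ofReal_le_ofReal hc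
  refine ⟨fun k z => c * χ k z, fun k => contDiff_const.mul (h1 k),
    fun k z hz => by simp [h2 k z hz], fun k => ?_, fun k => ?_, ?_⟩
  · simp only [enorm_mul, mul_pow]
    rw [lintegral_const_mul' _ _ (by simp), mul_assoc]
    gcongr
    exact h3 k
  · have : ∀ z, fderiv ℝ (fun z => c * χ k z) z = c • fderiv ℝ (χ k) z := fun z =>
      congrFun (fderiv_const_smul_field (𝕜 := ℝ) (f := χ k) c) z
    simp only [this, enorm_smul, mul_pow]
    rw [lintegral_const_mul' _ _ (by simp), mul_assoc]
    gcongr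
    exact h4 k
  · ext z
    rw [← Finset.mul_sum]; ring

/-- Change of variables: the Jacobian determinant is one. -/
lemma lintegral_comp_symm {K : Set Plane} {g : Equiv.Perm Plane} (hg : g ∈ areaDiffeoGroup K)
    (F : Plane → ℝ≥0∞) : ∫⁻ z, F (g.symm z) = ∫⁻ z, F z := by
  have h1 := lintegral_image_eq_lintegral_abs_det_fderiv_mul volume MeasurableSet.univ
    (f := g) (f' := fderiv ℝ g)
    (fun z _ => (hg.1.differentiable (by simp) z).hasFDerivAt.hasFDerivWithinAt)
    g.injective.injOn (fun z => F (g.symm z))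
  rw [image_univ_of_surjective g.surjective] at h1
  simp only [setLIntegral_univ, Equiv.symm_apply_apply,
    det_eq_one_of_areaForm (hg.2.2.2 _), abs_one, ENNReal.ofReal_one, one_mul] at h1
  exact h1

lemma exists_bound_fderiv_of_mem {K : Set Plane} (hK : IsCompact K) {g : Equiv.Perm Plane}
    (hg : g ∈ areaDiffeoGroup K) : ∃ C : ℝ, ∀ z, ‖fderiv ℝ g z‖ ≤ C := by
  obtain ⟨C, hC⟩ := hK.exists_bound_of_continuousOn (hg.1.continuous_fderiv (by simp)).continuousOn
  refine ⟨max C 1, fun z => ?_⟩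
  by_cases hz : z ∈ K
  · exact (hC z hz).trans (le_max_left _ _)
  · have : (g : Plane → Plane) =ᶠ[nhds z] id := by
      filter_upwards [hK.isClosed.isOpen_compl.mem_nhds hz] with y hy using hg.2.2.1 y hy
    rw [this.fderiv_eq, fderiv_id]
    exact ContinuousLinearMap.norm_id_le.trans (le_max_right _ _)

/-- The `L²` norms are invariant since `g` preserves area, and the gradients grow at most by the
supremum of the derivative of `g.symm`. The constant depends on `g` alone, neither on `n` nor on the
scales; taking `max C 1` lets it serve both bounds. -/
lemma IsDyadicAverage.comp_symm {K : Set Plane} (hK : IsCompact K) {g : Equiv.Perm Plane}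
    (hg : g ∈ areaDiffeoGroup K) : ∃ C : ℝ, ∀ {A : ℝ≥0∞} {n : ℕ} {ψ : Plane → ℝ},
    IsDyadicAverage K A n ψ → IsDyadicAverage K (ENNReal.ofReal C ^ 2 * A) n (ψ ∘ g.symm) := by
  obtain ⟨C, hC⟩ := exists_bound_fderiv_of_mem hK (inv_mem hg)
  have hC1 : 1 ≤ ENNReal.ofReal (max C 1) ^ 2 :=
    one_le_pow₀ (ENNReal.one_le_ofReal.2 (le_max_right _ _))
  refine ⟨max C 1, fun {A n ψ} h => ?_⟩
  obtain ⟨χ, h1, h2, h3, h4, rfl⟩ := h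
  refine ⟨fun k => χ k ∘ g.symm, fun k => (h1 k).comp hg.2.1,
    fun k z hz => ?_, fun k => ?_, fun k => ?_, rfl⟩
  · have := (inv_mem hg).2.2.1 z hz
    exact (congrArg (χ k) this).trans (h2 k z hz)
  · simp only [Function.comp_apply]
    rw [lintegral_comp_symm hg (fun z => ‖χ k z‖ₑ ^ 2), mul_assoc]
    exact (h3 k).trans (le_mul_of_one_le_left (zero_le) hC1)
  · have : ∀ z, ‖fderiv ℝ (χ k ∘ g.symm) z‖ₑ ^ 2 ≤
        ENNReal.ofReal (max C 1) ^ 2 * ‖fderiv ℝ (χ k) (g.symm z)‖ₑ ^ 2 := by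
      intro z
      rw [fderiv_comp z ((h1 k).differentiable (by simp) _) (hg.2.1.differentiable (by simp) _),
        ← mul_pow]
      gcongr
      rw [← ofReal_norm, ← ofReal_norm, ← ENNReal.ofReal_mul (by positivity)]
      refine ENNReal.ofReal_le_ofReal ?_
      rw [mul_comm]
      refine (ContinuousLinearMap.opNorm_comp_le _ _).trans ?_
      gcongr
      exact (hC z).trans (le_max_left _ _)
    refine (lintegral_mono this).trans ?_
    rw [lintegral_const_mul' _ _ (by finiteness),
      lintegral_comp_symm hg (fun z => ‖fderiv ℝ (χ k) z‖ₑ ^ 2), mul_assoc]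
    gcongr
    exact h4 k

/-- The sequence of diffeomorphisms can be reached by paths of Hamiltonians which are
`n`-fold dyadic averages with uniform bounds. -/
def IsDyadicallyReachable (K : Set Plane) (φ : ℕ → Equiv.Perm Plane) : Prop :=
  ∃ A : ℝ≥0∞, A ≠ ⊤ ∧ ∀ n, 0 < n → HamReachable K {ψ | IsDyadicAverage K A n ψ} (φ n)

lemma IsDyadicallyReachable.inv {K : Set Plane} {φ : ℕ → Equiv.Perm Plane}
    (h : IsDyadicallyReachable K φ) : IsDyadicallyReachable K (fun n => (φ n)⁻¹) := by
  obtain ⟨A, hA, h⟩ := h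
  refine ⟨ENNReal.ofReal 1 ^ 2 * A, by finiteness, fun n hn => (h n hn).inv.mono ?_⟩
  rintro _ ⟨χ, hχ, rfl⟩
  exact IsDyadicAverage.const_mul hχ (by simp)

lemma IsDyadicallyReachable.conj {K : Set Plane} (hK : IsCompact K) {φ : ℕ → Equiv.Perm Plane}
    (h : IsDyadicallyReachable K φ) {g : Equiv.Perm Plane} (hg : g ∈ areaDiffeoGroup K) :
    IsDyadicallyReachable K (fun n => g * φ n * g⁻¹) := by
  obtain ⟨A, hA, h⟩ := h
  obtain ⟨C, hC⟩ := IsDyadicAverage.comp_symm hK hg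
  refine ⟨ENNReal.ofReal C ^ 2 * A, by finiteness,
    fun n hn => ((h n hn).conj (fun ψ hψ => hψ.contDiff) hg).mono ?_⟩
  rintro _ ⟨χ, hχ, rfl⟩
  exact hC hχ

lemma IsDyadicallyReachable.mul {K : Set Plane} {φ χ : ℕ → Equiv.Perm Plane}
    (hφ : IsDyadicallyReachable K φ) (hχ : IsDyadicallyReachable K χ) :
    IsDyadicallyReachable K (fun n => φ n * χ n) := by
  obtain ⟨A, hA, hφ⟩ := hφ
  obtain ⟨B, hB, hχ⟩ := hχ
  obtain ⟨C, -, hC⟩ := exists_bound_deriv_smoothTransition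
  refine ⟨ENNReal.ofReal (3 * C) ^ 2 * (A + B), by finiteness, fun n hn =>
    (((hφ n hn).mono (T := {ψ | IsDyadicAverage K (A + B) n ψ})
      fun ψ hψ => hψ.mono le_self_add).mul hC ((hχ n hn).mono fun ψ hψ => hψ.mono le_add_self)).mono ?_⟩
  rintro _ ⟨c, hc, χ, hχ, rfl⟩
  exact IsDyadicAverage.const_mul hχ hc

/-- A Hamiltonian flow fixes the zeros of its vector field. -/
lemma flow_eq_self_of_hamField_eq_zero {ψ : Plane → ℝ} (hψ : ContDiff ℝ ∞ ψ)
    (hc : HasCompactSupport (fderiv ℝ (hamField ψ))) {Φ : ℝ → Equiv.Perm Plane} (h0 : Φ 0 = 1)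
    (hd : ∀ t z, HasDerivAt (fun s => Φ s z) (hamField ψ (Φ t z)) t)
    {z : Plane} (hz : hamField ψ z = 0) (t : ℝ) : Φ t z = z := by
  obtain ⟨C, hC0, hC⟩ := exists_lipschitz_of_hasCompactSupport (contDiff_hamField hψ) hc
  have hlip : LipschitzWith ⟨C, hC0⟩ (hamField ψ) := LipschitzWith.of_dist_le_mul fun x y => by
    rw [dist_eq_norm, dist_eq_norm]; exact hC y x
  have := ODE_solution_unique_univ (v := fun _ => hamField ψ) (s := fun _ => univ)
    (K := ⟨C, hC0⟩) (f := fun t => Φ t z) (g := fun _ => z) (t₀ := 0)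
      (fun _ => hlip.lipschitzOnWith) (fun t => ⟨hd t z, mem_univ _⟩)
      (fun t => ⟨by rw [hz]; exact hasDerivAt_const _ _, mem_univ _⟩) (by rw [h0]; rfl)
  exact congrFun this t

lemma fderiv_coord (i : Fin 2) (z : Plane) :
    fderiv ℝ (fun z : Plane => z i) z = (EuclideanSpace.proj i : Plane →L[ℝ] ℝ) :=
  (EuclideanSpace.proj i : Plane →L[ℝ] ℝ).fderiv

/-- The sign convention for Hamiltonian fields makes `z₁` generate the translation along `unitVec
0`. -/
lemma hamField_coord_one (z : Plane) : hamField (fun z : Plane => z 1) z = unitVec 0 := by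
  rw [hamField, fderiv_coord]
  simp [symplecticDual, unitVec]

lemma contDiff_coord (i : Fin 2) : ContDiff ℝ ∞ (fun z : Plane => z i) :=
  (EuclideanSpace.proj i : Plane →L[ℝ] ℝ).contDiff

/-- There are area preserving diffeomorphisms supported near a given point which move it. -/
lemma exists_areaDiffeo_ne (p : Plane) {r : ℝ} (hr : 0 < r) :
    ∃ f ∈ areaDiffeoGroup (closedBall p r), f p ≠ p := by
  let β : ContDiffBump p := ⟨r / 2, r, by positivity, by linarith⟩
  set ψ : Plane → ℝ := fun z => β z * z 1 with hψdef
  have hψ : ContDiff ℝ ∞ ψ := β.contDiff.mul (contDiff_coord 1)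
  have hsupp : ∀ z ∉ closedBall p r, hamField ψ z = 0 := fun z hz =>
    hamField_eq_zero_of_eqOn isClosed_closedBall (fun y hy => by
      simp only [hψdef]
      rw [β.zero_of_le_dist (by rw [mem_closedBall, not_le] at hy; exact hy.le), zero_mul]) hz
  have hcs : HasCompactSupport (hamField ψ) :=
    HasCompactSupport.intro (isCompact_closedBall p r) hsupp
  obtain ⟨Φ, h1, h2, h3, h4, h5, h6, h7⟩ := exists_hamFlow hψ (hcs.fderiv ℝ)
  have hmem : ∀ t, Φ t ∈ areaDiffeoGroup (closedBall p r) := fun t =>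
    ⟨h5 t, h6 t, fun z hz => flow_eq_self_of_hamField_eq_zero hψ (hcs.fderiv ℝ) h2 h3 (hsupp z hz) t,
      h7 t⟩
  -- If all the flow maps fixed `p`, the field would vanish there; but near `p` the Hamiltonian is
  -- `z₁`, whose field is `unitVec 0`.
  by_contra! hcon
  have hconst : (fun s => Φ s p) = fun _ => p := funext fun s => hcon _ (hmem s)
  have hder := h3 0 p
  rw [hconst, h2] at hder
  have hz : hamField ψ p = 0 := (hder.unique (hasDerivAt_const _ _))
  have heq : ψ =ᶠ[nhds p] fun z => z 1 := by
    filter_upwards [β.eventuallyEq_one] with z hz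
    simp [hψdef, hz]
  rw [hamField, heq.fderiv_eq] at hz
  have := hamField_coord_one p
  rw [hamField, hz] at this
  have := congrArg (fun v : Plane => v 0) this
  simp [unitVec] at this

/-- Let `f` move the origin, hence a small ball around it off itself, and let `g` move the origin
with support in that ball. Then `f * g * f⁻¹` fixes the origin and `g` does not. -/
lemma exists_not_commute {r : ℝ} (hr : 0 < r) : ∃ f ∈ areaDiffeoGroup (closedBall 0 r),
    ∃ g ∈ areaDiffeoGroup (closedBall 0 r), f * g * f⁻¹ * g⁻¹ ≠ 1 := by
  obtain ⟨f, hf, hf0⟩ := exists_areaDiffeo_ne 0 hr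
  have h1 : ∀ᶠ s in nhdsWithin (0 : ℝ) (Ioi 0), ∀ z ∈ closedBall (0 : Plane) s,
      f z ∉ closedBall 0 s := by
    have hpos : 0 < ‖f 0‖ := norm_pos_iff.2 hf0
    have hcont : ContinuousAt (fun z => ‖f z‖) 0 := (hf.1.continuous.norm).continuousAt
    obtain ⟨δ, hδ, hδ'⟩ := Metric.eventually_nhds_iff.1
      (hcont.eventually (lt_mem_nhds (half_lt_self hpos)))
    have hmin : 0 < min δ (‖f 0‖ / 2) := lt_min hδ (by positivity)
    filter_upwards [Ioo_mem_nhdsGT hmin] with s hs z hz hfz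
    have h2 := hδ' (lt_of_le_of_lt hz (hs.2.trans_le (min_le_left _ _)))
    rw [mem_closedBall_zero_iff] at hfz
    have := hs.2.trans_le (min_le_right _ _)
    linarith
  obtain ⟨s, hs, hs0⟩ := (h1.and (Ioo_mem_nhdsGT hr)).exists
  obtain ⟨g, hg, hg0⟩ := exists_areaDiffeo_ne 0 hs0.1
  refine ⟨f, hf, g, areaDiffeoGroup_mono (closedBall_subset_closedBall hs0.2.le) hg, fun hcon => hg0 ?_⟩
  have h2 : f * g * f⁻¹ = g := mul_inv_eq_one.1 hcon
  have h3 : f⁻¹ 0 ∉ closedBall (0 : Plane) s := fun hmem => by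
    have := hs _ hmem
    rw [show f (f⁻¹ 0) = 0 from f.apply_symm_apply 0] at this
    exact this (mem_closedBall_self hs0.1.le)
  rw [← h2, Equiv.Perm.mul_apply, Equiv.Perm.mul_apply, hg.2.2.1 _ h3]
  exact f.apply_symm_apply 0

end PlaneDisplacement

/-! ### Displacing the unit disc with Hamiltonians concentrated near circles, and the commutator
trick. -/

section PlaneShift

open Set Metric MeasureTheory
open scoped NNReal

/-- A smooth function on the line which is `1` near `0` and vanishes outside `(-1,1)`. -/
noncomputable def lineBump : ContDiffBump (0 : ℝ) := ⟨1 / 2, 1, by norm_num, by norm_num⟩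

/-- The Hamiltonian `z ↦ z₁` of the horizontal translation, cut off at the distance `4^(-k)` from
the unit circle. -/
noncomputable def circleHam (k : ℕ) (z : Plane) : ℝ := z 1 * lineBump (4 ^ k * (‖z‖ ^ 2 - 1))

lemma contDiff_circleHam (k : ℕ) : ContDiff ℝ ∞ (circleHam k) :=
  (contDiff_coord 1).mul (lineBump.contDiff.comp
    (contDiff_const.mul ((contDiff_norm_sq ℝ).sub contDiff_const)))

lemma lineBump_eq_zero {s : ℝ} (hs : 1 ≤ |s|) : lineBump s = 0 :=
  lineBump.zero_of_le_dist (by rwa [Real.dist_eq, sub_zero])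

/-- The annulus around the unit circle which contains the support of `circleHam k`. -/
def circleAnnulus (k : ℕ) : Set Plane := {z | |‖z‖ ^ 2 - 1| ≤ 4⁻¹ ^ k}

lemma isClosed_circleAnnulus (k : ℕ) : IsClosed (circleAnnulus k) :=
  isClosed_le (by fun_prop) continuous_const

lemma norm_le_of_mem_circleAnnulus {k : ℕ} {z : Plane} (hz : z ∈ circleAnnulus k) : ‖z‖ ≤ 2 := by
  have h1 : (4⁻¹ : ℝ) ^ k ≤ 1 := pow_le_one₀ (by norm_num) (by norm_num)
  have h2 := (abs_le.1 (show |‖z‖ ^ 2 - 1| ≤ 4⁻¹ ^ k from hz)).2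
  nlinarith [norm_nonneg z]

lemma circleHam_eq_zero {k : ℕ} {z : Plane} (hz : z ∉ circleAnnulus k) : circleHam k z = 0 := by
  rw [circleHam, lineBump_eq_zero, mul_zero]
  rw [abs_mul, abs_of_pos (by positivity)]
  have : (4⁻¹ : ℝ) ^ k < |‖z‖ ^ 2 - 1| := not_le.1 hz
  rw [inv_pow, inv_lt_iff_one_lt_mul₀ (by positivity), mul_comm] at this
  linarith

/-- The annulus is cut out by `‖z‖ ^ 2`, so the difference of the two disc areas is exactly `2πδ`
with `δ = 4^(-k)`. -/
lemma volume_circleAnnulus_le (k : ℕ) :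
    volume (circleAnnulus k) ≤ ENNReal.ofReal (2 * Real.pi) * 4⁻¹ ^ k := by
  set δ : ℝ := 4⁻¹ ^ k with hδ
  have hδ0 : 0 < δ := by positivity
  have hδ1 : δ ≤ 1 := pow_le_one₀ (by norm_num) (by norm_num)
  have hsub : circleAnnulus k ⊆ closedBall 0 (√(1 + δ)) \ ball 0 (√(1 - δ)) := by
    intro z hz
    have h := abs_le.1 (show |‖z‖ ^ 2 - 1| ≤ δ from hz)
    refine ⟨?_, ?_⟩
    · rw [mem_closedBall_zero_iff]
      exact Real.le_sqrt_of_sq_le (by linarith)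
    · rw [mem_ball_zero_iff, not_lt]
      exact Real.sqrt_le_iff.2 ⟨norm_nonneg _, by linarith⟩
  refine (measure_mono hsub).trans ?_
  rw [measure_sdiff (ball_subset_closedBall.trans (closedBall_subset_closedBall
    (Real.sqrt_le_sqrt (by linarith)))) measurableSet_ball.nullMeasurableSet
    measure_ball_lt_top.ne, EuclideanSpace.volume_closedBall_fin_two,
    EuclideanSpace.volume_ball_fin_two, ← ENNReal.ofReal_pow (Real.sqrt_nonneg _),
    ← ENNReal.ofReal_pow (Real.sqrt_nonneg _), Real.sq_sqrt (by linarith),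
    Real.sq_sqrt (by linarith), ← ENNReal.ofReal_mul (by linarith),
    ← ENNReal.ofReal_mul (by linarith), ← ENNReal.ofReal_sub _ (mul_nonneg (by linarith) Real.pi_pos.le)]
  have : (4⁻¹ : ℝ≥0∞) ^ k = ENNReal.ofReal δ := by
    rw [hδ, ENNReal.ofReal_pow (by norm_num), ENNReal.ofReal_inv_of_pos (by norm_num)]
    norm_num
  rw [this, ← ENNReal.ofReal_mul (by positivity)]
  refine ENNReal.ofReal_le_ofReal (le_of_eq ?_)
  ring

/-- On the annulus `‖z‖ ≤ 2`. Differentiating the cut-off costs at most `2 * C * 4^k * 4`,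
differentiating `z₁` at most `1`; this gives `1 + 8 * C`. -/
lemma exists_bound_fderiv_circleHam :
    ∃ C : ℝ, 0 ≤ C ∧ ∀ k z, ‖fderiv ℝ (circleHam k) z‖ ≤ C * 4 ^ k := by
  have hd : ContDiff ℝ ∞ (lineBump : ℝ → ℝ) := lineBump.contDiff
  obtain ⟨C, hC⟩ := (lineBump.hasCompactSupport.deriv).exists_bound_of_continuous
    (hd.continuous_deriv (by simp))
  have hC0 : 0 ≤ C := (norm_nonneg _).trans (hC 0)
  refine ⟨1 + 8 * C, by positivity, fun k z => ?_⟩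
  by_cases hz : z ∈ circleAnnulus k
  · have hz2 := norm_le_of_mem_circleAnnulus hz
    have h1 : HasFDerivAt (fun z : Plane => (4 : ℝ) ^ k * (‖z‖ ^ 2 - 1))
        ((4 : ℝ) ^ k • (2 • innerSL ℝ z)) z :=
      (((hasStrictFDerivAt_norm_sq z).hasFDerivAt.sub_const 1).const_mul _)
    have h2 := ((hd.differentiable (by simp) _).hasDerivAt).comp_hasFDerivAt z h1
    have h3 : HasFDerivAt (fun z : Plane => z 1) (EuclideanSpace.proj 1 : Plane →L[ℝ] ℝ) z :=
      (EuclideanSpace.proj 1 : Plane →L[ℝ] ℝ).hasFDerivAt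
    have h4 : HasFDerivAt (circleHam k) (z 1 • (deriv lineBump (4 ^ k * (‖z‖ ^ 2 - 1)) •
        ((4 : ℝ) ^ k • (2 • innerSL ℝ z))) + lineBump (4 ^ k * (‖z‖ ^ 2 - 1)) •
        (EuclideanSpace.proj 1 : Plane →L[ℝ] ℝ)) z := h3.mul h2
    rw [h4.fderiv]
    have hz1 : ‖z 1‖ ≤ 2 := (PiLp.norm_apply_le z 1).trans hz2
    have hproj : ‖(EuclideanSpace.proj 1 : Plane →L[ℝ] ℝ)‖ ≤ 1 :=
      ContinuousLinearMap.opNorm_le_bound _ zero_le_one fun v => by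
        rw [one_mul]; exact PiLp.norm_apply_le v 1
    have hb : ‖lineBump (4 ^ k * (‖z‖ ^ 2 - 1))‖ ≤ 1 := by
      rw [Real.norm_of_nonneg lineBump.nonneg]; exact lineBump.le_one
    have h4k : (1 : ℝ) ≤ 4 ^ k := one_le_pow₀ (by norm_num)
    have hin : ‖2 • innerSL ℝ z‖ ≤ 4 := by
      refine (norm_nsmul_le).trans ?_
      rw [innerSL_apply_norm]
      norm_num; linarith
    calc _ ≤ ‖z 1‖ * (‖deriv lineBump (4 ^ k * (‖z‖ ^ 2 - 1))‖ * (4 ^ k * ‖2 • innerSL ℝ z‖)) +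
          ‖lineBump (4 ^ k * (‖z‖ ^ 2 - 1))‖ * ‖(EuclideanSpace.proj 1 : Plane →L[ℝ] ℝ)‖ := by
          refine (norm_add_le _ _).trans (le_of_eq ?_)
          rw [norm_smul, norm_smul, norm_smul (4 ^ k : ℝ), norm_smul (lineBump _),
            Real.norm_of_nonneg (by positivity : (0 : ℝ) ≤ 4 ^ k)]
      _ ≤ 2 * (C * (4 ^ k * 4)) + 1 * 1 := by
          gcongr
          exact hC _
      _ ≤ (1 + 8 * C) * 4 ^ k := by nlinarith
  · have : circleHam k =ᶠ[nhds z] fun _ => 0 := by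
      filter_upwards [(isClosed_circleAnnulus k).isOpen_compl.mem_nhds hz] with y hy
        using circleHam_eq_zero hy
    rw [this.fderiv_eq]
    simp only [fderiv_fun_const, Pi.zero_apply, norm_zero]
    positivity

/-- The cut-off of the Hamiltonian `z ↦ z₁` near the unit circle at logarithmic scales. -/
noncomputable def circleAverage (n : ℕ) (z : Plane) : ℝ :=
  (1 / n) * ∑ k ∈ Finset.range n, circleHam k z

lemma contDiff_circleAverage (n : ℕ) : ContDiff ℝ ∞ (circleAverage n) :=
  contDiff_const.mul (ContDiff.sum fun k _ => contDiff_circleHam k)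

lemma circleAverage_eq_zero (n : ℕ) {z : Plane} (hz : 2 < ‖z‖) : circleAverage n z = 0 := by
  rw [circleAverage, Finset.sum_eq_zero, mul_zero]
  exact fun k _ => circleHam_eq_zero fun h => hz.not_ge (norm_le_of_mem_circleAnnulus h)

lemma hamField_circleAverage_eq_zero (n : ℕ) {z : Plane} (hz : 2 < ‖z‖) :
    hamField (circleAverage n) z = 0 :=
  hamField_eq_zero_of_eqOn (isClosed_closedBall (x := (0 : Plane)) (ε := 2)) (fun y hy =>
    circleAverage_eq_zero n (by simpa using hy)) (by simpa using hz)

/-- Every cut-off equals one near the circle, so averaging finitely many does not change the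
function there. -/
lemma circleAverage_eventuallyEq {n : ℕ} (hn : 0 < n) {z : Plane} (hz : ‖z‖ = 1) :
    circleAverage n =ᶠ[nhds z] fun z => z 1 := by
  have h1 : ∀ k, ∀ᶠ y in nhds z, circleHam k y = y 1 := by
    intro k
    have h2 : Filter.Tendsto (fun y : Plane => (4 : ℝ) ^ k * (‖y‖ ^ 2 - 1)) (nhds z) (nhds 0) := by
      have : Continuous (fun y : Plane => (4 : ℝ) ^ k * (‖y‖ ^ 2 - 1)) := by fun_prop
      simpa [hz] using this.tendsto z
    filter_upwards [h2.eventually lineBump.eventuallyEq_one] with y hy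
    rw [circleHam, hy, Pi.one_apply, mul_one]
  filter_upwards [(Filter.eventually_all_finset (Finset.range n)).2 fun k _ => h1 k] with y hy
  have hn' : (n : ℝ) ≠ 0 := by positivity
  rw [circleAverage, Finset.sum_congr rfl hy, Finset.sum_const, Finset.card_range, nsmul_eq_mul]
  field_simp

/-- Values at most `2`, and gradients of order `4^k`, on an area of order `4^(-k)`, give squared
`L²` norms of order `4^(-k)` and `16^k * 4^(-k) = 4^k`. The radius `5` is `2 + 3`: the annuli lie in
the ball of radius `2` and are translated by at most `3`. -/
lemma exists_isDyadicAverage_circleAverage : ∃ A : ℝ≥0∞, A ≠ ⊤ ∧ ∀ (n : ℕ) (a : Plane), ‖a‖ ≤ 3 →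
    IsDyadicAverage (closedBall 0 5) A n (fun z => circleAverage n (z - a)) := by
  obtain ⟨C, hC0, hC⟩ := exists_bound_fderiv_circleHam
  refine ⟨(4 + ENNReal.ofReal C ^ 2) * ENNReal.ofReal (2 * Real.pi), by finiteness, fun n a ha =>
    ⟨fun k z => circleHam k (z - a), fun k => (contDiff_circleHam k).comp
      (contDiff_id.sub contDiff_const), fun k z hz => circleHam_eq_zero fun h => hz ?_,
      fun k => ?_, fun k => ?_, rfl⟩⟩
  · rw [mem_closedBall_zero_iff]
    have h1 := norm_le_of_mem_circleAnnulus h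
    have h2 := norm_add_le (z - a) a
    rw [sub_add_cancel] at h2
    linarith
  · rw [lintegral_sub_right_eq_self (fun z => ‖circleHam k z‖ₑ ^ 2) a]
    have : ∀ z, ‖circleHam k z‖ₑ ^ 2 ≤ (circleAnnulus k).indicator (fun _ => 4) z := by
      intro z
      by_cases hz : z ∈ circleAnnulus k
      · rw [indicator_of_mem hz]
        have : ‖circleHam k z‖ ≤ 2 := by
          rw [circleHam, norm_mul, Real.norm_of_nonneg lineBump.nonneg]
          refine (mul_le_of_le_one_right (norm_nonneg _) lineBump.le_one).trans ?_
          exact (PiLp.norm_apply_le z 1).trans (norm_le_of_mem_circleAnnulus hz)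
        rw [← ofReal_norm]
        calc ENNReal.ofReal ‖circleHam k z‖ ^ 2 ≤ ENNReal.ofReal 2 ^ 2 := by gcongr
          _ = 4 := by norm_num
      · rw [circleHam_eq_zero hz]; simp
    refine (lintegral_mono this).trans ?_
    rw [lintegral_indicator_const (isClosed_circleAnnulus k).measurableSet, mul_assoc]
    gcongr
    · exact le_self_add
    · exact volume_circleAnnulus_le k
  · simp only [fderiv_comp_sub]
    rw [lintegral_sub_right_eq_self (fun z => ‖fderiv ℝ (circleHam k) z‖ₑ ^ 2) a]
    have : ∀ z, ‖fderiv ℝ (circleHam k) z‖ₑ ^ 2 ≤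
        (circleAnnulus k).indicator (fun _ => ENNReal.ofReal C ^ 2 * 4 ^ (2 * k)) z := by
      intro z
      by_cases hz : z ∈ circleAnnulus k
      · rw [indicator_of_mem hz, ← ofReal_norm]
        calc ENNReal.ofReal ‖fderiv ℝ (circleHam k) z‖ ^ 2
            ≤ ENNReal.ofReal (C * 4 ^ k) ^ 2 := by gcongr; exact hC k z
          _ = _ := by
            rw [ENNReal.ofReal_mul hC0, mul_pow, ENNReal.ofReal_pow (by norm_num), ← pow_mul,
              mul_comm k 2]
            norm_num
      · have : circleHam k =ᶠ[nhds z] fun _ => 0 := by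
          filter_upwards [(isClosed_circleAnnulus k).isOpen_compl.mem_nhds hz] with y hy
            using circleHam_eq_zero hy
        rw [this.fderiv_eq, indicator_of_notMem hz, fderiv_fun_const, Pi.zero_apply, ← ofReal_norm,
          norm_zero]
        simp
    refine (lintegral_mono this).trans ?_
    rw [lintegral_indicator_const (isClosed_circleAnnulus k).measurableSet]
    calc _ ≤ ENNReal.ofReal C ^ 2 * 4 ^ (2 * k) * (ENNReal.ofReal (2 * Real.pi) * 4⁻¹ ^ k) := by
          gcongr; exact volume_circleAnnulus_le k
      _ = ENNReal.ofReal C ^ 2 * ENNReal.ofReal (2 * Real.pi) * 4 ^ k * (4 ^ k * 4⁻¹ ^ k) := by ring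
      _ = ENNReal.ofReal C ^ 2 * ENNReal.ofReal (2 * Real.pi) * 4 ^ k := by
          rw [← mul_pow, ENNReal.mul_inv_cancel (by norm_num) (by norm_num), one_pow, mul_one]
      _ ≤ _ := by gcongr; exact le_add_self

/-- The unit disc can be displaced from itself by diffeomorphisms which can be reached by paths
with Hamiltonians concentrated near circles. -/
theorem exists_isDyadicallyReachable_displacement : ∃ φ : ℕ → Equiv.Perm Plane,
    IsDyadicallyReachable (closedBall 0 5) φ ∧
    ∀ n, 0 < n → ∀ z, ‖z‖ < 1 → 1 ≤ ‖φ n z‖ := by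
  obtain ⟨A, hA, hdy⟩ := exists_isDyadicAverage_circleAverage
  obtain ⟨C, hC0, hC⟩ := exists_bound_deriv_smoothTransition
  have key : ∀ n : ℕ, 0 < n → ∃ φ : Equiv.Perm Plane, HamReachable (closedBall 0 5)
      {ψ | IsDyadicAverage (closedBall 0 5) (ENNReal.ofReal (3 * C) ^ 2 * A) n ψ} φ ∧
      ∀ z, ‖z‖ < 1 → 1 ≤ ‖φ z‖ := by
    intro n hn
    -- The Hamiltonian in the frame moving with the translation. It vanishes near the unit circle,
    -- so its flow fixes the circle pointwise.
    set H : Plane → ℝ := fun z => circleAverage n z - z 1 with hH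
    have hHs : ContDiff ℝ ∞ H := (contDiff_circleAverage n).sub (contDiff_coord 1)
    have hHf : ∀ z, hamField H z = hamField (circleAverage n) z - unitVec 0 := by
      intro z
      have h1 : DifferentiableAt ℝ (circleAverage n) z :=
        (contDiff_circleAverage n).differentiable (by simp) z
      have h2 : DifferentiableAt ℝ (fun z : Plane => z 1) z :=
        (contDiff_coord 1).differentiable (by simp) z
      rw [← hamField_coord_one z, hamField, hamField, hamField, ← map_sub, hH, fderiv_fun_sub h1 h2]
    have hcs : HasCompactSupport (hamField (circleAverage n)) :=
      HasCompactSupport.intro (isCompact_closedBall (0 : Plane) 2) fun z hz =>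
        hamField_circleAverage_eq_zero n (by simpa using hz)
    have hcs' : HasCompactSupport (fderiv ℝ (hamField H)) := by
      have : hamField H = fun z => hamField (circleAverage n) z - unitVec 0 := funext hHf
      rw [this]
      have h2 : (fderiv ℝ fun z => hamField (circleAverage n) z - unitVec 0) =
          fderiv ℝ (hamField (circleAverage n)) := by
        ext1 z; rw [fderiv_sub_const]
      rw [h2]
      exact hcs.fderiv ℝ
    obtain ⟨g, g1, g2, g3, g4, g5, g6, g7⟩ := exists_hamFlow hHs hcs'
    have hfix := fun {z} => flow_eq_self_of_hamField_eq_zero hHs hcs' g2 g3 (z := z)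
    have hcirc : ∀ z : Plane, ‖z‖ = 1 → ∀ t, g t z = z := fun z hz => hfix (by
      have : H =ᶠ[nhds z] fun _ => 0 := by
        filter_upwards [circleAverage_eventuallyEq hn hz] with y hy
        rw [hH]; simp [hy]
      rw [hamField, this.fderiv_eq]; simp)
    -- An orbit leaving the disc would meet the circle, whose points are stationary.
    have hdisc : ∀ z : Plane, ‖z‖ < 1 → ∀ t, ‖g t z‖ < 1 := by
      intro z hz t
      by_contra! hcon
      have hcont : Continuous fun s => ‖g s z‖ :=
        (g1.continuous.comp (continuous_id.prodMk continuous_const)).norm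
      have hmem : (1 : ℝ) ∈ uIcc ‖g 0 z‖ ‖g t z‖ := by
        rw [g2]; exact Icc_subset_uIcc ⟨hz.le, hcon⟩
      obtain ⟨s, -, hs⟩ := intermediate_value_uIcc hcont.continuousOn hmem
      have h1 := hcirc _ hs (-s)
      rw [← Equiv.Perm.mul_apply, ← g4, neg_add_cancel, g2] at h1
      have h2 : g s z = z := h1.symm
      simp only [h2] at hs
      linarith
    -- A point at distance more than `5` stays at distance more than `2` during time `3`, and there
    -- the field is the constant `-unitVec 0`.
    have hout : ∀ s ∈ Icc (0 : ℝ) 3, ∀ z ∉ closedBall (0 : Plane) 5, g s z = z - s • unitVec 0 := by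
      intro s hs z hz
      have hz5 : 5 < ‖z‖ := by simpa using hz
      obtain ⟨K, hK0, hK⟩ := exists_lipschitz_of_hasCompactSupport (contDiff_hamField hHs) hcs'
      have hlip : LipschitzWith ⟨K, hK0⟩ (hamField H) := LipschitzWith.of_dist_le_mul fun x y => by
        rw [dist_eq_norm, dist_eq_norm]; exact hK y x
      have hder : ∀ t : ℝ, HasDerivAt (fun t : ℝ => z - t • unitVec 0) (-unitVec 0) t := fun t => by
        simpa using ((hasDerivAt_id t).smul_const (unitVec 0)).const_sub z
      refine ODE_solution_unique (v := fun _ => hamField H) (K := ⟨K, hK0⟩) (a := 0) (b := 3)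
        (f := fun t => g t z) (g := fun t => z - t • unitVec 0)
        (fun _ => hlip) (fun t _ => (g3 t z).continuousAt.continuousWithinAt)
        (fun t _ => (g3 t z).hasDerivWithinAt)
        (fun t _ => (hder t).continuousAt.continuousWithinAt) (fun t ht => ?_)
        (by simp [g2]) hs
      have : hamField H (z - t • unitVec 0) = -unitVec 0 := by
        rw [hHf, hamField_circleAverage_eq_zero, zero_sub]
        have h1 := norm_sub_norm_le z (t • unitVec 0)
        have h2 : ‖t • unitVec 0‖ ≤ 3 := by
          rw [norm_smul, Real.norm_of_nonneg ht.1]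
          simp only [unitVec, PiLp.norm_single, norm_one, mul_one]
          exact ht.2.le
        linarith
      rw [this]
      exact (hder t).hasDerivWithinAt
    set σ : ℝ → ℝ := fun t => 3 * Real.smoothTransition t with hσ
    have hσs : ContDiff ℝ ∞ σ := contDiff_const.mul Real.smoothTransition.contDiff
    have hσd : ∀ t, HasDerivAt σ (3 * deriv Real.smoothTransition t) t := fun t =>
      ((Real.smoothTransition.contDiff (n := 1)).differentiable (by simp) t).hasDerivAt.const_mul 3
    have hσI : ∀ t, σ t ∈ Icc (0 : ℝ) 3 := fun t =>
      ⟨mul_nonneg (by norm_num) (Real.smoothTransition.nonneg t), by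
        have := Real.smoothTransition.le_one t; simp only [hσ]; linarith⟩
    have hnorm : ∀ t, ‖σ t • unitVec 0‖ ≤ 3 := fun t => by
      rw [norm_smul, Real.norm_of_nonneg (hσI t).1]
      simp only [unitVec, PiLp.norm_single, norm_one, mul_one]
      exact (hσI t).2
    -- Back to the fixed frame: the translation cancels `g` far out, which gives compact support,
    -- and it turns the Hamiltonian into a moving copy of `circleAverage n`. The total shift `3`
    -- sends the disc to points of norm at least `3 - 1`.
    refine ⟨Equiv.addRight ((3 : ℝ) • unitVec 0) * g 3,
      ⟨fun t => Equiv.addRight (σ t • unitVec 0) * g (σ t),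
      fun t z => (3 * deriv Real.smoothTransition t) * circleAverage n (z - σ t • unitVec 0),
      fun t => ⟨?_, ?_, ?_, ?_⟩, ?_, ?_, ?_, fun t => ?_, fun t z => ?_⟩, fun z hz => ?_⟩
    · exact (g5 (σ t)).add contDiff_const
    · exact (g6 (σ t)).comp (contDiff_id.add contDiff_const)
    · intro z hz
      rw [Equiv.Perm.mul_apply, hout _ (hσI t) z hz]
      exact sub_add_cancel _ _
    · intro z a b
      have : ⇑(Equiv.addRight (σ t • unitVec 0) * g (σ t)) = fun z => g (σ t) z + σ t • unitVec 0 := rfl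
      rw [this, fderiv_add_const]
      exact g7 _ z a b
    · exact (g1.comp ((hσs.comp contDiff_fst).prodMk contDiff_snd)).add
        ((hσs.comp contDiff_fst).smul contDiff_const)
    · ext1 z
      simp [hσ, Real.smoothTransition.zero, g2]
    · simp [hσ, Real.smoothTransition.one]
    · refine (hdy n _ (hnorm t)).const_mul ?_
      rw [abs_mul, abs_of_pos (by norm_num : (0 : ℝ) < 3)]
      exact mul_le_mul_of_nonneg_left (hC t) (by norm_num)
    · rw [hamField_const_mul]
      have h1 := ((g3 (σ t) z).scomp t (hσd t)).add ((hσd t).smul_const (unitVec 0))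
      refine h1.congr_deriv ?_
      rw [← smul_add, hHf, sub_add_cancel]
      congr 1
      have h2 : (Equiv.addRight (σ t • unitVec 0) * g (σ t)) z = g (σ t) z + σ t • unitVec 0 := rfl
      rw [h2, hamField, hamField, fderiv_comp_sub, add_sub_cancel_right]
    · have h1 := hdisc z hz 3
      have h2 : (Equiv.addRight ((3 : ℝ) • unitVec 0) * g 3) z = g 3 z + (3 : ℝ) • unitVec 0 := rfl
      rw [h2]
      have h3 := norm_sub_norm_le ((3 : ℝ) • unitVec 0) (-(g 3 z))
      have h4 : ‖(3 : ℝ) • unitVec 0‖ = 3 := by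
        rw [norm_smul]; simp [unitVec]
      rw [sub_neg_eq_add, norm_neg, h4, add_comm] at h3
      linarith
  choose! φ h1 h2 using key
  exact ⟨φ, ⟨_, by finiteness, h1⟩, h2⟩

/-- A commutator of two elements with disjoint images under a displacement is a product of four
conjugates of the displacement and its inverse. -/
lemma commutator_eq_of_commute {G : Type*} [Group G] {f g φ : G} (h : Commute f (φ * g * φ⁻¹)) :
    f * g * f⁻¹ * g⁻¹ =
      ((f * g) * φ * (f * g)⁻¹) * ((f * φ⁻¹ * f⁻¹) * (φ * (g * φ⁻¹ * g⁻¹))) := by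
  have h1 : f⁻¹ * (φ * g * φ⁻¹) = (φ * g * φ⁻¹) * f⁻¹ := (h.inv_left).eq
  calc f * g * f⁻¹ * g⁻¹
      = f * g * φ * g⁻¹ * φ⁻¹ * ((φ * g * φ⁻¹) * f⁻¹) * g⁻¹ := by group
    _ = f * g * φ * g⁻¹ * φ⁻¹ * (f⁻¹ * (φ * g * φ⁻¹)) * g⁻¹ := by rw [h1]
    _ = _ := by group

/-- There is a nontrivial area preserving diffeomorphism which can, for all `n`, be reached by
paths whose Hamiltonians are `n`-fold dyadic averages with uniform bounds. -/
theorem exists_reachable_ne_one : ∃ h : Equiv.Perm Plane, h ≠ 1 ∧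
    IsDyadicallyReachable (closedBall 0 5) (fun _ => h) := by
  -- The radius `1 / 2` puts the closed ball inside the open unit disc, which is what gets
  -- displaced. The maps `f` and `g` are chosen before `n`.
  obtain ⟨f, hf, g, hg, hfg⟩ := exists_not_commute (r := 1 / 2) (by norm_num)
  obtain ⟨φ, hφ, hdis⟩ := exists_isDyadicallyReachable_displacement
  have hmono : areaDiffeoGroup (closedBall (0 : Plane) (1 / 2)) ≤ areaDiffeoGroup (closedBall 0 5) :=
    areaDiffeoGroup_mono (closedBall_subset_closedBall (by norm_num))
  have hK := isCompact_closedBall (0 : Plane) 5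
  obtain ⟨A, hA, h⟩ := (hφ.conj hK (hmono (mul_mem hf hg))).mul
    ((hφ.inv.conj hK (hmono hf)).mul (hφ.mul (hφ.inv.conj hK (hmono hg))))
  refine ⟨_, hfg, A, hA, fun n hn => ?_⟩
  rw [commutator_eq_of_commute (φ := φ n)]
  · exact h n hn
  -- The map `f` is supported in the small ball, and the conjugate of `g` in its image under `φ n`,
  -- which is disjoint from it.
  · refine Equiv.Perm.Disjoint.commute fun z => ?_
    by_cases hz : z ∈ closedBall (0 : Plane) (1 / 2)
    · right
      have h1 : (φ n)⁻¹ z ∉ closedBall (0 : Plane) (1 / 2) := fun hmem => by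
        rw [mem_closedBall_zero_iff] at hz hmem
        have := hdis n hn _ (lt_of_le_of_lt hmem (by norm_num))
        rw [show φ n ((φ n)⁻¹ z) = z from (φ n).apply_symm_apply z] at this
        linarith
      rw [Equiv.Perm.mul_apply, Equiv.Perm.mul_apply, hg.2.2.1 _ h1]
      exact (φ n).apply_symm_apply z
    · exact Or.inl (hf.2.2.1 z hz)

end PlaneShift

/-! ### Near orthogonality of dyadic scales in the Sobolev norm of order `-1/2`. -/

section NegativeSobolev

open Set MeasureTheory
open scoped NNReal SchwartzMap LineDeriv

lemma lintegral_enorm_fourier_sq (f : 𝓢(Plane, ℂ)) :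
    ∫⁻ ξ, ‖𝓕 f ξ‖ₑ ^ 2 = ∫⁻ x, ‖f x‖ₑ ^ 2 := by
  have key : ∀ g : 𝓢(Plane, ℂ), ∫⁻ x, ‖g x‖ₑ ^ 2 = ENNReal.ofReal (∫ x, ‖g x‖ ^ 2) := by
    intro g
    have hi : Integrable (fun x => ‖g x‖ ^ 2) volume :=
      (memLp_two_iff_integrable_sq_norm g.continuous.aestronglyMeasurable).1 (g.memLp 2)
    rw [ofReal_integral_eq_lintegral_ofReal hi (Filter.Eventually.of_forall fun x => by positivity)]
    refine lintegral_congr fun x => ?_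
    rw [ENNReal.ofReal_pow (norm_nonneg _), ofReal_norm]
  rw [key, key, SchwartzMap.integral_norm_sq_fourier]

lemma norm_fourier_lineDeriv_le (f : 𝓢(Plane, ℂ)) (m ξ : Plane) :
    ‖𝓕 (∂_{m} f) ξ‖ ≤ 2 * Real.pi * ‖m‖ * ‖ξ‖ * ‖𝓕 f ξ‖ := by
  have hg : (inner ℝ · m : Plane → ℝ).HasTemperateGrowth :=
    ((innerSL ℝ).flip m).hasTemperateGrowth
  rw [SchwartzMap.fourier_lineDerivOp_eq, smul_apply,
    SchwartzMap.smulLeftCLM_apply_apply hg, norm_smul, norm_smul]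
  have h1 : ‖(2 * Real.pi * Complex.I : ℂ)‖ = 2 * Real.pi := by
    simp [abs_of_pos Real.pi_pos]
  rw [h1, mul_assoc (2 * Real.pi), mul_assoc (2 * Real.pi)]
  gcongr
  rw [mul_comm ‖m‖]
  exact norm_inner_le_norm ξ m

/-- A Schwartz function together with a representation as a divergence plus a remainder. -/
structure DivergenceForm where
  /-- the function -/
  fn : 𝓢(Plane, ℂ)
  /-- the vector field whose divergence is taken -/
  field : Fin 2 → 𝓢(Plane, ℂ)
  /-- the remainder -/
  rem : 𝓢(Plane, ℂ)
  fn_eq : fn = ∑ j, ∂_{unitVec j} (field j) + rem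

/-- An upper bound for `(1 + |ξ|²)^(-1/2)` times the Fourier transform. -/
noncomputable def DivergenceForm.bound (w : DivergenceForm) (ξ : Plane) : ℝ :=
  2 * Real.pi * (‖𝓕 (w.field 0) ξ‖ + ‖𝓕 (w.field 1) ξ‖) + ‖𝓕 w.rem ξ‖

lemma DivergenceForm.bound_nonneg (w : DivergenceForm) (ξ : Plane) : 0 ≤ w.bound ξ := by
  have := Real.pi_pos
  unfold bound
  positivity

/-- A divergence costs one factor `‖ξ‖`, which the weight absorbs. Thus the `H^(-1)` norm is
controlled by `L²` norms of the field and the remainder. -/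
lemma DivergenceForm.weight_mul_le (w : DivergenceForm) (ξ : Plane) :
    (1 + ‖ξ‖ ^ 2) ^ (-1 / 2 : ℝ) * ‖𝓕 w.fn ξ‖ ≤ w.bound ξ := by
  have hpos : (0 : ℝ) < 1 + ‖ξ‖ ^ 2 := by positivity
  have h1 : (1 + ‖ξ‖ ^ 2) ^ (-1 / 2 : ℝ) = (√(1 + ‖ξ‖ ^ 2))⁻¹ := by
    rw [Real.sqrt_eq_rpow, ← Real.rpow_neg hpos.le]; norm_num
  have hs0 : 0 < √(1 + ‖ξ‖ ^ 2) := Real.sqrt_pos.2 hpos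
  have hs1 : 1 ≤ √(1 + ‖ξ‖ ^ 2) := Real.one_le_sqrt.2 (by nlinarith [norm_nonneg ξ])
  have hs2 : ‖ξ‖ ≤ √(1 + ‖ξ‖ ^ 2) := Real.le_sqrt_of_sq_le (by linarith)
  rw [h1, inv_mul_le_iff₀ hs0]
  have h2 : 𝓕 w.fn ξ = 𝓕 (∂_{unitVec 0} (w.field 0)) ξ + 𝓕 (∂_{unitVec 1} (w.field 1)) ξ +
      𝓕 w.rem ξ := by
    rw [w.fn_eq, Fin.sum_univ_two, FourierTransform.fourier_add, FourierTransform.fourier_add]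
    rfl
  have h3 : ∀ j, ‖𝓕 (∂_{unitVec j} (w.field j)) ξ‖ ≤
      √(1 + ‖ξ‖ ^ 2) * (2 * Real.pi * ‖𝓕 (w.field j) ξ‖) := by
    intro j
    refine (norm_fourier_lineDeriv_le _ _ _).trans ?_
    have : ‖unitVec j‖ = 1 := by simp [unitVec]
    rw [this, mul_one]
    have := Real.pi_pos
    calc 2 * Real.pi * ‖ξ‖ * ‖𝓕 (w.field j) ξ‖ = ‖ξ‖ * (2 * Real.pi * ‖𝓕 (w.field j) ξ‖) := by ring
      _ ≤ _ := by gcongr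
  have h4 : ‖𝓕 w.rem ξ‖ ≤ √(1 + ‖ξ‖ ^ 2) * ‖𝓕 w.rem ξ‖ :=
    le_mul_of_one_le_left (norm_nonneg _) hs1
  calc ‖𝓕 w.fn ξ‖ ≤ _ := by rw [h2]; exact norm_add₃_le
    _ ≤ _ := add_le_add (add_le_add (h3 0) (h3 1)) h4
    _ = _ := by unfold bound; ring

lemma lintegral_enorm_sq_le_of_eq (f : 𝓢(Plane, ℂ)) : ∫⁻ ξ, ENNReal.ofReal (‖𝓕 f ξ‖ ^ 2) =
    ∫⁻ x, ‖f x‖ₑ ^ 2 := by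
  rw [← lintegral_enorm_fourier_sq]
  refine lintegral_congr fun ξ => ?_
  rw [ENNReal.ofReal_pow (norm_nonneg _), ofReal_norm]

/-- Since `2π < 8`, the square is at most `(8 * (a + b) + c) ^ 2 ≤ 200 * (a ^ 2 + b ^ 2 + c ^ 2)`;
Plancherel and three terms give `600`. -/
lemma DivergenceForm.lintegral_bound_sq_le (w : DivergenceForm) {B : ℝ≥0∞}
    (hF : ∀ j, ∫⁻ x, ‖w.field j x‖ₑ ^ 2 ≤ B) (hG : ∫⁻ x, ‖w.rem x‖ₑ ^ 2 ≤ B) :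
    ∫⁻ ξ, ENNReal.ofReal (w.bound ξ ^ 2) ≤ 600 * B := by
  have h1 : ∀ ξ, ENNReal.ofReal (w.bound ξ ^ 2) ≤ ENNReal.ofReal (200 * ‖𝓕 (w.field 0) ξ‖ ^ 2) +
      (ENNReal.ofReal (200 * ‖𝓕 (w.field 1) ξ‖ ^ 2) + ENNReal.ofReal (200 * ‖𝓕 w.rem ξ‖ ^ 2)) := by
    intro ξ
    rw [← ENNReal.ofReal_add (by positivity) (by positivity),
      ← ENNReal.ofReal_add (by positivity) (by positivity)]
    refine ENNReal.ofReal_le_ofReal ?_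
    have hpi := Real.pi_lt_four
    have hpi0 := Real.pi_pos
    set a := ‖𝓕 (w.field 0) ξ‖
    set b := ‖𝓕 (w.field 1) ξ‖
    set c := ‖𝓕 w.rem ξ‖
    have ha : 0 ≤ a := norm_nonneg _
    have hb : 0 ≤ b := norm_nonneg _
    have hc : 0 ≤ c := norm_nonneg _
    have h2 : w.bound ξ ≤ 8 * (a + b) + c := by
      unfold bound; change 2 * Real.pi * (a + b) + c ≤ _; nlinarith
    have h3 : w.bound ξ ^ 2 ≤ (8 * (a + b) + c) ^ 2 :=
      pow_le_pow_left₀ (w.bound_nonneg ξ) h2 2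
    nlinarith [sq_nonneg (a - b), sq_nonneg (a - c), sq_nonneg (b - c), sq_nonneg a, sq_nonneg b, sq_nonneg c]
  have hm : ∀ f : 𝓢(Plane, ℂ), Measurable fun ξ => ENNReal.ofReal (200 * ‖𝓕 f ξ‖ ^ 2) := fun f =>
    (ENNReal.continuous_ofReal.comp (((𝓕 f).continuous.norm.pow 2).const_mul 200)).measurable
  have hi : ∀ f : 𝓢(Plane, ℂ), ∫⁻ ξ, ENNReal.ofReal (200 * ‖𝓕 f ξ‖ ^ 2) = 200 * ∫⁻ x, ‖f x‖ₑ ^ 2 := by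
    intro f
    simp_rw [ENNReal.ofReal_mul (by norm_num : (0 : ℝ) ≤ 200)]
    rw [lintegral_const_mul' _ _ (by simp), lintegral_enorm_sq_le_of_eq]
    norm_num
  refine (lintegral_mono h1).trans ?_
  rw [lintegral_add_left (hm _), lintegral_add_left (hm _), hi, hi, hi]
  calc _ ≤ 200 * B + (200 * B + 200 * B) := by gcongr; exacts [hF 0, hF 1]
    _ = 600 * B := by ring

/-- Nearly orthogonal functions: the interaction of two scales in the norm of order `-1/2`. -/
lemma DivergenceForm.lintegral_mul_le (v w : DivergenceForm) {A : ℝ≥0∞} {k l : ℕ} (hkl : k ≤ l)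
    (hv : ∫⁻ x, ‖v.fn x‖ₑ ^ 2 ≤ A * 4 ^ k) (hF : ∀ j, ∫⁻ x, ‖w.field j x‖ₑ ^ 2 ≤ A * 4⁻¹ ^ l)
    (hG : ∫⁻ x, ‖w.rem x‖ₑ ^ 2 ≤ A * 4⁻¹ ^ l) :
    ∫⁻ ξ, ENNReal.ofReal ((1 + ‖ξ‖ ^ 2) ^ (-1 / 2 : ℝ) * (‖𝓕 v.fn ξ‖ * ‖𝓕 w.fn ξ‖)) ≤
      601 * A * 2⁻¹ ^ (l - k) := by
  -- Young's inequality with parameter `2^(k+l)`, which balances the coarse `L²` bound `4^k` against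
  -- the fine `H^(-1)` bound `4^(-l)`: both terms become `2^(k-l)`.
  have h1 : ∀ ξ, ENNReal.ofReal ((1 + ‖ξ‖ ^ 2) ^ (-1 / 2 : ℝ) * (‖𝓕 v.fn ξ‖ * ‖𝓕 w.fn ξ‖)) ≤
      ENNReal.ofReal (2⁻¹ ^ (k + l)) * ENNReal.ofReal (‖𝓕 v.fn ξ‖ ^ 2) +
      ENNReal.ofReal (2 ^ (k + l)) * ENNReal.ofReal (w.bound ξ ^ 2) := by
    intro ξ
    rw [← ENNReal.ofReal_mul (by positivity), ← ENNReal.ofReal_mul (by positivity),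
      ← ENNReal.ofReal_add (by positivity) (by positivity)]
    refine ENNReal.ofReal_le_ofReal ?_
    have h2 := w.weight_mul_le ξ
    set a := ‖𝓕 v.fn ξ‖
    have ha : 0 ≤ a := norm_nonneg _
    set t : ℝ := 2 ^ (k + l) with ht
    have ht0 : 0 < t := by positivity
    have h3 : (2⁻¹ : ℝ) ^ (k + l) = t⁻¹ := by rw [inv_pow]
    rw [h3]
    calc (1 + ‖ξ‖ ^ 2) ^ (-1 / 2 : ℝ) * (a * ‖𝓕 w.fn ξ‖)
        = a * ((1 + ‖ξ‖ ^ 2) ^ (-1 / 2 : ℝ) * ‖𝓕 w.fn ξ‖) := by ring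
      _ ≤ a * w.bound ξ := by gcongr
      _ ≤ t⁻¹ * a ^ 2 + t * w.bound ξ ^ 2 := by
        have h4 : 0 ≤ t⁻¹ * (a - t * w.bound ξ) ^ 2 := by positivity
        have h5 : t⁻¹ * (a - t * w.bound ξ) ^ 2 =
            t⁻¹ * a ^ 2 - 2 * (a * w.bound ξ) + t * w.bound ξ ^ 2 := by
          field_simp; ring
        have h6 : 0 ≤ a * w.bound ξ := mul_nonneg ha (w.bound_nonneg ξ)
        linarith
  refine (lintegral_mono h1).trans ?_
  rw [lintegral_add_left, lintegral_const_mul' _ _ (by simp), lintegral_const_mul' _ _ (by simp),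
    lintegral_enorm_sq_le_of_eq]
  swap
  · exact ((ENNReal.continuous_ofReal.comp ((𝓕 v.fn).continuous.norm.pow 2)).measurable).const_mul _
  have h2 : ENNReal.ofReal (2⁻¹ ^ (k + l)) = 2⁻¹ ^ (k + l) := by
    rw [ENNReal.ofReal_pow (by norm_num), ENNReal.ofReal_inv_of_pos (by norm_num)]; norm_num
  have h3 : ENNReal.ofReal (2 ^ (k + l)) = 2 ^ (k + l) := by
    rw [ENNReal.ofReal_pow (by norm_num)]; norm_num
  rw [h2, h3]
  obtain ⟨d, rfl⟩ := Nat.exists_eq_add_of_le hkl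
  have hinv : ∀ m : ℕ, (2 : ℝ≥0∞)⁻¹ ^ m * 2 ^ m = 1 := fun m => by
    rw [← mul_pow, ENNReal.inv_mul_cancel (by norm_num) (by norm_num), one_pow]
  have h4 : ∀ m : ℕ, (4 : ℝ≥0∞) ^ m = 2 ^ m * 2 ^ m := fun m => by
    rw [← mul_pow]; norm_num
  have h4' : ∀ m : ℕ, (4 : ℝ≥0∞)⁻¹ ^ m = 2⁻¹ ^ m * 2⁻¹ ^ m := fun m => by
    rw [← mul_pow, ← ENNReal.mul_inv (by norm_num) (by norm_num)]; norm_num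
  rw [Nat.add_sub_cancel_left]
  calc _ ≤ 2⁻¹ ^ (k + (k + d)) * (A * 4 ^ k) + 2 ^ (k + (k + d)) * (600 * (A * 4⁻¹ ^ (k + d))) := by
        gcongr
        exact w.lintegral_bound_sq_le hF hG
    _ = A * 2⁻¹ ^ d * ((2⁻¹ ^ k * 2 ^ k) * (2⁻¹ ^ k * 2 ^ k)) +
        600 * A * 2⁻¹ ^ d * ((2⁻¹ ^ k * 2 ^ k) * (2⁻¹ ^ k * 2 ^ k) * (2⁻¹ ^ d * 2 ^ d)) := by
        rw [h4', h4]; ring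
    _ = 601 * A * 2⁻¹ ^ d := by rw [hinv, hinv]; ring

/-- The exponent is the distance of `k` and `l`, so the sum is bounded by two geometric series of
value `2`. -/
lemma sum_two_inv_pow_le (k n : ℕ) :
    ∑ l ∈ Finset.range n, (2⁻¹ : ℝ≥0∞) ^ (max k l - min k l) ≤ 4 := by
  have hgeom : ∀ m : ℕ, ∑ i ∈ Finset.range m, (2⁻¹ : ℝ≥0∞) ^ i ≤ 2 := fun m => by
    refine (ENNReal.sum_le_tsum _).trans ?_
    rw [ENNReal.tsum_geometric, ENNReal.one_sub_inv_two, inv_inv]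
  -- For `l < k` the exponent is lowered to `k - 1 - l`, a weaker bound in the form that reversing
  -- the order of a range needs.
  have hsub : ∀ l ∈ Finset.range n, (2⁻¹ : ℝ≥0∞) ^ (max k l - min k l) ≤
      (if l < k then 2⁻¹ ^ (k - 1 - l) else 0) + if k ≤ l then 2⁻¹ ^ (l - k) else 0 := by
    intro l _
    rcases lt_or_ge l k with h | h
    · rw [if_pos h, max_eq_left h.le, min_eq_right h.le]
      refine le_add_right ?_
      exact pow_le_pow_right_of_le_one' (ENNReal.inv_le_one.2 ENNReal.one_lt_two.le) (by omega)
    · rw [if_neg h.not_gt, if_pos h, max_eq_right h, min_eq_left h, zero_add]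
  refine (Finset.sum_le_sum hsub).trans ?_
  rw [Finset.sum_add_distrib]
  have h1 : ∑ l ∈ Finset.range n, (if l < k then (2⁻¹ : ℝ≥0∞) ^ (k - 1 - l) else 0) ≤ 2 := by
    rw [← Finset.sum_filter]
    calc _ ≤ ∑ l ∈ Finset.range k, (2⁻¹ : ℝ≥0∞) ^ (k - 1 - l) :=
          Finset.sum_le_sum_of_subset fun l hl => by
            simp only [Finset.mem_filter, Finset.mem_range] at hl ⊢; exact hl.2
      _ = ∑ l ∈ Finset.range k, (2⁻¹ : ℝ≥0∞) ^ l := Finset.sum_range_reflect (fun i => (2⁻¹ : ℝ≥0∞) ^ i) k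
      _ ≤ 2 := hgeom k
  have h2 : ∑ l ∈ Finset.range n, (if k ≤ l then (2⁻¹ : ℝ≥0∞) ^ (l - k) else 0) ≤ 2 := by
    rw [← Finset.sum_filter]
    calc _ ≤ ∑ l ∈ Finset.Ico k (n + k), (2⁻¹ : ℝ≥0∞) ^ (l - k) :=
          Finset.sum_le_sum_of_subset fun l hl => by
            simp only [Finset.mem_filter, Finset.mem_range, Finset.mem_Ico] at hl ⊢; omega
      _ = ∑ l ∈ Finset.range n, (2⁻¹ : ℝ≥0∞) ^ l := by
          rw [Finset.sum_Ico_eq_sum_range, Nat.add_sub_cancel]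
          exact Finset.sum_congr rfl fun i _ => by rw [Nat.add_sub_cancel_left]
      _ ≤ 2 := hgeom n
  calc _ ≤ (2 : ℝ≥0∞) + 2 := add_le_add h1 h2
    _ = 4 := by norm_num

/-- An `n`-fold average of functions on dyadic scales has a small norm of order `-1/2`. -/
theorem planeSobolevSq_average_le {n : ℕ} (hn : 0 < n) (w : ℕ → DivergenceForm) {A : ℝ≥0∞}
    (hw : ∀ k, ∫⁻ x, ‖(w k).fn x‖ₑ ^ 2 ≤ A * 4 ^ k)
    (hF : ∀ k j, ∫⁻ x, ‖(w k).field j x‖ₑ ^ 2 ≤ A * 4⁻¹ ^ k)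
    (hG : ∀ k, ∫⁻ x, ‖(w k).rem x‖ₑ ^ 2 ≤ A * 4⁻¹ ^ k) {f : Plane → ℝ}
    (hf : ∀ y, (f y : ℂ) = (1 / n : ℝ) * ∑ k ∈ Finset.range n, (w k).fn y) :
    planeSobolevSq (-1 / 2) f ≤ 2404 * A / n := by
  have hfour : ∀ ξ, ‖𝓕 (fun y : Plane => (f y : ℂ)) ξ‖ ≤
      (1 / n : ℝ) * ∑ k ∈ Finset.range n, ‖𝓕 (w k).fn ξ‖ := by
    intro ξ
    have h1 : (fun y : Plane => (f y : ℂ)) =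
        ⇑(((1 / n : ℝ) : ℂ) • ∑ k ∈ Finset.range n, (w k).fn) := by
      ext y
      rw [hf, smul_apply, sum_apply, smul_eq_mul]
    rw [h1, ← SchwartzMap.fourier_coe, FourierTransform.fourier_smul, ← SchwartzMap.fourierTransformCLM_apply ℂ,
      map_sum, smul_apply, sum_apply, norm_smul, Complex.norm_real,
      Real.norm_of_nonneg (by positivity)]
    gcongr
    exact norm_sum_le _ _
  have hpt : ∀ ξ : Plane, ENNReal.ofReal ((1 + ‖ξ‖ ^ 2) ^ (-1 / 2 : ℝ) *
      ‖𝓕 (fun y : Plane => (f y : ℂ)) ξ‖ ^ 2) ≤ ENNReal.ofReal ((1 / n : ℝ) ^ 2) *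
      ∑ k ∈ Finset.range n, ∑ l ∈ Finset.range n, ENNReal.ofReal ((1 + ‖ξ‖ ^ 2) ^ (-1 / 2 : ℝ) *
        (‖𝓕 (w k).fn ξ‖ * ‖𝓕 (w l).fn ξ‖)) := by
    intro ξ
    have hW : 0 ≤ (1 + ‖ξ‖ ^ 2) ^ (-1 / 2 : ℝ) := by positivity
    simp_rw [← ENNReal.ofReal_sum_of_nonneg (fun l _ => mul_nonneg hW (mul_nonneg (norm_nonneg (𝓕 (w _).fn ξ)) (norm_nonneg (𝓕 (w l).fn ξ))))]
    rw [← ENNReal.ofReal_sum_of_nonneg (fun k _ => Finset.sum_nonneg fun l _ =>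
      mul_nonneg hW (mul_nonneg (norm_nonneg _) (norm_nonneg _))), ← ENNReal.ofReal_mul (by positivity)]
    refine ENNReal.ofReal_le_ofReal ?_
    calc _ ≤ (1 + ‖ξ‖ ^ 2) ^ (-1 / 2 : ℝ) *
          ((1 / n : ℝ) * ∑ k ∈ Finset.range n, ‖𝓕 (w k).fn ξ‖) ^ 2 := by
          gcongr; exact hfour ξ
      _ = _ := by
          simp_rw [← Finset.mul_sum]
          rw [← Finset.sum_mul]; ring
  have hpair : ∀ k l, ∫⁻ ξ, ENNReal.ofReal ((1 + ‖ξ‖ ^ 2) ^ (-1 / 2 : ℝ) *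
      (‖𝓕 (w k).fn ξ‖ * ‖𝓕 (w l).fn ξ‖)) ≤ 601 * A * 2⁻¹ ^ (max k l - min k l) := by
    intro k l
    rcases le_total k l with h | h
    · rw [max_eq_right h, min_eq_left h]
      exact (w k).lintegral_mul_le (w l) h (hw k) (hF l) (hG l)
    · rw [max_eq_left h, min_eq_right h]
      refine le_trans (le_of_eq (lintegral_congr fun ξ => ?_))
        ((w l).lintegral_mul_le (w k) h (hw l) (hF k) (hG k))
      rw [mul_comm ‖𝓕 (w k).fn ξ‖]
  have hmeas : ∀ k l, Measurable fun ξ : Plane => ENNReal.ofReal ((1 + ‖ξ‖ ^ 2) ^ (-1 / 2 : ℝ) *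
      (‖𝓕 (w k).fn ξ‖ * ‖𝓕 (w l).fn ξ‖)) := by
    intro k l
    refine (ENNReal.continuous_ofReal.comp (Continuous.mul ?_
      ((𝓕 (w k).fn).continuous.norm.mul (𝓕 (w l).fn).continuous.norm))).measurable
    exact Continuous.rpow_const (by fun_prop) fun ξ => Or.inl (by positivity)
  unfold planeSobolevSq
  refine (lintegral_mono hpt).trans ?_
  rw [lintegral_const_mul' _ _ (by simp), lintegral_finsetSum _ (fun k _ =>
    Finset.measurable_fun_sum _ fun l _ => hmeas k l)]
  simp_rw [lintegral_finsetSum _ (fun l _ => hmeas _ l)]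
  -- Each of the `n` rows of the matrix of pairings sums to at most `601 * A * 4`, against the
  -- factor `1 / n ^ 2` of the average.
  calc _ ≤ ENNReal.ofReal ((1 / n : ℝ) ^ 2) * ∑ k ∈ Finset.range n, (601 * A * 4) := by
        gcongr with k _
        refine (Finset.sum_le_sum fun l _ => hpair k l).trans ?_
        rw [← Finset.mul_sum]
        gcongr
        exact sum_two_inv_pow_le k n
    _ = _ := by
        have hn' : (0 : ℝ) < n := by positivity
        rw [Finset.sum_const, Finset.card_range, nsmul_eq_mul, ENNReal.ofReal_pow (by positivity),
          one_div, ENNReal.ofReal_inv_of_pos hn', ENNReal.ofReal_natCast, ENNReal.div_eq_inv_mul]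
        calc _ = (n : ℝ≥0∞)⁻¹ * ((n : ℝ≥0∞)⁻¹ * n) * (2404 * A) := by ring
          _ = _ := by
            rw [ENNReal.inv_mul_cancel (by exact_mod_cast hn.ne') (by simp), mul_one]

end NegativeSobolev

/-! ### The Sobolev estimate under a change of coordinates. -/

section PushForward

open Set Metric MeasureTheory
open scoped NNReal Topology SchwartzMap LineDeriv

variable {F : Type*} [NormedAddCommGroup F]

open Classical in
/-- The function `f ∘ T⁻¹` on the target of `T`, extended by zero. -/
noncomputable def pushForward (T : OpenPartialHomeomorph Plane Plane) (f : Plane → F)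
    (y : Plane) : F :=
  if y ∈ T.target then f (T.symm y) else 0

lemma pushForward_apply (T : OpenPartialHomeomorph Plane Plane) (f : Plane → F) {z : Plane}
    (hz : z ∈ T.source) : pushForward T f (T z) = f z := by
  rw [pushForward, if_pos (T.map_source hz), T.left_inv hz]

lemma pushForward_eq_zero {T : OpenPartialHomeomorph Plane Plane} {f : Plane → F} {L : Set Plane}
    (hf : ∀ z ∉ L, f z = 0) {y : Plane} (hy : y ∉ T '' L) : pushForward T f y = 0 := by
  unfold pushForward
  split_ifs with h
  · exact hf _ fun hL => hy ⟨_, hL, T.right_inv h⟩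
  · rfl

lemma hasCompactSupport_pushForward {T : OpenPartialHomeomorph Plane Plane} {f : Plane → F}
    {L : Set Plane} (hL : IsCompact L) (hLT : L ⊆ T.source) (hf : ∀ z ∉ L, f z = 0) :
    HasCompactSupport (pushForward T f) :=
  HasCompactSupport.intro (hL.image_of_continuousOn (T.continuousOn.mono hLT))
    fun _ hy => pushForward_eq_zero hf hy

lemma contDiff_pushForward [NormedSpace ℝ F] {T : OpenPartialHomeomorph Plane Plane}
    (hT : ContDiffOn ℝ ∞ T.symm T.target) {f : Plane → F} {L : Set Plane} (hL : IsCompact L)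
    (hLT : L ⊆ T.source) (hf : ∀ z ∉ L, f z = 0) (hfs : ContDiffOn ℝ ∞ f T.source) :
    ContDiff ℝ ∞ (pushForward T f) := by
  rw [contDiff_iff_contDiffAt]
  intro y
  by_cases hy : y ∈ T '' L
  · have hyT : y ∈ T.target := by
      obtain ⟨z, hz, rfl⟩ := hy
      exact T.map_source (hLT hz)
    have h1 : ContDiffAt ℝ ∞ (fun y => f (T.symm y)) y :=
      (hfs.contDiffAt (T.open_source.mem_nhds (T.map_target hyT))).comp y
        (hT.contDiffAt (T.open_target.mem_nhds hyT))
    refine h1.congr_of_eventuallyEq ?_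
    filter_upwards [T.open_target.mem_nhds hyT] with x hx
    rw [pushForward, if_pos hx]
  · have hc : IsClosed (T '' L) := (hL.image_of_continuousOn (T.continuousOn.mono hLT)).isClosed
    refine (contDiffAt_const (c := (0 : F))).congr_of_eventuallyEq ?_
    filter_upwards [hc.isOpen_compl.mem_nhds hy] with x hx
    exact pushForward_eq_zero hf hx

/-- The Jacobian is bounded on the compact set `L`, so the constant is uniform over all functions
supported there. -/
lemma exists_lintegral_pushForward_le {T : OpenPartialHomeomorph Plane Plane}
    (hT : ContDiffOn ℝ ∞ T T.source) {L : Set Plane} (hL : IsCompact L) (hLT : L ⊆ T.source) :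
    ∃ C : ℝ≥0, ∀ f : Plane → F, (∀ z ∉ L, f z = 0) →
      ∫⁻ y, ‖pushForward T f y‖ₑ ^ 2 ≤ C * ∫⁻ z, ‖f z‖ₑ ^ 2 := by
  have hcont : ContinuousOn (fun z => (fderiv ℝ T z).det) L := by
    have h1 : ContinuousOn (fderiv ℝ T) T.source :=
      hT.continuousOn_fderiv_of_isOpen T.open_source (by simp)
    exact ContinuousLinearMap.continuous_det.comp_continuousOn (h1.mono hLT)
  obtain ⟨C, hC⟩ := hL.exists_bound_of_continuousOn hcont
  refine ⟨C.toNNReal, fun f hf => ?_⟩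
  have hmeas : MeasurableSet L := hL.measurableSet
  have himg : IsCompact (T '' L) := hL.image_of_continuousOn (T.continuousOn.mono hLT)
  have hd : ∀ z ∈ L, HasFDerivWithinAt T (fderiv ℝ T z) L z := fun z hz =>
    ((hT.contDiffAt (T.open_source.mem_nhds (hLT hz))).differentiableAt
      (by simp)).hasFDerivAt.hasFDerivWithinAt
  calc ∫⁻ y, ‖pushForward T f y‖ₑ ^ 2 = ∫⁻ y in T '' L, ‖pushForward T f y‖ₑ ^ 2 := by
        rw [← lintegral_indicator himg.measurableSet]
        refine lintegral_congr fun y => ?_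
        by_cases hy : y ∈ T '' L
        · rw [indicator_of_mem hy]
        · rw [indicator_of_notMem hy, pushForward_eq_zero hf hy]; simp
    _ = ∫⁻ z in L, ENNReal.ofReal |(fderiv ℝ T z).det| * ‖pushForward T f (T z)‖ₑ ^ 2 :=
        lintegral_image_eq_lintegral_abs_det_fderiv_mul volume hmeas hd (T.injOn.mono hLT) _
    _ ≤ ∫⁻ z in L, C.toNNReal * ‖f z‖ₑ ^ 2 := by
        refine setLIntegral_mono' hmeas fun z hz => ?_
        rw [pushForward_apply T f (hLT hz)]
        gcongr
        exact ENNReal.ofReal_le_ofReal (hC z hz)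
    _ = C.toNNReal * ∫⁻ z in L, ‖f z‖ₑ ^ 2 := lintegral_const_mul' _ _ (by simp)
    _ ≤ C.toNNReal * ∫⁻ z, ‖f z‖ₑ ^ 2 := by
        gcongr
        exact Measure.restrict_le_self

lemma exists_smooth_cutoff {L S : Set Plane} (hL : IsCompact L) (hS : IsOpen S) (hLS : L ⊆ S) :
    ∃ θ : Plane → ℝ, ∃ L' : Set Plane, ContDiff ℝ ∞ θ ∧ IsCompact L' ∧ L' ⊆ S ∧ L ⊆ L' ∧
      (∀ᶠ z in 𝓝ˢ L, θ z = 1) ∧ (∀ z ∉ L', θ z = 0) ∧ ∀ z, θ z ∈ Icc 0 1 := by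
  obtain ⟨L', hL', h1, h2⟩ := exists_compact_between hL hS hLS
  obtain ⟨f, hf1, hf2, hf3⟩ := exists_contMDiffMap_one_nhds_of_subset_interior (n := (⊤ : ℕ∞)) 𝓘(ℝ, Plane)
    hL.isClosed h1
  exact ⟨f, L', f.contMDiff.contDiff, hL', h2, h1.trans interior_subset, hf1, hf2, hf3⟩

/-- The divergence form of the derivative of `f` along a vector field `b`. -/
noncomputable def derivDivergenceForm (f : Plane → ℝ) (b : Plane → Plane) (hf : ContDiff ℝ ∞ f)
    (hb : ContDiff ℝ ∞ b) (hbc : HasCompactSupport b) : DivergenceForm where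
  fn := HasCompactSupport.toSchwartzMap (f := fun y => ((fderiv ℝ f y (b y) : ℝ) : ℂ))
    (hbc.mono fun y hy hb0 => hy (by simp [hb0]))
    (Complex.ofRealCLM.contDiff.comp ((hf.fderiv_right (by simp)).clm_apply hb))
  field j := HasCompactSupport.toSchwartzMap (f := fun y => ((f y * b y j : ℝ) : ℂ))
    (hbc.mono fun y hy hb0 => hy (by simp [hb0]))
    (Complex.ofRealCLM.contDiff.comp (hf.mul ((contDiff_coord j).comp hb)))
  rem := HasCompactSupport.toSchwartzMap
    (f := fun y => ((-(f y * ∑ j, fderiv ℝ b y (unitVec j) j) : ℝ) : ℂ))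
    ((hbc.fderiv (𝕜 := ℝ)).mono fun y hy hb0 => hy (by simp [hb0]))
    (Complex.ofRealCLM.contDiff.comp (hf.mul (ContDiff.sum fun j _ => (contDiff_coord j).comp
      ((hb.fderiv_right (m := ∞) (by simp)).clm_apply contDiff_const))).neg)
  fn_eq := by
    ext y
    rw [add_apply, sum_apply]
    simp only [SchwartzMap.lineDerivOp_apply_eq_fderiv]
    have hd : ∀ j, fderiv ℝ (fun y => ((f y * b y j : ℝ) : ℂ)) y (unitVec j) =
        ((f y * fderiv ℝ b y (unitVec j) j + b y j * fderiv ℝ f y (unitVec j) : ℝ) : ℂ) := by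
      intro j
      have h1 : HasFDerivAt b (fderiv ℝ b y) y :=
        (hb.differentiable (by simp)).differentiableAt.hasFDerivAt
      have h2 : HasFDerivAt (fun y => b y j) ((EuclideanSpace.proj j : Plane →L[ℝ] ℝ) ∘L
          fderiv ℝ b y) y := (EuclideanSpace.proj j : Plane →L[ℝ] ℝ).hasFDerivAt.comp y h1
      have h3 := (hf.differentiable (by simp)).differentiableAt.hasFDerivAt.mul h2
      have h4 : HasFDerivAt (fun y => ((f y * b y j : ℝ) : ℂ)) _ y :=
        Complex.ofRealCLM.hasFDerivAt.comp y h3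
      rw [h4.fderiv]
      simp
    have hfield : ∀ j, fderiv ℝ (HasCompactSupport.toSchwartzMap
        (f := fun y => ((f y * b y j : ℝ) : ℂ))
        (hbc.mono fun y hy hb0 => hy (by simp [hb0]))
        (Complex.ofRealCLM.contDiff.comp (hf.mul ((contDiff_coord j).comp hb)))) y (unitVec j) =
        ((f y * fderiv ℝ b y (unitVec j) j + b y j * fderiv ℝ f y (unitVec j) : ℝ) : ℂ) := hd
    simp only [hfield]
    change ((fderiv ℝ f y (b y) : ℝ) : ℂ) =
      _ + ((-(f y * ∑ j, fderiv ℝ b y (unitVec j) j) : ℝ) : ℂ)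
    rw [← Complex.ofReal_sum, ← Complex.ofReal_add]
    congr 1
    conv_lhs => rw [plane_eq_sum (b y)]
    simp only [map_add, map_smul, smul_eq_mul, Fin.sum_univ_two]
    ring

lemma fderiv_pushForward_apply {T : OpenPartialHomeomorph Plane Plane}
    (hT : ContDiffOn ℝ ∞ T T.source) {θ χ : Plane → ℝ} {z : Plane} (hz : z ∈ T.source)
    (hθ : ∀ᶠ x in 𝓝 z, θ x = 1) (hd : ContDiff ℝ ∞ (pushForward T fun z => θ z * χ z)) (v : Plane) :
    fderiv ℝ (pushForward T fun z => θ z * χ z) (T z) (fderiv ℝ T z v) = fderiv ℝ χ z v := by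
  have hTd : HasFDerivAt T (fderiv ℝ T z) z :=
    ((hT.contDiffAt (T.open_source.mem_nhds hz)).differentiableAt (by simp)).hasFDerivAt
  have h1 := (hd.differentiable (by simp)).differentiableAt.hasFDerivAt.comp z hTd
  have h2 : (pushForward T fun z => θ z * χ z) ∘ T =ᶠ[𝓝 z] χ := by
    filter_upwards [hθ, T.open_source.mem_nhds hz] with x hx hxs
    rw [Function.comp_apply, pushForward_apply T _ hxs, hx, one_mul]
  rw [← h2.fderiv_eq, h1.fderiv]
  rfl

lemma lintegral_enorm_sq_le_mul {E G : Type*} [NormedAddCommGroup E] [NormedAddCommGroup G]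
    {f : Plane → E} {g : Plane → G} {C : ℝ} (h : ∀ y, ‖f y‖ ≤ C * ‖g y‖) :
    ∫⁻ y, ‖f y‖ₑ ^ 2 ≤ ENNReal.ofReal C ^ 2 * ∫⁻ y, ‖g y‖ₑ ^ 2 := by
  rw [← lintegral_const_mul' _ _ (by simp)]
  refine lintegral_mono fun y => ?_
  rw [← mul_pow]
  gcongr
  rw [← ofReal_norm, ← ofReal_norm (g y)]
  refine (ENNReal.ofReal_le_ofReal (h y)).trans ?_
  rw [ENNReal.ofReal_mul' (norm_nonneg _)]

/-- With `b` the pushed forward field of `a`, and `f` the pushed forward function `θ * χ k`, the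
pushed forward derivative of `χ k` along `a` is the derivative of `f` along `b`, that is `div (f b)
- f div b`. Thus the `L²` bounds on `χ k` and its gradient are what `planeSobolevSq_average_le`
needs. The cut-off `θ` is there because `χ k` need not be supported in the domain of `T`. -/
theorem exists_planeSobolevSq_pushForward_le {T : OpenPartialHomeomorph Plane Plane}
    (hT : ContDiffOn ℝ ∞ T T.source) (hT' : ContDiffOn ℝ ∞ T.symm T.target)
    {a : Plane → Plane} (ha : ContDiff ℝ ∞ a) {L : Set Plane} (hL : IsCompact L)
    (hLT : L ⊆ T.source) (haL : ∀ z ∉ L, a z = 0) :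
    ∃ C : ℝ≥0∞, C ≠ ⊤ ∧ ∀ (K : Set Plane) (A : ℝ≥0∞) (n : ℕ) (ψ : Plane → ℝ), 0 < n →
      IsDyadicAverage K A n ψ →
      planeSobolevSq (-1 / 2) (pushForward T fun z => fderiv ℝ ψ z (a z)) ≤ C * A / n := by
  obtain ⟨θ, L', hθ, hL', hL'T, hLL', hθ1, hθ0, hθI⟩ := exists_smooth_cutoff hL T.open_source hLT
  have hbsm : ContDiffOn ℝ ∞ (fun z => fderiv ℝ T z (a z)) T.source :=
    (hT.fderiv_of_isOpen T.open_source (by simp)).clm_apply ha.contDiffOn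
  have hb0 : ∀ z ∉ L, fderiv ℝ T z (a z) = 0 := fun z hz => by rw [haL z hz, map_zero]
  set b : Plane → Plane := pushForward T fun z => fderiv ℝ T z (a z) with hbdef
  have hb : ContDiff ℝ ∞ b := contDiff_pushForward hT' hL hLT hb0 hbsm
  have hbc : HasCompactSupport b := hasCompactSupport_pushForward hL hLT hb0
  obtain ⟨Ca, hCa⟩ := (HasCompactSupport.intro hL haL).exists_bound_of_continuous ha.continuous
  obtain ⟨Cb, hCb⟩ := hbc.exists_bound_of_continuous hb.continuous
  have hdiv : Continuous fun y => ∑ j, fderiv ℝ b y (unitVec j) j :=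
    (ContDiff.sum (n := ∞) fun j _ => (contDiff_coord j).comp
      ((hb.fderiv_right (m := ∞) (by simp)).clm_apply contDiff_const)).continuous
  have hdivc : HasCompactSupport fun y => ∑ j, fderiv ℝ b y (unitVec j) j :=
    (hbc.fderiv (𝕜 := ℝ)).mono fun y hy hb0 => hy (by simp [hb0])
  obtain ⟨Cd, hCd⟩ := hdivc.exists_bound_of_continuous hdiv
  obtain ⟨C1, hC1⟩ := exists_lintegral_pushForward_le (F := ℝ) hT hL hLT
  obtain ⟨C2, hC2⟩ := exists_lintegral_pushForward_le (F := ℝ) hT hL' hL'T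
  refine ⟨2404 * (C1 * ENNReal.ofReal Ca ^ 2 + ENNReal.ofReal Cb ^ 2 * C2 +
    ENNReal.ofReal Cd ^ 2 * C2), by finiteness, ?_⟩
  rintro K A n ψ hn ⟨χ, hχ, -, hχ2, hdχ2, rfl⟩
  have hcut0 : ∀ k, ∀ z ∉ L', θ z * χ k z = 0 := fun k z hz => by rw [hθ0 z hz, zero_mul]
  have hf : ∀ k, ContDiff ℝ ∞ (pushForward T fun z => θ z * χ k z) := fun k =>
    contDiff_pushForward hT' hL' hL'T (hcut0 k) (hθ.mul (hχ k)).contDiffOn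
  let w : ℕ → DivergenceForm := fun k => derivDivergenceForm _ b (hf k) hb hbc
  have hcutle : ∀ k, ∫⁻ y, ‖pushForward T (fun z => θ z * χ k z) y‖ₑ ^ 2 ≤ C2 * (A * 4⁻¹ ^ k) := by
    intro k
    refine (hC2 _ (hcut0 k)).trans ?_
    gcongr
    refine le_trans (lintegral_mono fun z => ?_) (hχ2 k)
    dsimp only
    rw [enorm_mul]
    refine pow_le_pow_left' (mul_le_of_le_one_left' ?_) 2
    rw [← ofReal_norm, Real.norm_of_nonneg (hθI z).1]
    exact ENNReal.ofReal_le_one.2 (hθI z).2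
  have hfn : ∀ k y, (w k).fn y =
      ((pushForward T (fun z => fderiv ℝ (χ k) z (a z)) y : ℝ) : ℂ) := by
    intro k y
    change ((fderiv ℝ (pushForward T fun z => θ z * χ k z) y (b y) : ℝ) : ℂ) = _
    congr 1
    by_cases hy : y ∈ T '' L
    · obtain ⟨z, hz, rfl⟩ := hy
      rw [hbdef, pushForward_apply T _ (hLT hz), pushForward_apply T _ (hLT hz)]
      exact fderiv_pushForward_apply hT (hLT hz)
        (mem_nhdsSet_iff_forall.1 hθ1 z hz) (hf k) _
    · rw [hbdef, pushForward_eq_zero hb0 hy, map_zero,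
        pushForward_eq_zero (L := L) (fun z hz => by rw [haL z hz, map_zero]) hy]
  have key := planeSobolevSq_average_le hn w (f := pushForward T fun z => fderiv ℝ
      (fun z => (1 / n) * ∑ k ∈ Finset.range n, χ k z) z (a z))
    (A := (C1 * ENNReal.ofReal Ca ^ 2 + ENNReal.ofReal Cb ^ 2 * C2 +
      ENNReal.ofReal Cd ^ 2 * C2) * A) ?_ ?_ ?_ ?_
  · rwa [← mul_assoc] at key
  · intro k
    simp only [hfn]
    calc _ = ∫⁻ y, ‖pushForward T (fun z => fderiv ℝ (χ k) z (a z)) y‖ₑ ^ 2 :=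
          lintegral_congr fun y => by rw [← ofReal_norm, Complex.norm_real, ofReal_norm]
      _ ≤ C1 * ∫⁻ z, ‖fderiv ℝ (χ k) z (a z)‖ₑ ^ 2 :=
          hC1 _ fun z hz => by rw [haL z hz, map_zero]
      _ ≤ C1 * (ENNReal.ofReal Ca ^ 2 * ∫⁻ z, ‖fderiv ℝ (χ k) z‖ₑ ^ 2) := by
          gcongr
          refine lintegral_enorm_sq_le_mul fun z => ?_
          rw [mul_comm]
          exact (ContinuousLinearMap.le_opNorm _ _).trans (by gcongr; exact hCa z)
      _ ≤ C1 * (ENNReal.ofReal Ca ^ 2 * (A * 4 ^ k)) := by gcongr; exact hdχ2 k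
      _ = C1 * ENNReal.ofReal Ca ^ 2 * A * 4 ^ k := by ring
      _ ≤ _ := by
          gcongr
          rw [add_assoc]
          exact le_self_add
  · intro k j
    calc _ ≤ ENNReal.ofReal Cb ^ 2 * ∫⁻ y, ‖pushForward T (fun z => θ z * χ k z) y‖ₑ ^ 2 := by
          refine lintegral_enorm_sq_le_mul fun y => ?_
          change ‖((pushForward T (fun z => θ z * χ k z) y * b y j : ℝ) : ℂ)‖ ≤ _
          rw [Complex.norm_real, norm_mul, mul_comm]
          gcongr
          exact (PiLp.norm_apply_le (b y) j).trans (hCb y)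
      _ ≤ ENNReal.ofReal Cb ^ 2 * (C2 * (A * 4⁻¹ ^ k)) := by gcongr; exact hcutle k
      _ = ENNReal.ofReal Cb ^ 2 * C2 * A * 4⁻¹ ^ k := by ring
      _ ≤ _ := by
          gcongr
          exact le_add_right le_add_self
  · intro k
    calc _ ≤ ENNReal.ofReal Cd ^ 2 * ∫⁻ y, ‖pushForward T (fun z => θ z * χ k z) y‖ₑ ^ 2 := by
          refine lintegral_enorm_sq_le_mul fun y => ?_
          change ‖((-(pushForward T (fun z => θ z * χ k z) y *
            ∑ j, fderiv ℝ b y (unitVec j) j) : ℝ) : ℂ)‖ ≤ _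
          rw [Complex.norm_real, norm_neg, norm_mul, mul_comm]
          gcongr
          exact hCd y
      _ ≤ ENNReal.ofReal Cd ^ 2 * (C2 * (A * 4⁻¹ ^ k)) := by gcongr; exact hcutle k
      _ = ENNReal.ofReal Cd ^ 2 * C2 * A * 4⁻¹ ^ k := by ring
      _ ≤ _ := by
          gcongr
          exact le_add_self
  · intro y
    simp only [hfn]
    rw [← Complex.ofReal_sum, ← Complex.ofReal_mul]
    congr 1
    unfold pushForward
    split_ifs with hy
    · have hsum : HasFDerivAt (fun z => (1 / n : ℝ) * ∑ k ∈ Finset.range n, χ k z)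
          ((1 / n : ℝ) • ∑ k ∈ Finset.range n, fderiv ℝ (χ k) (T.symm y)) (T.symm y) :=
        (HasFDerivAt.fun_sum fun k _ =>
          ((hχ k).differentiable (by simp)).differentiableAt.hasFDerivAt).const_mul _
      beta_reduce
      rw [hsum.fderiv]
      simp
    · simp

end PushForward

/-! ### Darboux coordinates for area forms in the plane. -/

section PlaneDarboux

open Set Metric MeasureTheory
open scoped Topology

/-- The horizontal segments `t ↦ (t x, y)` as continuous maps. -/
noncomputable def horizontalSegment : Plane →L[ℝ] C(Icc (-1 : ℝ) 1, Plane) :=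
  LinearMap.toContinuousLinearMap
    { toFun := fun z => ⟨fun t => !₂[t.1 * z 0, z 1], by fun_prop⟩
      map_add' := fun z w => by
        ext t i; fin_cases i <;> simp [mul_add]
      map_smul' := fun c z => by
        ext t i; fin_cases i <;> simp [mul_left_comm] }

/-- Every smooth compactly supported function on the plane is a horizontal derivative. -/
lemma exists_fderiv_unitVec_zero_eq {r : Plane → ℝ} (hr : ContDiff ℝ ∞ r)
    (hc : HasCompactSupport r) :
    ∃ R : Plane → ℝ, ContDiff ℝ ∞ R ∧ ∀ z, fderiv ℝ R z (unitVec 0) = r z := by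
  let one : Icc (-1 : ℝ) 1 := ⟨1, by norm_num⟩
  -- The primitive from `0` to `z 0`, rescaled to the fixed interval `[0, 1]`, so that its
  -- smoothness follows from that of composition operators.
  let R : Plane → ℝ := fun z => z 0 * integrateFromZero ℝ
    ⟨fun t => r (horizontalSegment z t), hr.continuous.comp (horizontalSegment z).continuous⟩ one
  have hR : ContDiff ℝ ∞ R := by
    have h1 := (contDiff_comp_continuousMap (Icc (-1 : ℝ) 1) hr (hc.fderiv (𝕜 := ℝ))).comp
      horizontalSegment.contDiff
    exact (contDiff_coord 0).mul ((ContinuousMap.evalCLM ℝ one : C(Icc (-1 : ℝ) 1, ℝ) →L[ℝ] ℝ).contDiff.comp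
      ((integrateFromZero ℝ).contDiff.comp h1))
  have hint : ∀ z, R z = ∫ s in (0 : ℝ)..z 0, r !₂[s, z 1] := by
    intro z
    have h := intervalIntegral.smul_integral_comp_mul_right (a := 0) (b := 1)
      (fun s => r !₂[s, z 1]) (z 0)
    rw [zero_mul, one_mul, smul_eq_mul] at h
    rw [← h]
    simp only [R]
    rw [integrateFromZero_apply]
    congr 1
    refine intervalIntegral.integral_congr fun s hs => ?_
    rw [uIcc_of_le zero_le_one] at hs
    have hs' : s ∈ Icc (-1 : ℝ) 1 := ⟨by linarith [hs.1], hs.2⟩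
    rw [IccExtend_of_mem _ _ hs']
    rfl
  refine ⟨R, hR, fun z => ?_⟩
  have hline : HasDerivAt (fun s : ℝ => R (!₂[s, z 1])) (r !₂[z 0, z 1]) (z 0) := by
    have hcont : Continuous fun s : ℝ => r !₂[s, z 1] := hr.continuous.comp (by fun_prop)
    have h := (hcont.integral_hasStrictDerivAt 0 (z 0)).hasDerivAt
    simpa [hint] using h
  have hz : (!₂[z 0, z 1] : Plane) = z := by ext i; fin_cases i <;> rfl
  have hd : HasDerivAt (fun s : ℝ => (!₂[s, z 1] : Plane)) (unitVec 0) (z 0) := by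
    have h1 : HasDerivAt (fun s : ℝ => s • unitVec 0 + z 1 • unitVec 1) (unitVec 0) (z 0) := by
      simpa using ((hasDerivAt_id (z 0)).smul_const (unitVec 0)).add_const (z 1 • unitVec 1)
    convert! h1 using 1
    funext s
    ext i; fin_cases i <;> simp [unitVec]
  have h2 := HasFDerivAt.comp_hasDerivAt_of_eq (z 0)
    (hR.differentiable (by simp)).differentiableAt.hasFDerivAt hd hz.symm
  rw [hz] at hline
  exact h2.unique hline

lemma exists_equiv_of_areaForm {l : Plane →L[ℝ] Plane} {r : ℝ} (hr : r ≠ 0)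
    (h : ∀ v w, areaForm (l v) (l w) = r * areaForm v w) :
    ∃ l' : Plane ≃L[ℝ] Plane, (l' : Plane →L[ℝ] Plane) = l := by
  have hinj : Function.Injective (l : Plane →ₗ[ℝ] Plane) := by
    intro v w hvw
    refine eq_of_areaForm_eq fun a => mul_left_cancel₀ hr ?_
    rw [← h, ← h]
    exact congrArg (fun x => areaForm x (l a)) hvw
  refine ⟨(LinearEquiv.ofInjectiveEndo _ hinj).toContinuousLinearEquiv, ?_⟩
  ext v : 1
  rfl

/-- The Darboux theorem for area forms on plane domains. -/
lemma exists_darboux_plane {V : Set Plane} (hV : IsOpen V) {p : Plane} (hp : p ∈ V) {ρ : Plane → ℝ}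
    (hρ : ContDiffOn ℝ ∞ ρ V) (hρ0 : ∀ z ∈ V, ρ z ≠ 0) :
    ∃ Φ : OpenPartialHomeomorph Plane Plane, ∃ k : ℝ, k ≠ 0 ∧ Φ.source ⊆ V ∧
      closedBall 0 5 ⊆ Φ.target ∧ ContDiffOn ℝ ∞ Φ Φ.source ∧ ContDiffOn ℝ ∞ Φ.symm Φ.target ∧
      ∀ z ∈ Φ.source, ∀ v w,
        areaForm (fderiv ℝ Φ z v) (fderiv ℝ Φ z w) = k * ρ z * areaForm v w := by
  obtain ⟨θ, L', hθ, hL', hL'V, -, hθ1, hθ0, -⟩ :=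
    exists_smooth_cutoff isCompact_singleton hV (singleton_subset_iff.2 hp)
  rw [nhdsSet_singleton] at hθ1
  -- Extension by zero of `θ * ρ`: nothing is known about `ρ` outside `V`.
  let r : Plane → ℝ := pushForward (OpenPartialHomeomorph.ofSet V hV) fun z => θ z * ρ z
  have hr0 : ∀ z ∉ L', θ z * ρ z = 0 := fun z hz => by rw [hθ0 z hz, zero_mul]
  have hrs : ContDiff ℝ ∞ r := contDiff_pushForward (by simpa using contDiffOn_id) hL'
    (by simpa using hL'V) hr0 (by simpa using hθ.contDiffOn.mul hρ)
  obtain ⟨R, hR, hRd⟩ := exists_fderiv_unitVec_zero_eq hrs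
    (hasCompactSupport_pushForward hL' (by simpa using hL'V) hr0)
  obtain ⟨W, hW1, hW, hpW⟩ := _root_.mem_nhds_iff.1 hθ1
  have hrW : ∀ z ∈ V ∩ W, r z = ρ z := fun z hz => by
    have := pushForward_apply (OpenPartialHomeomorph.ofSet V hV) (fun z => θ z * ρ z)
      (z := z) (by simpa using hz.1)
    have h1 : θ z = 1 := hW1 hz.2
    exact this.trans (by rw [h1, one_mul])
  -- Keeping the second coordinate makes the Jacobian of `G` the horizontal derivative of `R`, which
  -- is `r`.
  let G : Plane → Plane := fun z => !₂[R z, z 1]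
  have hG : ContDiff ℝ ∞ G := by
    rw [contDiff_piLp]
    intro i; fin_cases i
    · exact hR
    · exact contDiff_coord 1
  have hGd : ∀ z v, fderiv ℝ G z v = !₂[fderiv ℝ R z v, v 1] := by
    intro z v
    have h1 := (hG.differentiable (by simp)).differentiableAt (x := z) |>.hasFDerivAt
    ext i
    have h2 := (EuclideanSpace.proj i : Plane →L[ℝ] ℝ).hasFDerivAt.comp z h1
    have h3 : fderiv ℝ G z v i = fderiv ℝ ((EuclideanSpace.proj i : Plane →L[ℝ] ℝ) ∘ G) z v := by
      rw [h2.fderiv]; rfl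
    rw [h3]
    fin_cases i
    · rfl
    · change fderiv ℝ (fun z : Plane => z 1) z v = v 1
      rw [fderiv_coord]; rfl
  have hGarea : ∀ z v w, areaForm (fderiv ℝ G z v) (fderiv ℝ G z w) = r z * areaForm v w := by
    intro z v w
    rw [hGd, hGd, ← hRd z, areaForm_apply, areaForm_apply]
    conv_lhs => rw [plane_eq_sum v, plane_eq_sum w]
    simp [unitVec]
    ring
  have hpVW : p ∈ V ∩ W := ⟨hp, hpW⟩
  obtain ⟨l, hl⟩ := exists_equiv_of_areaForm (hrW p hpVW ▸ hρ0 p hp) (hGarea p)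
  have hGp : HasFDerivAt G (l : Plane →L[ℝ] Plane) p := by
    rw [hl]; exact (hG.differentiable (by simp)).differentiableAt.hasFDerivAt
  let Ψ := (hG.contDiffAt.toOpenPartialHomeomorph G hGp (by simp)).restrOpen (V ∩ W) (hV.inter hW)
  have hΨs : Ψ.source ⊆ V ∩ W := fun z hz => hz.2
  have hΨp : p ∈ Ψ.source := ⟨hG.contDiffAt.mem_toOpenPartialHomeomorph_source hGp (by simp), hpVW⟩
  have hΨcoe : ⇑Ψ = G := rfl
  obtain ⟨ε, hε, hball⟩ := nhds_basis_closedBall.mem_iff.1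
    (Ψ.open_target.mem_nhds (Ψ.map_source hΨp))
  -- Dilation by `5 / ε` makes the image contain the ball of radius `5` in which the plane
  -- construction lives. It multiplies the area form by `(5 / ε) ^ 2`, hence the constant `k`.
  have hc : 5 / ε ≠ 0 := by positivity
  let H : Plane ≃ₜ Plane := (Homeomorph.addRight (-(G p))).trans (Homeomorph.smulOfNeZero _ hc)
  have hHs : ∀ y, H y = (5 / ε) • (y + -(G p)) := fun y => rfl
  have hHsymm : ∀ y, H.symm y = (5 / ε)⁻¹ • y + G p := fun y => by
    rw [Homeomorph.symm_apply_eq, hHs, add_neg_cancel_right, smul_inv_smul₀ hc]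
  let Φ := Ψ.transHomeomorph H
  have hΦcoe : ∀ z, Φ z = (5 / ε) • (G z + -(G p)) := fun z => rfl
  have hΦcoe' : ⇑Φ = fun z => (5 / ε) • (G z + -(G p)) := rfl
  have hΦd : ∀ z, HasFDerivAt Φ ((5 / ε) • fderiv ℝ G z) z := fun z => by
    rw [hΦcoe']
    exact (((hG.differentiable (by simp)).differentiableAt.hasFDerivAt).add_const _).fun_const_smul _
  have hΦ : ContDiff ℝ ∞ Φ := by
    rw [hΦcoe']
    exact contDiff_const.fun_smul (hG.add contDiff_const)
  have harea : ∀ z ∈ Φ.source, ∀ v w,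
      areaForm (fderiv ℝ Φ z v) (fderiv ℝ Φ z w) = (5 / ε) ^ 2 * ρ z * areaForm v w := by
    intro z hz v w
    rw [(hΦd z).fderiv, mul_assoc, ← hrW z (hΨs hz), ← hGarea]
    simp only [smul_apply, map_smul, smul_eq_mul]
    ring
  refine ⟨Φ, (5 / ε) ^ 2, by positivity, hΨs.trans inter_subset_left, ?_, hΦ.contDiffOn, ?_, harea⟩
  · intro y hy
    change H.symm y ∈ Ψ.target
    refine hball ?_
    rw [mem_closedBall, hHsymm, hΨcoe, dist_eq_norm, add_sub_cancel_right, norm_smul, norm_inv,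
      Real.norm_of_nonneg (by positivity)]
    rw [mem_closedBall_zero_iff] at hy
    rw [inv_mul_le_iff₀ (by positivity), div_mul_cancel₀ _ hε.ne']
    exact hy
  · intro y hy
    have hs := Φ.map_target hy
    obtain ⟨l, hl⟩ := exists_equiv_of_areaForm
      (mul_ne_zero (pow_ne_zero 2 hc) (hρ0 _ (hΨs hs).1)) (harea _ hs)
    refine (Φ.contDiffAt_symm hy (f₀' := l) ?_ hΦ.contDiffAt).contDiffWithinAt
    rw [hl]
    exact (hΦ.differentiable (by simp)).differentiableAt.hasFDerivAt

end PlaneDarboux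

/-! ### Darboux charts on the surface. -/

section ManifoldDarboux

open Set Metric VectorField
open scoped Topology

variable {M : Type*} [TopologicalSpace M] [ChartedSpace Plane M] [IsManifold (𝓡 2) ∞ M]

/-- `e` is a diffeomorphism of an open subset of `M` onto an open subset of the plane. -/
structure IsSmoothChart (e : OpenPartialHomeomorph M Plane) : Prop where
  contMDiffOn : ContMDiffOn (𝓡 2) (𝓡 2) ∞ e e.source
  contMDiffOn_symm : ContMDiffOn (𝓡 2) (𝓡 2) ∞ e.symm e.target

omit [IsManifold (𝓡 2) ∞ M] in
lemma isSmoothChart_of_mem_maximalAtlas {e : OpenPartialHomeomorph M Plane}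
    (he : e ∈ IsManifold.maximalAtlas (𝓡 2) ∞ M) : IsSmoothChart e :=
  ⟨contMDiffOn_of_mem_maximalAtlas he, contMDiffOn_symm_of_mem_maximalAtlas he⟩

namespace IsSmoothChart

variable {e : OpenPartialHomeomorph M Plane}

omit [IsManifold (𝓡 2) ∞ M]

lemma mdifferentiable (he : IsSmoothChart e) : e.MDifferentiable (𝓡 2) (𝓡 2) :=
  ⟨he.contMDiffOn.mdifferentiableOn (by simp), he.contMDiffOn_symm.mdifferentiableOn (by simp)⟩

lemma trans (he : IsSmoothChart e) {Φ : OpenPartialHomeomorph Plane Plane}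
    (hΦ : ContDiffOn ℝ ∞ Φ Φ.source) (hΦ' : ContDiffOn ℝ ∞ Φ.symm Φ.target) :
    IsSmoothChart (e.trans Φ) := by
  constructor
  · rw [e.trans_source]
    exact hΦ.contMDiffOn.comp (he.contMDiffOn.mono inter_subset_left) fun x hx => hx.2
  · rw [e.trans_target]
    exact he.contMDiffOn_symm.comp (hΦ'.contMDiffOn.mono inter_subset_left) fun x hx => hx.2

lemma isInvertible_mfderiv (he : IsSmoothChart e) {x : M} (hx : x ∈ e.source) :
    (mfderiv (𝓡 2) (𝓡 2) e x).IsInvertible :=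
  ⟨he.mdifferentiable.mfderiv hx, rfl⟩

end IsSmoothChart

section ChartLift

omit [IsManifold (𝓡 2) ∞ M]

/-- The derivative of the inverse of a chart, as a map from the plane to a tangent space. -/
noncomputable def chartLift (e : OpenPartialHomeomorph M Plane) (z : Plane) :
    Plane →L[ℝ] TangentSpace (𝓡 2) (e.symm z) :=
  mfderiv (𝓡 2) (𝓡 2) e.symm z

lemma IsSmoothChart.mpullback_symm {e : OpenPartialHomeomorph M Plane} (he : IsSmoothChart e)
    {z : Plane} (hz : z ∈ e.target) (X : Plane → Plane) :
    mpullback (𝓡 2) (𝓡 2) e X (e.symm z) = chartLift e z (X z) := by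
  have hx := e.map_target hz
  have h : mfderiv (𝓡 2) (𝓡 2) e (e.symm z) = (he.mdifferentiable.mfderiv hx : _ →L[ℝ] _) := rfl
  have h1 : (mfderiv (𝓡 2) (𝓡 2) e (e.symm z)).inverse =
      mfderiv (𝓡 2) (𝓡 2) e.symm (e (e.symm z)) := by
    rw [h, ContinuousLinearMap.inverse_equiv]
    rfl
  have h2 : ∀ y, y = z → (mfderiv (𝓡 2) (𝓡 2) e.symm y (X y) : Plane) = chartLift e z (X z) := by
    rintro y rfl
    rfl
  exact (congrArg (fun l => l (X (e (e.symm z)))) h1).trans (h2 _ (e.right_inv hz))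

lemma IsSmoothChart.chartLift_injective {e : OpenPartialHomeomorph M Plane} (he : IsSmoothChart e)
    {z : Plane} (hz : z ∈ e.target) : Function.Injective (chartLift e z) :=
  he.mdifferentiable.symm.mfderiv_injective hz

lemma chartLift_trans {c : OpenPartialHomeomorph M Plane} (hc : IsSmoothChart c)
    {Φ : OpenPartialHomeomorph Plane Plane} (hΦ' : ContDiffOn ℝ ∞ Φ.symm Φ.target) {y : Plane}
    (hy : y ∈ Φ.target) (hy' : Φ.symm y ∈ c.target) (v : Plane) :
    chartLift (c.trans Φ) y v = chartLift c (Φ.symm y) (fderiv ℝ Φ.symm y v) := by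
  have h1 : MDifferentiableAt (𝓡 2) (𝓡 2) Φ.symm y :=
    ((hΦ'.contDiffAt (Φ.open_target.mem_nhds hy)).differentiableAt (by simp)).mdifferentiableAt
  have h2 := mfderiv_comp y (hc.mdifferentiable.mdifferentiableAt_symm hy') h1
  have h3 : mfderiv (𝓡 2) (𝓡 2) Φ.symm y = fderiv ℝ Φ.symm y := mfderiv_eq_fderiv
  have h4 := congrArg (fun l => l v) h2
  refine h4.trans ?_
  change mfderiv (𝓡 2) (𝓡 2) c.symm (Φ.symm y) (mfderiv (𝓡 2) (𝓡 2) Φ.symm y v) = _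
  rw [h3]
  rfl

end ChartLift


lemma IsSmoothChart.contMDiffOn_mpullback {e : OpenPartialHomeomorph M Plane}
    (he : IsSmoothChart e) {X : Plane → Plane} (hX : ContDiffOn ℝ ∞ X e.target) :
    ContMDiffOn (𝓡 2) (𝓡 2).tangent ∞ (fun x => TotalSpace.mk' Plane
      (E := fun x : M => TangentSpace (𝓡 2) x) x (mpullback (𝓡 2) (𝓡 2) e X x)) e.source := by
  intro x hx
  have h1 := contMDiffAt_vectorSpace_iff_contDiffAt.2
    (hX.contDiffAt (e.open_target.mem_nhds (e.map_source hx)))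
  exact (h1.mpullback_vectorField_preimage (he.contMDiffOn.contMDiffAt (e.open_source.mem_nhds hx))
    (he.isInvertible_mfderiv hx) (by simp)).contMDiffWithinAt

/-- The equality case of Cauchy–Schwarz: a vanishing Gram determinant makes `g(v,v) w - g(v,w) v` a
vector of norm zero, so `v` and `w` are dependent. -/
lemma IsRiemannianVolumeForm.ne_zero {g : SurfaceMetric M}
    {μ : ∀ x : M, TangentSpace (𝓡 2) x →L[ℝ] TangentSpace (𝓡 2) x →L[ℝ] ℝ}
    (hμ : IsRiemannianVolumeForm g μ) {x : M} {v w : TangentSpace (𝓡 2) x} (hv : v ≠ 0)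
    (hvw : ∀ a b : ℝ, a • v = b • w → b = 0) : μ x v w ≠ 0 := by
  intro h0
  have h := hμ.sq_eq_gram x v w
  rw [h0] at h
  have hvv : 0 < g.inner x v v := g.pos x v hv
  have hu : g.inner x (g.inner x v v • w - g.inner x v w • v)
      (g.inner x v v • w - g.inner x v w • v) = 0 := by
    simp only [map_sub, map_smul, sub_apply, smul_apply, smul_eq_mul]
    rw [g.symm x w v]
    linear_combination (-g.inner x v v) * h
  have hu0 : g.inner x v v • w - g.inner x v w • v = 0 := by
    by_contra hne
    exact (g.pos x _ hne).ne' hu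
  exact hvv.ne' (hvw _ _ (sub_eq_zero.1 hu0).symm)

/-- Alternating forms on the plane are multiples of the area form. -/
lemma alternating_eq_smul_areaForm {E : Type*} [AddCommGroup E] [Module ℝ E] [TopologicalSpace E]
    {β : E →L[ℝ] E →L[ℝ] ℝ} (hβ : ∀ v, β v v = 0) (l : Plane →L[ℝ] E) (v w : Plane) :
    β (l v) (l w) = β (l (unitVec 0)) (l (unitVec 1)) * areaForm v w := by
  have hanti : β (l (unitVec 1)) (l (unitVec 0)) = -β (l (unitVec 0)) (l (unitVec 1)) := by
    have := hβ (l (unitVec 0) + l (unitVec 1))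
    simp only [map_add, add_apply, hβ] at this
    linarith
  conv_lhs => rw [plane_eq_sum v, plane_eq_sum w]
  simp only [map_add, map_smul, add_apply, smul_apply, smul_eq_mul, hβ, hanti, areaForm_apply]
  ring

/-- The Darboux theorem for volume forms on surfaces. -/
theorem IsRiemannianVolumeForm.exists_darboux_chart [Nonempty M] {g : SurfaceMetric M}
    {μ : ∀ x : M, TangentSpace (𝓡 2) x →L[ℝ] TangentSpace (𝓡 2) x →L[ℝ] ℝ}
    (hμ : IsRiemannianVolumeForm g μ) :
    ∃ e : OpenPartialHomeomorph M Plane, IsSmoothChart e ∧ closedBall 0 5 ⊆ e.target ∧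
      ∃ k : ℝ, ∀ y ∈ e.target, ∀ v w : Plane,
        μ (e.symm y) (chartLift e y v) (chartLift e y w) = k * areaForm v w := by
  obtain ⟨x₀⟩ := ‹Nonempty M›
  let c := chartAt Plane x₀
  have hc : IsSmoothChart c := isSmoothChart_of_mem_maximalAtlas (IsManifold.chart_mem_maximalAtlas x₀)
  -- The coefficient of `μ` in the chart `c`.
  let ρ : Plane → ℝ := fun z =>
    μ (c.symm z) (chartLift c z (unitVec 0)) (chartLift c z (unitVec 1))
  have hρ : ContDiffOn ℝ ∞ ρ c.target := by
    have h1 : ContMDiffOn (𝓡 2) 𝓘(ℝ, ℝ) ∞ (fun x => μ x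
        (mpullback (𝓡 2) (𝓡 2) c (fun _ => unitVec 0) x)
        (mpullback (𝓡 2) (𝓡 2) c (fun _ => unitVec 1) x)) c.source := by
      have h2 := (hμ.contMDiff.contMDiffOn (s := c.source)).clm_bundle_apply₂
        (F₃ := ℝ) (E₃ := Bundle.Trivial M ℝ)
        (hc.contMDiffOn_mpullback (X := fun _ => unitVec 0) contDiffOn_const)
        (hc.contMDiffOn_mpullback (X := fun _ => unitVec 1) contDiffOn_const)
      intro x hx
      exact ((Bundle.contMDiffWithinAt_totalSpace.1 (h2 x hx)).2)
    refine (h1.comp hc.contMDiffOn_symm c.mapsTo_symm).contDiffOn.congr fun z hz => ?_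
    change ρ z = μ (c.symm z) (mpullback (𝓡 2) (𝓡 2) c (fun _ => unitVec 0) (c.symm z))
      (mpullback (𝓡 2) (𝓡 2) c (fun _ => unitVec 1) (c.symm z))
    exact (congrArg₂ (fun v w => μ (c.symm z) v w)
      (hc.mpullback_symm hz fun _ => unitVec 0) (hc.mpullback_symm hz fun _ => unitVec 1)).symm
  have hρ0 : ∀ z ∈ c.target, ρ z ≠ 0 := by
    intro z hz
    have hinj := hc.chartLift_injective hz
    refine hμ.ne_zero ?_ ?_
    · intro h
      rw [← map_zero (chartLift c z), hinj.eq_iff] at h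
      simpa [unitVec] using congrArg (fun v : Plane => v 0) h
    · intro a b hab
      rw [← map_smul, ← map_smul, hinj.eq_iff] at hab
      simpa [unitVec] using (congrArg (fun v : Plane => v 1) hab).symm
  obtain ⟨Φ, k, hk, hΦc, hball, hΦ, hΦ', harea⟩ :=
    exists_darboux_plane c.open_target (c.map_source (mem_chart_source Plane x₀)) hρ hρ0
  -- In the chart `c` the form is `ρ` times the area form, and `Φ` multiplies area by `k * ρ`; the
  -- quotient is `k⁻¹`.
  refine ⟨c.trans Φ, hc.trans hΦ hΦ', ?_, k⁻¹, ?_⟩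
  · intro y hy
    rw [c.trans_target]
    exact ⟨hball hy, hΦc (Φ.map_target (hball hy))⟩
  · intro y hy v w
    rw [c.trans_target] at hy
    have hz := Φ.map_target hy.1
    have hid : ∀ v, fderiv ℝ Φ (Φ.symm y) (fderiv ℝ Φ.symm y v) = v := by
      intro v
      have h1 := ((hΦ.contDiffAt (Φ.open_source.mem_nhds hz)).differentiableAt
        (by simp)).hasFDerivAt.comp y ((hΦ'.contDiffAt (Φ.open_target.mem_nhds
          hy.1)).differentiableAt (by simp)).hasFDerivAt
      have h2 : (Φ ∘ Φ.symm) =ᶠ[𝓝 y] id := by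
        filter_upwards [Φ.open_target.mem_nhds hy.1] with z hz using Φ.right_inv hz
      have h3 := h2.fderiv_eq (𝕜 := ℝ)
      rw [h1.fderiv, fderiv_id] at h3
      exact congrArg (fun l : Plane →L[ℝ] Plane => l v) h3
    have h := harea _ hz (fderiv ℝ Φ.symm y v) (fderiv ℝ Φ.symm y w)
    rw [hid, hid] at h
    have h' := alternating_eq_smul_areaForm (hμ.alternating (c.symm (Φ.symm y)))
      (chartLift c (Φ.symm y)) (fderiv ℝ Φ.symm y v) (fderiv ℝ Φ.symm y w)
    refine (congrArg₂ (fun v w => μ (c.symm (Φ.symm y)) v w) (chartLift_trans hc hΦ' hy.1 hy.2 v)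
      (chartLift_trans hc hΦ' hy.1 hy.2 w)).trans (h'.trans ?_)
    change ρ (Φ.symm y) * _ = _
    rw [h]
    field_simp

end ManifoldDarboux

/-! ### Transport of vector fields from the plane to the surface. -/

section LiftField

open Set Metric VectorField
open scoped Topology

variable {M : Type*} [TopologicalSpace M]

lemma isCompact_symm_image {e : OpenPartialHomeomorph M Plane} {K : Set Plane} (hK : IsCompact K)
    (hKe : K ⊆ e.target) : IsCompact (e.symm '' K) :=
  hK.image_of_continuousOn (e.continuousOn_symm.mono hKe)

variable [ChartedSpace Plane M]

open Classical in
/-- The vector field on `M` which is `X` in the chart `e`, extended by zero. -/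
noncomputable def liftField (e : OpenPartialHomeomorph M Plane) (X : Plane → Plane) (x : M) :
    TangentSpace (𝓡 2) x :=
  if x ∈ e.source then mpullback (𝓡 2) (𝓡 2) e X x else 0

lemma liftField_eq_zero {e : OpenPartialHomeomorph M Plane} {X : Plane → Plane} {K : Set Plane}
    (hX : ∀ z ∉ K, X z = 0) {x : M} (hx : x ∉ e.symm '' K) : liftField e X x = 0 := by
  unfold liftField
  split_ifs with h
  · have h0 : X (e x) = 0 := hX _ fun hK => hx ⟨_, hK, e.left_inv h⟩
    change (mfderiv (𝓡 2) (𝓡 2) e x).inverse (X (e x)) = 0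
    exact (congrArg _ h0).trans (map_zero _)
  · rfl

lemma IsSmoothChart.liftField_symm {e : OpenPartialHomeomorph M Plane} (he : IsSmoothChart e)
    {z : Plane} (hz : z ∈ e.target) (X : Plane → Plane) :
    liftField e X (e.symm z) = chartLift e z (X z) := by
  rw [liftField, if_pos (e.map_target hz)]
  exact he.mpullback_symm hz X

variable [IsManifold (𝓡 2) ∞ M] [T2Space M]

/-- The surface is Hausdorff, so the compact image of `K` is closed and the extension by zero is
smooth across the boundary of the chart domain. -/
lemma IsSmoothChart.contMDiff_liftField {e : OpenPartialHomeomorph M Plane} (he : IsSmoothChart e)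
    {K : Set Plane} (hK : IsCompact K) (hKe : K ⊆ e.target) {X : Plane → Plane}
    (hX : ContDiff ℝ ∞ X) (hX0 : ∀ z ∉ K, X z = 0) :
    ContMDiff (𝓡 2) (𝓡 2).tangent ∞ (fun x => TotalSpace.mk' Plane
      (E := fun x : M => TangentSpace (𝓡 2) x) x (liftField e X x)) := by
  intro x
  by_cases hx : x ∈ e.source
  · refine ((he.contMDiffOn_mpullback hX.contDiffOn).contMDiffAt
      (e.open_source.mem_nhds hx)).congr_of_eventuallyEq ?_
    filter_upwards [e.open_source.mem_nhds hx] with y hy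
    rw [liftField, if_pos hy]
  · have hx' : x ∉ e.symm '' K := by
      rintro ⟨z, hz, rfl⟩
      exact hx (e.map_target (hKe hz))
    refine ((contMDiff_zeroSection ℝ fun x : M => TangentSpace (𝓡 2) x) x).congr_of_eventuallyEq ?_
    filter_upwards [(isCompact_symm_image hK hKe).isClosed.isOpen_compl.mem_nhds hx'] with y hy
    rw [liftField_eq_zero hX0 hy]
    rfl

/-- The compactly supported vector field on `M` which is `X` in the chart `e`. -/
noncomputable def IsSmoothChart.liftVectorField {e : OpenPartialHomeomorph M Plane}
    (he : IsSmoothChart e) {K : Set Plane} (hK : IsCompact K) (hKe : K ⊆ e.target) {X : Plane → Plane}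
    (hX : ContDiff ℝ ∞ X) (hX0 : ∀ z ∉ K, X z = 0) : CompactVectorField M :=
  ⟨⟨liftField e X, he.contMDiff_liftField hK hKe hX hX0⟩, e.symm '' K, isCompact_symm_image hK hKe,
    fun _ hx => liftField_eq_zero hX0 hx⟩

end LiftField

/-! ### Transport of area preserving maps from the plane to the surface. -/

section LiftMap

open Set Metric
open scoped Topology

variable {M : Type*} [TopologicalSpace M]

open Classical in
/-- The map of `M` which is `h` in the chart `e` and the identity elsewhere. -/
noncomputable def liftMap (e : OpenPartialHomeomorph M Plane) (h : Plane → Plane) (x : M) : M :=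
  if x ∈ e.source then e.symm (h (e x)) else x

lemma liftMap_eq_self {e : OpenPartialHomeomorph M Plane} {h : Plane → Plane} {K : Set Plane}
    (hh : ∀ z ∉ K, h z = z) {x : M} (hx : x ∉ e.symm '' K) : liftMap e h x = x := by
  unfold liftMap
  split_ifs with hs
  · rw [hh _ fun hK => hx ⟨_, hK, e.left_inv hs⟩, e.left_inv hs]
  · rfl

lemma liftMap_symm {e : OpenPartialHomeomorph M Plane} (h : Plane → Plane) {z : Plane}
    (hz : z ∈ e.target) : liftMap e h (e.symm z) = e.symm (h z) := by
  rw [liftMap, if_pos (e.map_target hz), e.right_inv hz]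

lemma liftMap_id (e : OpenPartialHomeomorph M Plane) (x : M) : liftMap e id x = x := by
  unfold liftMap
  split_ifs with hs
  · exact e.left_inv hs
  · rfl

/-- An injective map fixing every point outside `K` cannot send a point of `K` out of `K`. -/
lemma mapsTo_of_eqOn_compl {h : Equiv.Perm Plane} {K S : Set Plane} (hh : ∀ z ∉ K, h z = z)
    (hKS : K ⊆ S) {z : Plane} (hz : z ∈ S) : h z ∈ S := by
  by_cases hzK : z ∈ K
  · refine hKS ?_
    by_contra hc
    exact hc ((h.injective (hh _ hc)).symm ▸ hzK)
  · rwa [hh z hzK]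

lemma liftMap_liftMap {e : OpenPartialHomeomorph M Plane} {g h : Plane → Plane}
    (hh : ∀ z ∈ e.target, h z ∈ e.target) (x : M) :
    liftMap e g (liftMap e h x) = liftMap e (g ∘ h) x := by
  by_cases hx : x ∈ e.source
  · have h1 : liftMap e h x = e.symm (h (e x)) := if_pos hx
    rw [h1, liftMap_symm g (hh _ (e.map_source hx)), liftMap, if_pos hx]
    rfl
  · have h1 : ∀ f, liftMap e f x = x := fun f => if_neg hx
    rw [h1, h1, h1]

variable [ChartedSpace Plane M]

lemma IsSmoothChart.hasMFDerivAt_liftMap {e : OpenPartialHomeomorph M Plane}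
    (he : IsSmoothChart e) {K : Set Plane} (hKe : K ⊆ e.target) {Φ : ℝ → Equiv.Perm Plane}
    (hΦK : ∀ t, Φ t ∈ areaDiffeoGroup K) {X : Plane → Plane} {t : ℝ}
    (hd : ∀ z, HasDerivAt (fun s => Φ s z) (X (Φ t z)) t) (x : M) :
    HasMFDerivAt 𝓘(ℝ, ℝ) (𝓡 2) (fun r : ℝ => liftMap e (Φ r) x) t
      (ContinuousLinearMap.toSpanSingleton ℝ
        (liftField e X (liftMap e (Φ t) x) : TangentSpace (𝓡 2) (liftMap e (Φ t) x))) := by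
  by_cases hx : x ∈ e.source
  · obtain ⟨z, hz, rfl⟩ : ∃ z ∈ e.target, e.symm z = x := ⟨e x, e.map_source hx, e.left_inv hx⟩
    have hzt : Φ t z ∈ e.target := mapsTo_of_eqOn_compl (hΦK t).2.2.1 hKe hz
    have h1 : HasMFDerivAt 𝓘(ℝ, ℝ) (𝓡 2) (fun s => Φ s z) t
        (ContinuousLinearMap.toSpanSingleton ℝ (X (Φ t z))) :=
      (hd z).hasFDerivAt.hasMFDerivAt
    have h2 := (he.mdifferentiable.mdifferentiableAt_symm hzt).hasMFDerivAt.comp t h1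
    have h3 : (fun r : ℝ => liftMap e (Φ r) (e.symm z)) = e.symm ∘ fun s => Φ s z :=
      funext fun r => liftMap_symm _ hz
    rw [h3]
    refine h2.congr_mfderiv ?_
    -- The two base points are equal but not by definition, so the identity of tangent vectors is
    -- stated for a variable base point.
    have h4 : ∀ y, y = e.symm (Φ t z) →
        (liftField e X y : Plane) = chartLift e (Φ t z) (X (Φ t z)) := by
      rintro y rfl
      exact he.liftField_symm hzt X
    refine ContinuousLinearMap.ext fun (c : ℝ) => ?_
    change (mfderiv (𝓡 2) (𝓡 2) e.symm (Φ t z) (c • X (Φ t z)) : Plane) =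
      c • (liftField e X (liftMap e (Φ t) (e.symm z)) : Plane)
    rw [h4 _ (liftMap_symm _ hz)]
    exact map_smul (chartLift e (Φ t z)) c _
  · have h1 : ∀ r, liftMap e (Φ r) x = x := fun r => if_neg hx
    have h2 : (fun r : ℝ => liftMap e (Φ r) x) = fun _ => x := funext h1
    have h3 : ∀ y, y = x → (liftField e X y : Plane) = 0 := by
      rintro y rfl
      exact if_neg hx
    rw [h2]
    refine (hasMFDerivAt_const x t).congr_mfderiv ?_
    refine ContinuousLinearMap.ext fun (c : ℝ) => ?_
    change (0 : Plane) = c • (liftField e X (liftMap e (Φ t) x) : Plane)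
    exact ((congrArg (fun v : Plane => c • v) (h3 _ (h1 t))).trans (smul_zero c)).symm

variable [T2Space M]

lemma IsSmoothChart.contMDiff_liftMap {e : OpenPartialHomeomorph M Plane} (he : IsSmoothChart e)
    {K : Set Plane} (hK : IsCompact K) (hKe : K ⊆ e.target) {Φ : ℝ → Equiv.Perm Plane}
    (hΦ : ContDiff ℝ ∞ fun p : ℝ × Plane => Φ p.1 p.2) (hΦK : ∀ t, ∀ z ∉ K, Φ t z = z) :
    ContMDiff (𝓘(ℝ, ℝ).prod (𝓡 2)) (𝓡 2) ∞ (fun p : ℝ × M => liftMap e (Φ p.1) p.2) := by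
  rintro ⟨t, x⟩
  by_cases hx : x ∈ e.source
  · have h1 : ContMDiffAt (𝓘(ℝ, ℝ).prod (𝓡 2)) (𝓘(ℝ, ℝ).prod (𝓡 2)) ∞
        (fun p : ℝ × M => (p.1, e p.2)) (t, x) :=
      contMDiffAt_fst.prodMk ((he.contMDiffOn.contMDiffAt (e.open_source.mem_nhds hx)).comp (t, x)
        contMDiffAt_snd)
    have h2 : ContMDiff (𝓘(ℝ, ℝ).prod (𝓡 2)) (𝓡 2) ∞ (fun p : ℝ × Plane => Φ p.1 p.2) := by
      rw [← modelWithCornersSelf_prod, chartedSpaceSelf_prod]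
      exact hΦ.contMDiff
    have h3 : ContMDiffAt (𝓡 2) (𝓡 2) ∞ e.symm (Φ t (e x)) :=
      he.contMDiffOn_symm.contMDiffAt (e.open_target.mem_nhds
        (mapsTo_of_eqOn_compl (hΦK t) hKe (e.map_source hx)))
    have h4 : ContMDiffAt (𝓘(ℝ, ℝ).prod (𝓡 2)) (𝓡 2) ∞
        (fun p : ℝ × M => e.symm (Φ p.1 (e p.2))) (t, x) :=
      ContMDiffAt.comp (t, x) h3 ((h2 (t, e x)).comp (t, x) h1)
    refine h4.congr_of_eventuallyEq ?_
    filter_upwards [(e.open_source.preimage continuous_snd).mem_nhds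
      (show (t, x) ∈ Prod.snd ⁻¹' e.source from hx)] with p hp
    exact if_pos hp
  · have hx' : x ∉ e.symm '' K := by
      rintro ⟨z, hz, rfl⟩
      exact hx (e.map_target (hKe hz))
    refine contMDiffAt_snd.congr_of_eventuallyEq ?_
    filter_upwards [((isCompact_symm_image hK hKe).isClosed.isOpen_compl.preimage
      continuous_snd).mem_nhds (show (t, x) ∈ Prod.snd ⁻¹' (e.symm '' K)ᶜ from hx')] with p hp
    exact liftMap_eq_self (hΦK p.1) hp

lemma IsSmoothChart.contMDiff_liftMap_const {e : OpenPartialHomeomorph M Plane}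
    (he : IsSmoothChart e) {K : Set Plane} (hK : IsCompact K) (hKe : K ⊆ e.target)
    {h : Equiv.Perm Plane} (hh : h ∈ areaDiffeoGroup K) :
    ContMDiff (𝓡 2) (𝓡 2) ∞ (liftMap e h) := by
  have h1 := he.contMDiff_liftMap hK hKe (Φ := fun _ => h) (hh.1.comp contDiff_snd)
    fun _ => hh.2.2.1
  have h2 : ContMDiff (𝓡 2) (𝓘(ℝ, ℝ).prod (𝓡 2)) ∞ (fun x : M => ((0 : ℝ), x)) :=
    contMDiff_const.prodMk contMDiff_id
  exact h1.comp h2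

/-- The diffeomorphism of `M` which is `h` in the chart `e` and the identity elsewhere. -/
noncomputable def IsSmoothChart.liftDiffeo {e : OpenPartialHomeomorph M Plane}
    (he : IsSmoothChart e) {K : Set Plane} (hK : IsCompact K) (hKe : K ⊆ e.target)
    {h : Equiv.Perm Plane} (hh : h ∈ areaDiffeoGroup K) : Diffeomorph (𝓡 2) (𝓡 2) M M ∞ where
  toFun := liftMap e h
  invFun := liftMap e h.symm
  left_inv x := by
    rw [liftMap_liftMap fun z hz => mapsTo_of_eqOn_compl hh.2.2.1 hKe hz,
      Equiv.symm_comp_self, liftMap_id]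
  right_inv x := by
    rw [liftMap_liftMap fun z hz => mapsTo_of_eqOn_compl (h := h.symm)
      ((areaDiffeoGroup K).inv_mem hh).2.2.1 hKe hz, Equiv.self_comp_symm, liftMap_id]
  contMDiff_toFun := he.contMDiff_liftMap_const hK hKe hh
  contMDiff_invFun := he.contMDiff_liftMap_const hK hKe ((areaDiffeoGroup K).inv_mem hh)

lemma isSmoothDiffPath_liftDiffeo {e : OpenPartialHomeomorph M Plane} (he : IsSmoothChart e)
    {K : Set Plane} (hK : IsCompact K) (hKe : K ⊆ e.target) {Φ : ℝ → Equiv.Perm Plane}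
    (hΦ : ContDiff ℝ ∞ fun p : ℝ × Plane => Φ p.1 p.2) (hΦK : ∀ t, Φ t ∈ areaDiffeoGroup K) :
    IsSmoothDiffPath fun t => he.liftDiffeo hK hKe (hΦK t) :=
  ⟨(he.contMDiff_liftMap hK hKe hΦ fun t => (hΦK t).2.2.1).contMDiffOn, e.symm '' K,
    isCompact_symm_image hK hKe, fun t _ _ hx => liftMap_eq_self (hΦK t).2.2.1 hx⟩

lemma IsSmoothChart.liftDiffeo_one {e : OpenPartialHomeomorph M Plane} (he : IsSmoothChart e)
    {K : Set Plane} (hK : IsCompact K) (hKe : K ⊆ e.target) {h : Equiv.Perm Plane}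
    (hh : h ∈ areaDiffeoGroup K) (h1 : h = 1) :
    he.liftDiffeo hK hKe hh = Diffeomorph.refl (𝓡 2) M ∞ := by
  subst h1
  ext x
  exact liftMap_id e x

lemma IsSmoothChart.liftDiffeo_mem_compactDiff {e : OpenPartialHomeomorph M Plane}
    (he : IsSmoothChart e) {K : Set Plane} (hK : IsCompact K) (hKe : K ⊆ e.target)
    {Φ : ℝ → Equiv.Perm Plane} (hΦ : ContDiff ℝ ∞ fun p : ℝ × Plane => Φ p.1 p.2)
    (hΦK : ∀ t, Φ t ∈ areaDiffeoGroup K) (hΦ0 : Φ 0 = 1) (t : ℝ) :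
    he.liftDiffeo hK hKe (hΦK t) ∈ compactDiff M := by
  have hsmooth : ContDiff ℝ ∞ fun p : ℝ × Plane => Φ (p.1 * t) p.2 :=
    hΦ.comp ((contDiff_fst.mul contDiff_const).prodMk contDiff_snd)
  refine ⟨_, isSmoothDiffPath_liftDiffeo he hK hKe (Φ := fun s => Φ (s * t)) hsmooth
    fun s => hΦK _, ?_, ?_⟩
  · exact he.liftDiffeo_one hK hKe _ (by rw [zero_mul, hΦ0])
  · ext x
    change liftMap e (Φ (1 * t)) x = liftMap e (Φ t) x
    rw [one_mul]

lemma IsSmoothChart.mfderiv_liftMap {e : OpenPartialHomeomorph M Plane} (he : IsSmoothChart e)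
    {K : Set Plane} (hK : IsCompact K) (hKe : K ⊆ e.target) {h : Equiv.Perm Plane}
    (hh : h ∈ areaDiffeoGroup K) {z : Plane} (hz : z ∈ e.target) (v : Plane) :
    (mfderiv (𝓡 2) (𝓡 2) (liftMap e h) (e.symm z) (chartLift e z v) : Plane) =
      chartLift e (h z) (fderiv ℝ h z v) := by
  have hd : MDifferentiableAt (𝓡 2) (𝓡 2) (liftMap e h) (e.symm z) :=
    (he.contMDiff_liftMap_const hK hKe hh).mdifferentiable (by simp) _
  have hh' : MDifferentiableAt (𝓡 2) (𝓡 2) h z :=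
    (hh.1.differentiable (by simp) z).mdifferentiableAt
  have h1 := mfderiv_comp z hd (he.mdifferentiable.mdifferentiableAt_symm hz)
  have h2 := mfderiv_comp z (he.mdifferentiable.mdifferentiableAt_symm
    (mapsTo_of_eqOn_compl hh.2.2.1 hKe hz)) hh'
  have h3 : liftMap e h ∘ e.symm =ᶠ[𝓝 z] e.symm ∘ h := by
    filter_upwards [e.open_target.mem_nhds hz] with y hy using liftMap_symm h hy
  have h4 : (mfderiv (𝓡 2) (𝓡 2) (liftMap e h ∘ e.symm) z v : Plane) =
      mfderiv (𝓡 2) (𝓡 2) (e.symm ∘ h) z v :=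
    congrArg (fun l : Plane →L[ℝ] Plane => l v) h3.mfderiv_eq
  have h5 : mfderiv (𝓡 2) (𝓡 2) h z = fderiv ℝ h z := mfderiv_eq_fderiv
  exact ((congrArg (fun l : Plane →L[ℝ] Plane => l v) h1).symm.trans h4).trans
    ((congrArg (fun l : Plane →L[ℝ] Plane => l v) h2).trans
      (congrArg (fun l : Plane →L[ℝ] Plane => mfderiv (𝓡 2) (𝓡 2) e.symm (h z) (l v)) h5))

/-- Over `K` both sides are `k` times the area form in Darboux coordinates, which the plane map
preserves; elsewhere the lifted map is locally the identity. -/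
lemma IsSmoothChart.volumeForm_mfderiv_liftMap {e : OpenPartialHomeomorph M Plane}
    (he : IsSmoothChart e) {K : Set Plane} (hK : IsCompact K) (hKe : K ⊆ e.target)
    {h : Equiv.Perm Plane} (hh : h ∈ areaDiffeoGroup K)
    {μ : ∀ x : M, TangentSpace (𝓡 2) x →L[ℝ] TangentSpace (𝓡 2) x →L[ℝ] ℝ} {k : ℝ}
    (hμ : ∀ y ∈ e.target, ∀ v w : Plane,
      μ (e.symm y) (chartLift e y v) (chartLift e y w) = k * areaForm v w)
    (x : M) (v w : TangentSpace (𝓡 2) x) :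
    μ (liftMap e h x) (mfderiv (𝓡 2) (𝓡 2) (liftMap e h) x v)
      (mfderiv (𝓡 2) (𝓡 2) (liftMap e h) x w) = μ x v w := by
  have hcongr : ∀ (a b : M) (v w v' w' : Plane), a = b → v = v' → w = w' →
      μ a v w = μ b v' w' := by
    rintro a b v w v' w' rfl rfl rfl
    rfl
  by_cases hx : x ∈ e.symm '' K
  · obtain ⟨z, hzK, rfl⟩ := hx
    have hz := hKe hzK
    have hsurj : Function.Surjective (chartLift e z) :=
      he.mdifferentiable.symm.mfderiv_surjective hz
    obtain ⟨v, rfl⟩ := hsurj v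
    obtain ⟨w, rfl⟩ := hsurj w
    refine (hcongr _ (e.symm (h z)) _ _ _ _ (liftMap_symm h hz)
      (he.mfderiv_liftMap hK hKe hh hz v) (he.mfderiv_liftMap hK hKe hh hz w)).trans ?_
    exact (hμ _ (mapsTo_of_eqOn_compl hh.2.2.1 hKe hz) _ _).trans
      ((congrArg (k * ·) (hh.2.2.2 z v w)).trans (hμ z hz v w).symm)
  · have h1 : liftMap e h =ᶠ[𝓝 x] id := by
      filter_upwards [(isCompact_symm_image hK hKe).isClosed.isOpen_compl.mem_nhds hx] with y hy
      exact liftMap_eq_self hh.2.2.1 hy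
    have h2 : ∀ v : Plane, (mfderiv (𝓡 2) (𝓡 2) (liftMap e h) x v : Plane) = v := fun v =>
      (congrArg (fun l : Plane →L[ℝ] Plane => l v) h1.mfderiv_eq).trans
        (congrArg (fun l : Plane →L[ℝ] Plane => l v) (mfderiv_id (I := 𝓡 2) (x := x)))
    exact hcongr _ _ _ _ _ _ (liftMap_eq_self hh.2.2.1 hx) (h2 v) (h2 w)

end LiftMap

/-! ### The Sobolev norm of lifted Hamiltonian fields. -/

section SobolevBound

open Set Metric
open scoped Topology

lemma planeSobolevSq_zero (s : ℝ) : planeSobolevSq s (fun _ => 0) = 0 := by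
  have h : ∀ ξ, 𝓕 (fun _ : Plane => (0 : ℂ)) ξ = 0 := fun ξ => by simp [Real.fourier_eq]
  simp [planeSobolevSq, h]

variable {ι M : Type*} [TopologicalSpace M] [ChartedSpace Plane M] [IsManifold (𝓡 2) ∞ M]

namespace IsSmoothChart

variable {e κ : OpenPartialHomeomorph M Plane}

omit [IsManifold (𝓡 2) ∞ M] in
lemma contDiffOn_transition (he : IsSmoothChart e) (hκ : IsSmoothChart κ) :
    ContDiffOn ℝ ∞ (e.symm.trans κ) (e.symm.trans κ).source := by
  rw [← contMDiffOn_iff_contDiffOn, e.symm.trans_source]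
  exact hκ.contMDiffOn.comp (he.contMDiffOn_symm.mono inter_subset_left) fun x hx => hx.2

omit [IsManifold (𝓡 2) ∞ M] in
lemma mfderiv_chartLift (he : IsSmoothChart e) (hκ : IsSmoothChart κ) {z : Plane}
    (hz : z ∈ e.target) (hz' : e.symm z ∈ κ.source) (v : Plane) :
    (mfderiv (𝓡 2) (𝓡 2) κ (e.symm z) (chartLift e z v) : Plane) =
      fderiv ℝ (e.symm.trans κ) z v := by
  have h1 := mfderiv_comp z (hκ.mdifferentiable.mdifferentiableAt hz')
    (he.mdifferentiable.mdifferentiableAt_symm hz)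
  have h2 : mfderiv (𝓡 2) (𝓡 2) (κ ∘ e.symm) z = fderiv ℝ (κ ∘ e.symm) z := mfderiv_eq_fderiv
  exact (congrArg (fun l : Plane →L[ℝ] Plane => l v) h1).symm.trans
    (congrArg (fun l : Plane →L[ℝ] Plane => l v) h2)

end IsSmoothChart

/-- Antisymmetry of the area form. It turns a component of a Hamiltonian field into a derivative of
the Hamiltonian along a field that does not depend on it. -/
lemma map_symplecticDual (l m : Plane →L[ℝ] ℝ) : l (symplecticDual m) = m (-symplecticDual l) := by
  rw [map_neg, ← areaForm_symplecticDual l, ← areaForm_symplecticDual m, areaForm_swap]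

lemma SobolevAtlas.component_eq_zero (D : SobolevAtlas ι M) {i : ι} {u : CompactVectorField M}
    {L : Set M} (hu : ∀ x ∉ L, u.1 x = 0) (hi : ∀ x ∈ L, D.weight i x = 0) (k : Fin 2) :
    D.component i k u = fun _ => 0 := by
  funext y
  unfold SobolevAtlas.component
  split_ifs with hy
  · by_cases hx : (D.chart i).symm y ∈ L
    · rw [hi _ hx, zero_mul]
    · rw [hu _ hx, map_zero]
      exact mul_eq_zero_of_right _ (map_zero (EuclideanSpace.proj k : Plane →L[ℝ] ℝ))
  · rfl

-- Through the transition map `T`, the component is `Λ` applied to the Hamiltonian field, hence the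
-- derivative of `ψ` along the fixed field `-symplecticDual ∘ Λ`. After a cut-off this is the
-- situation of `exists_planeSobolevSq_pushForward_le`.
open Classical in
lemma exists_planeSobolevSq_component_le (D : SobolevAtlas ι M) {e : OpenPartialHomeomorph M Plane}
    (he : IsSmoothChart e) {K : Set Plane} (hK : IsCompact K) (hKe : K ⊆ e.target) (i : ι)
    (k : Fin 2) :
    ∃ C : ℝ≥0∞, C ≠ ⊤ ∧ ∀ (A : ℝ≥0∞) (n : ℕ) (ψ : Plane → ℝ) (u : CompactVectorField M), 0 < n →
      IsDyadicAverage K A n ψ → (∀ x, u.1 x = liftField e (hamField ψ) x) →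
      planeSobolevSq (-1 / 2) (D.component i k u) ≤ C * A / n := by
  have hκ := isSmoothChart_of_mem_maximalAtlas (D.chart_mem i)
  set κ := D.chart i
  let T := e.symm.trans κ
  have hTs : T.source = e.target ∩ e.symm ⁻¹' κ.source := e.symm.trans_source κ
  have hTt : T.target = κ.target ∩ κ.symm ⁻¹' e.source := e.symm.trans_target κ
  have hT : ContDiffOn ℝ ∞ T T.source := he.contDiffOn_transition hκ
  have hT' : ContDiffOn ℝ ∞ T.symm T.target := hκ.contDiffOn_transition he
  -- Where both the Hamiltonian and the weight can be nonzero. Subordination makes this a compact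
  -- subset of the domain of `T`, though `K` itself need not lie in it.
  let K' : Set Plane := K ∩ e.symm ⁻¹' tsupport (D.weight i)
  have hK' : IsCompact K' :=
    hK.of_isClosed_subset ((e.continuousOn_symm.mono hKe).preimage_isClosed_of_isClosed hK.isClosed
      (isClosed_tsupport _)) inter_subset_left
  have hK'T : K' ⊆ T.source := fun z hz => by
    rw [hTs]
    exact ⟨hKe hz.1, D.subordinate i hz.2⟩
  obtain ⟨θ, L, hθ, hL, hLT, hK'L, hθ1, hθ0, -⟩ := exists_smooth_cutoff hK' T.open_source hK'T
  let Λ : Plane → Plane →L[ℝ] ℝ := fun z =>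
    D.weight i (e.symm z) • (EuclideanSpace.proj k : Plane →L[ℝ] ℝ) ∘L fderiv ℝ T z
  have hΛ : ContDiffOn ℝ ∞ Λ T.source := by
    have h1 : ContDiffOn ℝ ∞ (fun z => D.weight i (e.symm z)) T.source := by
      rw [← contMDiffOn_iff_contDiffOn]
      exact (D.weight i).contMDiff.comp_contMDiffOn
        (he.contMDiffOn_symm.mono (hTs.subset.trans inter_subset_left))
    exact h1.smul (contDiffOn_const.clm_comp (hT.fderiv_of_isOpen T.open_source (by simp)))
  have ha0 : ∀ z ∉ L, θ z • -symplecticDual (Λ z) = 0 := fun z hz => by rw [hθ0 z hz, zero_smul]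
  let a : Plane → Plane := pushForward (OpenPartialHomeomorph.ofSet T.source T.open_source)
    fun z => θ z • -symplecticDual (Λ z)
  have haT : ∀ z ∈ T.source, a z = θ z • -symplecticDual (Λ z) := fun z hz =>
    pushForward_apply (OpenPartialHomeomorph.ofSet T.source T.open_source)
      (fun z => θ z • -symplecticDual (Λ z)) hz
  have ha : ContDiff ℝ ∞ a := by
    refine contDiff_pushForward (by simpa using contDiffOn_id) hL (by simpa using hLT) ha0 ?_
    exact hθ.contDiffOn.smul (symplecticDual.contDiff.comp_contDiffOn hΛ).neg
  have haL : ∀ z ∉ L, a z = 0 := fun z hz => by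
    by_cases hzT : z ∈ T.source
    · rw [haT z hzT, ha0 z hz]
    · exact if_neg hzT
  obtain ⟨C, hC, hbound⟩ := exists_planeSobolevSq_pushForward_le hT hT' ha hL hLT haL
  refine ⟨C, hC, fun A n ψ u hn hψ hu => ?_⟩
  convert! hbound K A n ψ hn hψ using 2
  funext y
  have hcomp : D.component i k u y = if y ∈ κ.target then D.weight i (κ.symm y) *
      (EuclideanSpace.proj k : Plane →L[ℝ] ℝ)
        (mfderiv (𝓡 2) (𝓡 2) κ (κ.symm y) (liftField e (hamField ψ) (κ.symm y))) else 0 := by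
    rw [← hu]
    rfl
  rw [hcomp]
  unfold pushForward
  by_cases hy : y ∈ T.target
  · rw [if_pos hy]
    have hzs := T.map_target hy
    have hy2 := hTt ▸ hy
    rw [if_pos hy2.1]
    obtain ⟨z, hz, hzy⟩ : ∃ z, T.symm y = z ∧ κ.symm y = e.symm z :=
      ⟨_, rfl, (e.left_inv hy2.2).symm⟩
    rw [hz] at hzs ⊢
    have hzs2 := hTs ▸ hzs
    have hfield : ∀ x, x = e.symm z → D.weight i x * (EuclideanSpace.proj k : Plane →L[ℝ] ℝ)
        (mfderiv (𝓡 2) (𝓡 2) κ x (liftField e (hamField ψ) x)) = Λ z (hamField ψ z) := by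
      rintro x rfl
      rw [he.liftField_symm hzs2.1]
      exact congrArg (fun v : Plane => D.weight i (e.symm z) *
        (EuclideanSpace.proj k : Plane →L[ℝ] ℝ) v)
        (he.mfderiv_chartLift hκ hzs2.1 hzs2.2 (hamField ψ z))
    rw [hfield _ hzy]
    beta_reduce
    rw [haT z hzs, hamField, map_symplecticDual,
      (fderiv ℝ ψ z).map_smul (θ z) (-symplecticDual (Λ z)), smul_eq_mul]
    -- The cut-off is harmless: it is one on `K'`, and off `K'` either the weight or the Hamiltonian
    -- field vanishes.
    by_cases hzK : z ∈ K'
    · have h1 : θ z = 1 := mem_of_mem_nhds (s := {x | θ x = 1}) (mem_nhdsSet_iff_forall.1 hθ1 z hzK)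
      rw [h1, one_mul]
    · have hzero : fderiv ℝ ψ z (-symplecticDual (Λ z)) = 0 := by
        by_cases hK1 : z ∈ K
        · have h0 : D.weight i (e.symm z) = 0 :=
            image_eq_zero_of_notMem_tsupport fun h => hzK ⟨hK1, h⟩
          simp [Λ, h0]
        · rw [← areaForm_hamField, hamField_eq_zero_of_eqOn hK.isClosed
            (fun z hz => hψ.eq_zero hz) hK1]
          simp
      rw [hzero, mul_zero]
  · rw [if_neg hy]
    split_ifs with hyκ
    · have hx : κ.symm y ∉ e.source := fun h => hy (hTt ▸ ⟨hyκ, h⟩)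
      have h0 : liftField e (hamField ψ) (κ.symm y) = 0 := if_neg hx
      rw [h0, map_zero]
      exact mul_eq_zero_of_right _ (map_zero (EuclideanSpace.proj k : Plane →L[ℝ] ℝ))
    · rfl

/-- By local finiteness only finitely many weights meet the compact image of `K`, so finitely many
component bounds add up. -/
theorem exists_sobolevSq_liftField_le [T2Space M] (D : SobolevAtlas ι M)
    {e : OpenPartialHomeomorph M Plane} (he : IsSmoothChart e) {K : Set Plane} (hK : IsCompact K)
    (hKe : K ⊆ e.target) :
    ∃ C : ℝ≥0∞, C ≠ ⊤ ∧ ∀ (A : ℝ≥0∞) (n : ℕ) (ψ : Plane → ℝ) (u : CompactVectorField M), 0 < n →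
      IsDyadicAverage K A n ψ → (∀ x, u.1 x = liftField e (hamField ψ) x) →
      D.sobolevSq (-1 / 2) u ≤ C * A / n := by
  choose C hC hbound using exists_planeSobolevSq_component_le D he hK hKe
  have hfin := D.weight.locallyFinite.finite_nonempty_inter_compact (isCompact_symm_image hK hKe)
  refine ⟨∑ i ∈ hfin.toFinset, ∑ k, C i k, by simp [hC], fun A n ψ u hn hψ hu => ?_⟩
  have hu0 : ∀ x ∉ e.symm '' K, u.1 x = 0 := fun x hx => by
    rw [hu]
    exact liftField_eq_zero (fun z hz => hamField_eq_zero_of_eqOn hK.isClosed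
      (fun z hz => hψ.eq_zero hz) hz) hx
  rw [SobolevAtlas.sobolevSq, tsum_eq_sum (s := hfin.toFinset)]
  · calc _ ≤ ∑ i ∈ hfin.toFinset, ∑ k, C i k * A / n :=
          Finset.sum_le_sum fun i _ => Finset.sum_le_sum fun k _ => hbound i k A n ψ u hn hψ hu
      _ = _ := by simp only [div_eq_mul_inv, Finset.sum_mul]
  · intro i hi
    refine Finset.sum_eq_zero fun k _ => ?_
    rw [D.component_eq_zero hu0 (fun x hx => ?_), planeSobolevSq_zero]
    by_contra hne
    exact hi (hfin.mem_toFinset.2 ⟨x, hne, hx⟩)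

end SobolevBound

/-! ### Paths on the surface and the vanishing of the geodesic distance. -/

section Degenerate

open Set Metric Filter
open scoped Topology

variable {M : Type*} [TopologicalSpace M] [ChartedSpace Plane M]

lemma VolumeDiffPath.length_le [IsManifold (𝓡 2) ∞ M]
    {μ : ∀ x : M, TangentSpace (𝓡 2) x →L[ℝ] TangentSpace (𝓡 2) x →L[ℝ] ℝ}
    {φ ψ : Diffeomorph (𝓡 2) (𝓡 2) M M ∞} (p : VolumeDiffPath μ φ ψ)
    {B : CompactVectorField M →ₗ[ℝ] CompactVectorField M →ₗ[ℝ] ℝ} {b : ℝ≥0∞}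
    (hb : ∀ t, ENNReal.ofReal (B (p.velocity t) (p.velocity t)) ≤ b) :
    p.length B ≤ b ^ (1 / 2 : ℝ) := by
  calc p.length B ≤ ∫⁻ _ in Icc (0 : ℝ) 1, b ^ (1 / 2 : ℝ) := by
        refine MeasureTheory.lintegral_mono fun t => ?_
        rcases le_or_gt (B (p.velocity t) (p.velocity t)) 0 with h | h
        · rw [Real.sqrt_eq_zero_of_nonpos h, ENNReal.ofReal_zero]
          exact zero_le
        · rw [Real.sqrt_eq_rpow, ← ENNReal.ofReal_rpow_of_pos h]
          exact ENNReal.rpow_le_rpow (hb t) (by norm_num)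
    _ = b ^ (1 / 2 : ℝ) := by simp

variable [T2Space M]

lemma IsSmoothChart.liftDiffeo_mem_volumeDiff {e : OpenPartialHomeomorph M Plane}
    (he : IsSmoothChart e) {K : Set Plane} (hK : IsCompact K) (hKe : K ⊆ e.target)
    {Φ : ℝ → Equiv.Perm Plane} (hΦ : ContDiff ℝ ∞ fun p : ℝ × Plane => Φ p.1 p.2)
    (hΦK : ∀ t, Φ t ∈ areaDiffeoGroup K) (hΦ0 : Φ 0 = 1)
    {μ : ∀ x : M, TangentSpace (𝓡 2) x →L[ℝ] TangentSpace (𝓡 2) x →L[ℝ] ℝ} {k : ℝ}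
    (hμ : ∀ y ∈ e.target, ∀ v w : Plane,
      μ (e.symm y) (chartLift e y v) (chartLift e y w) = k * areaForm v w) (t : ℝ) :
    he.liftDiffeo hK hKe (hΦK t) ∈ volumeDiff μ :=
  ⟨he.liftDiffeo_mem_compactDiff hK hKe hΦ hΦK hΦ0 t,
    fun x v w => he.volumeForm_mfderiv_liftMap hK hKe (hΦK t) hμ x v w⟩

variable [IsManifold (𝓡 2) ∞ M]

lemma exists_volumeDiffPath_of_hamReachable {e : OpenPartialHomeomorph M Plane}
    (he : IsSmoothChart e) {K : Set Plane} (hK : IsCompact K) (hKe : K ⊆ e.target)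
    {μ : ∀ x : M, TangentSpace (𝓡 2) x →L[ℝ] TangentSpace (𝓡 2) x →L[ℝ] ℝ} {k : ℝ}
    (hμ : ∀ y ∈ e.target, ∀ v w : Plane,
      μ (e.symm y) (chartLift e y v) (chartLift e y w) = k * areaForm v w)
    {S : Set (Plane → ℝ)} (hS : ∀ ψ ∈ S, ContDiff ℝ ∞ ψ ∧ ∀ z ∉ K, ψ z = 0)
    {h : Equiv.Perm Plane} (hh : h ∈ areaDiffeoGroup K) (hreach : HamReachable K S h) :
    ∃ p : VolumeDiffPath μ (Diffeomorph.refl (𝓡 2) M ∞) (he.liftDiffeo hK hKe hh),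
      ∀ t, ∃ ψ ∈ S, ∀ x, (p.velocity t).1 x = liftField e (hamField ψ) x := by
  obtain ⟨Φ, ψ, hΦK, hΦ, hΦ0, hΦ1, hψ, hd⟩ := hreach
  have hX0 : ∀ t, ∀ z ∉ K, hamField (ψ t) z = 0 := fun t z hz =>
    hamField_eq_zero_of_eqOn hK.isClosed (hS _ (hψ t)).2 hz
  exact ⟨{
    curve := fun t => he.liftDiffeo hK hKe (hΦK t)
    velocity := fun t => he.liftVectorField hK hKe (contDiff_hamField (hS _ (hψ t)).1) (hX0 t)
    smooth := isSmoothDiffPath_liftDiffeo he hK hKe hΦ hΦK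
    mem := fun t _ => he.liftDiffeo_mem_volumeDiff hK hKe hΦ hΦK hΦ0 hμ t
    start := he.liftDiffeo_one hK hKe _ hΦ0
    finish := by subst hΦ1; rfl
    hasDeriv := fun t _ x =>
      (he.hasMFDerivAt_liftMap hKe hΦK (hd t) x).hasMFDerivWithinAt },
    fun t => ⟨ψ t, hψ t, fun _ => rfl⟩⟩

end Degenerate

theorem corollary4p2 {ι M : Type*} [TopologicalSpace M] [T2Space M] [SigmaCompactSpace M]
    [Nonempty M] [ChartedSpace Plane M] [IsManifold (𝓡 2) ∞ M]
    (g : SurfaceMetric M)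
    (μ : ∀ x : M, TangentSpace (𝓡 2) x →L[ℝ] TangentSpace (𝓡 2) x →L[ℝ] ℝ)
    (hμ : IsRiemannianVolumeForm g μ)
    (D : SobolevAtlas ι M)
    (B : CompactVectorField M →ₗ[ℝ] CompactVectorField M →ₗ[ℝ] ℝ)
    (hB : IsSobolevInnerProduct D (-1 / 2) B) :
    ∃ φ ∈ volumeDiff μ, ∃ ψ ∈ volumeDiff μ, φ ≠ ψ ∧ geodesicDist μ B φ ψ = 0 := by
  obtain ⟨e, he, hKe, k, hk⟩ := hμ.exists_darboux_chart
  have hK := isCompact_closedBall (0 : Plane) 5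
  obtain ⟨h, hne, A, hA, hreach⟩ := exists_reachable_ne_one
  have hh : h ∈ areaDiffeoGroup (Metric.closedBall 0 5) := by
    obtain ⟨Φ, ψ, hΦK, -, -, rfl, -⟩ := hreach 1 one_pos
    exact hΦK 1
  obtain ⟨C, hC, hsob⟩ := exists_sobolevSq_liftField_le D he hK hKe
  obtain ⟨C', -, hcomp⟩ := hB.comparable _ (isCompact_symm_image hK hKe)
  -- The end points are the same for every `n`, while the length bound is of order `n^(-1/2)`.
  have hpath : ∀ n : ℕ, 0 < n →
      ∃ p : VolumeDiffPath μ (Diffeomorph.refl (𝓡 2) M ∞) (he.liftDiffeo hK hKe hh),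
        p.length B ≤ (ENNReal.ofReal C' * (C * A / n)) ^ (1 / 2 : ℝ) := by
    intro n hn
    obtain ⟨p, hp⟩ := exists_volumeDiffPath_of_hamReachable he hK hKe hk
      (fun ψ hψ => ⟨hψ.contDiff, fun z hz => hψ.eq_zero hz⟩) hh (hreach n hn)
    refine ⟨p, p.length_le fun t => ?_⟩
    obtain ⟨ψ, hψ, hv⟩ := hp t
    refine (hcomp (p.velocity t) fun x hx => ?_).1.trans ?_
    · rw [hv]
      exact liftField_eq_zero (fun z hz => hamField_eq_zero_of_eqOn hK.isClosed
        (fun z hz => hψ.eq_zero hz) hz) hx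
    · gcongr
      exact hsob A n ψ _ hn hψ hv
  obtain ⟨p, -⟩ := hpath 1 one_pos
  refine ⟨_, p.start ▸ p.mem 0 ⟨le_rfl, zero_le_one⟩, _, p.finish ▸ p.mem 1 ⟨zero_le_one, le_rfl⟩,
    fun heq => hne ?_, le_antisymm ?_ zero_le⟩
  -- Were the lifted map the identity, injectivity of `e.symm` on the chart would force `h` to be
  -- the identity.
  · ext1 z
    by_cases hz : z ∈ e.target
    · have h1 := congrArg (fun φ : Diffeomorph (𝓡 2) (𝓡 2) M M ∞ => φ (e.symm z)) heq
      have h2 : e.symm z = e.symm (h z) := h1.trans (liftMap_symm h hz)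
      exact (e.symm.injOn hz (mapsTo_of_eqOn_compl hh.2.2.1 hKe hz) h2).symm
    · exact hh.2.2.1 z fun hzK => hz (hKe hzK)
  · have hlim : Filter.Tendsto (fun n : ℕ => (ENNReal.ofReal C' * (C * A / n)) ^ (1 / 2 : ℝ))
        Filter.atTop (nhds 0) := by
      have h1 : Filter.Tendsto (fun n : ℕ => C * A / (n : ℝ≥0∞)) Filter.atTop (nhds 0) := by
        simp only [div_eq_mul_inv]
        have := ENNReal.Tendsto.const_mul (a := C * A) ENNReal.tendsto_inv_nat_nhds_zero
          (Or.inr (ENNReal.mul_ne_top hC hA))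
        simpa using this
      have h2 := ENNReal.Tendsto.const_mul (a := ENNReal.ofReal C') h1 (Or.inr ENNReal.ofReal_ne_top)
      rw [mul_zero] at h2
      have h3 := (ENNReal.continuous_rpow_const (y := (1 / 2 : ℝ))).tendsto 0 |>.comp h2
      simpa [Function.comp_def] using h3
    refine ge_of_tendsto hlim ?_
    filter_upwards [Filter.eventually_gt_atTop 0] with n hn
    obtain ⟨p, hp⟩ := hpath n hn
    exact (iInf_le _ p).trans hp
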